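/- Let $n\ge 1$, let $\mathbb T^n=\mathbb R^n/\mathbb Z^n$, and let $r,q$ be exponents with $\frac{n}{2q}+\frac1r\le 1$, where $r\in[1,\infty)$ and $q\in(n/2,\infty]$ if $n\ge2$, while $r\in[1,2]$ and $q\in[1,\infty]$ if $n=1$. Then there are a number $C_1=C_1(n,q,r,M)$ for every $M\ge 0$ and a number $C_2=C_2(n,q,r,M,T)$ for every $M\ge0$ and $T>0$ such that the following holds. Let $T>0$, $Q_T=\mathbb T^n\times(0,T)$, let $b:Q_T\to\mathbb R^n$ be a vector field with $b\in L^1(0,T;L^2(\mathbb T^n))$ whose distributional spatial divergence satisfies $\mathrm{div}(b)\in L^r(0,T;L^q(\mathbb T^n))$, set $M=\|\mathrm{div}(b)\|_{L^r(0,T;L^q(\mathbb T^n))}$, and let $\rho_0\in L^2(\mathbb T^n)$. Let $$\rho\in\mathcal H^1_2(Q_T):=\{u\in L^2(0,T;H^1(\mathbb T^n)):\ \partial_tu\in L^2(0,T;H^{-1}(\mathbb T^n))\}$$ be a weak solution of $$\partial_t\rho-\Delta\rho+\mathrm{div}(b\rho)=0\ \text{ in } Q_T,\qquad \rho(\cdot,0)=\rho_0\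 \text{ in }\mathbb T^n,$$ that is, $$\int_0^T\!\!\int_{\mathbb T^n}\big(-\rho\,\partial_t\varphi+D\rho\cdot D\varphi-\rho\, b\cdot D\varphi\big)\,dx\,dt=\int_{\mathbb T^n}\rho_0\,\varphi(\cdot,0)\,dx$$ for all smooth $\varphi$ on $\mathbb T^n\times\mathbb R$ that vanish for $t>s$ for some $s<T$. Then $\rho$ has a representative in $C([0,T];L^2(\mathbb T^n))$ with $\rho(\cdot,0)=\rho_0$, and this representative satisfies $$\|\rho(\cdot,t)\|_{L^2(\mathbb T^n)}\le C_1\,\|\rho_0\|_{L^2(\mathbb T^n)}\qquad\text{for all }t\in[0,T].$$ Moreover, $$\int_0^T\!\!\int_{\mathbb T^n}|D\rho(x,t)|^2\,dx\,dt\le C_2\,\|\rho_0\|_{L^2(\mathbb T^n)}^2 .$$ -/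

import Mathlib

open MeasureTheory Set
open scoped ENNReal ContDiff

noncomputable section

namespace FokkerPlanck

/-- The flat torus `ℝⁿ / ℤⁿ`; its `volume` is Lebesgue measure, of total mass `1`. -/
abbrev Torus (n : ℕ) : Type := UnitAddTorus (Fin n)

/-- Vectors of `ℝⁿ` with the Euclidean norm. -/
abbrev Vec (n : ℕ) : Type := EuclideanSpace ℝ (Fin n)

/-- The covering map `ℝⁿ → ℝⁿ / ℤⁿ`. -/
def proj (n : ℕ) (x : Fin n → ℝ) : Torus n := fun i => (x i : UnitAddCircle)

/-- `C^∞` functions on the torus. -/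
def SmoothOnTorus {n : ℕ} (φ : Torus n → ℝ) : Prop :=
  ContDiff ℝ ∞ (fun x : Fin n → ℝ => φ (proj n x))

/-- `C^∞` functions of `(t, x) ∈ ℝ × 𝕋ⁿ`. -/
def SmoothOnSpaceTime {n : ℕ} (φ : ℝ → Torus n → ℝ) : Prop :=
  ContDiff ℝ ∞ (fun p : ℝ × (Fin n → ℝ) => φ p.1 (proj n p.2))

/-- The classical partial derivative `∂ᵢ φ` on the torus. -/
def partialDeriv {n : ℕ} (i : Fin n) (φ : Torus n → ℝ) (x : Torus n) : ℝ :=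
  deriv (fun s : ℝ => φ (x + Pi.single i (s : UnitAddCircle))) 0

/-- The classical gradient `D φ` on the torus. -/
def grad {n : ℕ} (φ : Torus n → ℝ) (x : Torus n) : Vec n :=
  WithLp.toLp 2 (fun i => partialDeriv i φ x)

/-- `L²(𝕋ⁿ)`. -/
abbrev L2 (n : ℕ) : Type := Lp ℝ 2 (volume : Measure (Torus n))

/-- `L²(𝕋ⁿ; ℝⁿ)`. -/
abbrev L2Vec (n : ℕ) : Type := Lp (Vec n) 2 (volume : Measure (Torus n))

/-- `G` is the weak (distributional) gradient of `u` on the torus. -/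
def IsWeakGrad {n : ℕ} (u : L2 n) (G : L2Vec n) : Prop :=
  ∀ φ : Torus n → ℝ, SmoothOnTorus φ → ∀ i : Fin n,
    ∫ x, u x * partialDeriv i φ x = -∫ x, G x i * φ x

theorem proj_isOpenQuotientMap (n : ℕ) : IsOpenQuotientMap (proj n) :=
  IsOpenQuotientMap.piMap (f := fun (_ : Fin n) (s : ℝ) => (s : UnitAddCircle))
    (fun _ => QuotientAddGroup.isOpenQuotientMap_mk)

theorem SmoothOnTorus.continuous {n : ℕ} {φ : Torus n → ℝ} (hφ : SmoothOnTorus φ) :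
    Continuous φ :=
  (proj_isOpenQuotientMap n).isQuotientMap.continuous_iff.2 (ContDiff.continuous hφ)

theorem SmoothOnTorus.partialDeriv_proj {n : ℕ} {φ : Torus n → ℝ} (hφ : SmoothOnTorus φ)
    (i : Fin n) (x : Fin n → ℝ) :
    partialDeriv i φ (proj n x) =
      fderiv ℝ (fun y : Fin n → ℝ => φ (proj n y)) x (Pi.single i 1) := by
  have h1 : HasFDerivAt (fun y : Fin n → ℝ => φ (proj n y))
      (fderiv ℝ (fun y : Fin n → ℝ => φ (proj n y)) x) (x + (0 : ℝ) • Pi.single i 1) := by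
    rw [zero_smul, add_zero]
    exact ((ContDiff.differentiable hφ (by simp)) x).hasFDerivAt
  have h2 : HasDerivAt (fun s : ℝ => x + s • (Pi.single i 1 : Fin n → ℝ))
      (Pi.single i 1) 0 := by
    simpa using ((hasDerivAt_id (0 : ℝ)).smul_const (Pi.single i 1 : Fin n → ℝ)).const_add x
  have h3 := (h1.comp_hasDerivAt (0 : ℝ) h2).deriv
  rw [← h3]
  unfold partialDeriv
  congr 1
  funext s
  simp only [Function.comp]
  congr 1
  funext j
  by_cases hj : j = i
  · subst hj
    simp [proj]
  · simp [proj, hj]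

theorem SmoothOnTorus.continuous_partialDeriv {n : ℕ} {φ : Torus n → ℝ}
    (hφ : SmoothOnTorus φ) (i : Fin n) : Continuous (partialDeriv i φ) := by
  refine (proj_isOpenQuotientMap n).isQuotientMap.continuous_iff.2 ?_
  have h : (partialDeriv i φ ∘ proj n) = fun x =>
      fderiv ℝ (fun y : Fin n → ℝ => φ (proj n y)) x (Pi.single i 1) :=
    funext fun x => hφ.partialDeriv_proj i x
  rw [h]
  exact (ContDiff.continuous_fderiv hφ (by simp)).clm_apply continuous_const

theorem integrable_L2_mul {n : ℕ} (u : L2 n) {f : Torus n → ℝ} (hf : Continuous f) :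
    Integrable (fun x => u x * f x) :=
  MemLp.integrable_mul (p := 2) (q := 2) (Lp.memLp u)
    (hf.memLp_of_hasCompactSupport (HasCompactSupport.of_compactSpace f))

theorem integrable_L2Vec_mul {n : ℕ} (G : L2Vec n) (i : Fin n) {f : Torus n → ℝ}
    (hf : Continuous f) : Integrable (fun x => G x i * f x) := by
  have h : MemLp (fun x => G x i) 2 (volume : Measure (Torus n)) :=
    (EuclideanSpace.proj (𝕜 := ℝ) i).comp_memLp' (Lp.memLp G)
  exact MemLp.integrable_mul (p := 2) (q := 2) h
    (hf.memLp_of_hasCompactSupport (HasCompactSupport.of_compactSpace f))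

/-- The Sobolev space `H¹(𝕋ⁿ)`, realised as the space of all pairs `(u, Du)` with `u ∈ L²` and
weak gradient `Du ∈ L²`; its norm is `(‖u‖² + ‖Du‖²)^{1/2}`. -/
def H1 (n : ℕ) : Submodule ℝ (WithLp 2 (L2 n × L2Vec n)) where
  carrier := {p | IsWeakGrad p.fst p.snd}
  zero_mem' := by
    intro φ _ i
    have h1 : ∀ᵐ x, (0 : L2 n) x * partialDeriv i φ x = 0 := by
      filter_upwards [Lp.coeFn_zero ℝ 2 (volume : Measure (Torus n))] with x hx
      rw [hx]; simp
    have h2 : ∀ᵐ x, (0 : L2Vec n) x i * φ x = 0 := by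
      filter_upwards [Lp.coeFn_zero (Vec n) 2 (volume : Measure (Torus n))] with x hx
      rw [hx]; simp
    change ∫ x, (0 : L2 n) x * partialDeriv i φ x = -∫ x, (0 : L2Vec n) x i * φ x
    rw [integral_eq_zero_of_ae h1, integral_eq_zero_of_ae h2, neg_zero]
  add_mem' := by
    intro p q hp hq φ hφ i
    have h1 : ∫ x, (p.fst + q.fst) x * partialDeriv i φ x =
        ∫ x, (p.fst x * partialDeriv i φ x + q.fst x * partialDeriv i φ x) := by
      refine integral_congr_ae ?_
      filter_upwards [Lp.coeFn_add p.fst q.fst] with x hx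
      rw [hx, Pi.add_apply, add_mul]
    have h2 : ∫ x, (p.snd + q.snd) x i * φ x =
        ∫ x, (p.snd x i * φ x + q.snd x i * φ x) := by
      refine integral_congr_ae ?_
      filter_upwards [Lp.coeFn_add p.snd q.snd] with x hx
      rw [hx, Pi.add_apply, PiLp.add_apply, add_mul]
    change ∫ x, (p.fst + q.fst) x * partialDeriv i φ x = -∫ x, (p.snd + q.snd) x i * φ x
    rw [h1, h2, integral_add (integrable_L2_mul _ (hφ.continuous_partialDeriv i))
      (integrable_L2_mul _ (hφ.continuous_partialDeriv i)),
      integral_add (integrable_L2Vec_mul _ i hφ.continuous)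
      (integrable_L2Vec_mul _ i hφ.continuous), hp φ hφ i, hq φ hφ i, neg_add]
  smul_mem' := by
    intro c p hp φ hφ i
    have h1 : ∫ x, (c • p.fst) x * partialDeriv i φ x =
        ∫ x, c * (p.fst x * partialDeriv i φ x) := by
      refine integral_congr_ae ?_
      filter_upwards [Lp.coeFn_smul c p.fst] with x hx
      rw [hx, Pi.smul_apply, smul_eq_mul, mul_assoc]
    have h2 : ∫ x, (c • p.snd) x i * φ x = ∫ x, c * (p.snd x i * φ x) := by
      refine integral_congr_ae ?_
      filter_upwards [Lp.coeFn_smul c p.snd] with x hx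
      rw [hx, Pi.smul_apply, PiLp.smul_apply, smul_eq_mul, mul_assoc]
    change ∫ x, (c • p.fst) x * partialDeriv i φ x = -∫ x, (c • p.snd) x i * φ x
    rw [h1, h2, integral_const_mul, integral_const_mul, hp φ hφ i, mul_neg]

/-- The underlying `L²` function of an element of `H¹(𝕋ⁿ)`. -/
def H1.toL2 {n : ℕ} (u : H1 n) : L2 n := u.val.fst

/-- The weak gradient of an element of `H¹(𝕋ⁿ)`. -/
def H1.weakGrad {n : ℕ} (u : H1 n) : L2Vec n := u.val.snd

/-- `H⁻¹(𝕋ⁿ)`, the dual space of `H¹(𝕋ⁿ)` with the dual norm. -/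
abbrev HNeg1 (n : ℕ) : Type := StrongDual ℝ (H1 n)

/-- Lebesgue measure on the time interval `(0,T)`. -/
def timeMeasure (T : ℝ) : Measure ℝ := volume.restrict (Ioo 0 T)

/-- `g` is the distributional time derivative on `(0,T)` of `u`, in the sense of
`H⁻¹(𝕋ⁿ)`-valued distributions; here `H¹ ⊆ L² ⊆ H⁻¹` through the `L²` inner product. -/
def IsWeakTimeDeriv {n : ℕ} (T : ℝ) (u : ℝ → H1 n) (g : ℝ → HNeg1 n) : Prop :=
  ∀ η : ℝ → ℝ, ContDiff ℝ ∞ η → HasCompactSupport η → tsupport η ⊆ Ioo 0 T → ∀ v : H1 n,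
    ∫ t, deriv η t * inner ℝ (H1.toL2 (u t)) (H1.toL2 v) ∂(timeMeasure T) =
      -∫ t, η t * g t v ∂(timeMeasure T)

/-- The parabolic class `𝓗¹₂(Q_T)`: `u ∈ L²(0,T;H¹)` and `∂ₜu ∈ L²(0,T;H⁻¹)`. -/
def InParabolicClass {n : ℕ} (T : ℝ) (u : ℝ → H1 n) : Prop :=
  MemLp u 2 (timeMeasure T) ∧
    ∃ g : ℝ → HNeg1 n, MemLp g 2 (timeMeasure T) ∧ IsWeakTimeDeriv T u g

/-- The norm of `L^r(0,T; L^q(𝕋ⁿ))`, with values in `[0,∞]`. -/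
def mixedNorm {n : ℕ} {E : Type*} [NormedAddCommGroup E] (T : ℝ) (r q : ℝ≥0∞)
    (f : ℝ → Torus n → E) : ℝ≥0∞ :=
  eLpNorm (fun t => eLpNorm (f t) q volume) r (timeMeasure T)

/-- `f ∈ L^r(0,T; L^q(𝕋ⁿ))`. -/
def MemMixed {n : ℕ} {E : Type*} [NormedAddCommGroup E] (T : ℝ) (r q : ℝ≥0∞)
    (f : ℝ → Torus n → E) : Prop :=
  AEStronglyMeasurable (Function.uncurry f)
      ((timeMeasure T).prod (volume : Measure (Torus n))) ∧
    mixedNorm T r q f < ⊤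

/-- The function `d` on `Q_T = 𝕋ⁿ × (0,T)` is the distributional spatial divergence of the
vector field `b`. -/
def IsWeakDiv {n : ℕ} (T : ℝ) (b : ℝ → Torus n → Vec n) (d : ℝ → Torus n → ℝ) : Prop :=
  ∀ φ : ℝ → Torus n → ℝ, SmoothOnSpaceTime φ →
    (∃ s₀ s₁ : ℝ, 0 < s₀ ∧ s₁ < T ∧ ∀ t, t ∉ Icc s₀ s₁ → ∀ x, φ t x = 0) →
    ∫ t, (∫ x, inner ℝ (b t x) (grad (φ t) x)) ∂(timeMeasure T) =
      -∫ t, (∫ x, d t x * φ t x) ∂(timeMeasure T)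

/-- `ρ` is a weak solution of `∂ₜρ - Δρ + div(bρ) = 0` in `𝕋ⁿ × (0,T)`, `ρ(·,0) = ρ₀`:
the test functions are smooth on `𝕋ⁿ × [0,T]` and vanish for `t` near `T`. -/
def IsWeakSolution {n : ℕ} (T : ℝ) (b : ℝ → Torus n → Vec n) (ρ₀ : L2 n) (ρ : ℝ → H1 n) :
    Prop :=
  ∀ φ : ℝ → Torus n → ℝ, SmoothOnSpaceTime φ →
    (∃ s₁ : ℝ, s₁ < T ∧ ∀ t, s₁ < t → ∀ x, φ t x = 0) →
    ∫ t, (∫ x, (-(H1.toL2 (ρ t) x * deriv (fun s => φ s x) t)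
        + inner ℝ (H1.weakGrad (ρ t) x) (grad (φ t) x)
        - H1.toL2 (ρ t) x * inner ℝ (b t x) (grad (φ t) x))) ∂(timeMeasure T) =
      ∫ x, ρ₀ x * φ 0 x

/-- The admissible exponents: `n/(2q) + 1/r ≤ 1`, with `r ∈ [1,∞)`, `q ∈ (n/2,∞]` if `n ≥ 2`,
and `r ∈ [1,2]`, `q ∈ [1,∞]` if `n = 1`. -/
def AdmissibleExponents (n : ℕ) (q r : ℝ≥0∞) : Prop :=
  (n : ℝ≥0∞) / (2 * q) + 1 / r ≤ 1 ∧
    ((2 ≤ n ∧ 1 ≤ r ∧ r < ⊤ ∧ (n : ℝ≥0∞) / 2 < q) ∨ (n = 1 ∧ 1 ≤ r ∧ r ≤ 2 ∧ 1 ≤ q))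

end FokkerPlanck

end

open MeasureTheory Set
open scoped ENNReal ContDiff

noncomputable section

namespace FokkerPlanck

open Filter Topology

variable {n : ℕ}

/-! The proof is an energy estimate. Formally, testing the equation with ρ gives d/dt ‖ρ‖² + 2‖Dρ‖²
= -∫ div(b) ρ², so only div(b), and not b, enters the constants. Three points need work.

The first is that ρ is not a legitimate test function: b is only L² in space and ρ is unbounded, so
ρ b·Dρ need not be integrable. The equation itself, however, exhibits div(bρ) as an element of H⁻¹
at almost every time, and `pairing_eq_half_integral_div` computes its pairing with ρ through bounded
truncations T_ε(ρ). With S_ε' = T_ε one has b·Dρ T_ε(ρ) = b·D(S_ε(ρ)), which integrates to -∫ div(b)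
S_ε(ρ); letting ε → 0 is dominated by |div(b)| ρ². Time regularity is separate:
`IsWeakTimeDeriv.exists_continuous_representative` gives continuity into L² and the energy identity
for any member of the parabolic class, and `IsWeakSolution.ae_slice_and_initial` localises the
equation to time slices. `slice_energy_eq` combines the slice identities.

The second is to absorb ∫ |div(b)| ρ² into the Dirichlet energy. With s = n/(2q),
`exists_weighted_gagliardoNirenberg` bounds it by C ‖div(b)‖_q (N^{2s} ‖ρ‖² + N^{2s-2} ‖Dρ‖²) for
every N ≥ 1. It comes from splitting frequencies dyadically above N and applying Bernstein's
inequality to each block; s < 1 makes the sum converge. Choosing N so that the gradient term is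
small costs ‖div(b)‖_q^{1/(1-s)}, and the exponent condition says exactly 1/(1-s) ≤ r
(`exists_weighted_energy_bound`).

The third is that C₁ must not depend on T. The mean of ρ is conserved, since the constant function
is a test function, and Poincaré's inequality bounds ‖ρ‖² minus the squared mean by ‖Dρ‖². The
remaining Dirichlet energy is thus a damping term, and Grönwall's inequality with damping
(`gronwall_damped`, `energy_bounds`) gives a bound in terms of ∫ ‖div(b)‖_q^r dt alone. -/

/-! ### Calculus of smooth functions on the torus -/

theorem torus_volume_eq (n : ℕ) :
    (volume : Measure (Torus n)) = Measure.pi (fun _ => AddCircle.haarAddCircle) := by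
  simp [volume_pi, AddCircle.volume_eq_smul_haarAddCircle]

instance : IsProbabilityMeasure (volume : Measure (Torus n)) := by
  rw [torus_volume_eq]; infer_instance

theorem proj_surjective (n : ℕ) : Function.Surjective (proj n) :=
  (proj_isOpenQuotientMap n).surjective

theorem proj_add_single (x : Fin n → ℝ) (i : Fin n) (s : ℝ) :
    proj n (x + s • Pi.single i 1) = proj n x + Pi.single i (s : UnitAddCircle) := by
  funext j
  by_cases hj : j = i
  · subst hj; simp [proj]
  · simp [proj, hj]

theorem _root_.Continuous.memLp_torus {E : Type*} [NormedAddCommGroup E] {f : Torus n → E}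
    (hf : Continuous f) (p : ℝ≥0∞) : MemLp f p (volume : Measure (Torus n)) :=
  hf.memLp_of_hasCompactSupport (HasCompactSupport.of_compactSpace f)

theorem _root_.Continuous.integrable_torus {E : Type*} [NormedAddCommGroup E] {f : Torus n → E}
    (hf : Continuous f) : Integrable f :=
  memLp_one_iff_integrable.1 (hf.memLp_torus 1)

theorem _root_.Continuous.exists_bound_torus {E : Type*} [NormedAddCommGroup E] {f : Torus n → E}
    (hf : Continuous f) : ∃ B : ℝ, 0 ≤ B ∧ ∀ x, ‖f x‖ ≤ B := by
  obtain ⟨B, hB⟩ := isCompact_univ.exists_bound_of_continuousOn hf.continuousOn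
  exact ⟨B, (norm_nonneg _).trans (hB 0 (mem_univ _)), fun x => hB x (mem_univ _)⟩

namespace SmoothOnTorus

variable {φ ψ : Torus n → ℝ}

theorem const (c : ℝ) : SmoothOnTorus (fun _ : Torus n => c) := contDiff_const

theorem add (hφ : SmoothOnTorus φ) (hψ : SmoothOnTorus ψ) :
    SmoothOnTorus (fun x => φ x + ψ x) := ContDiff.add hφ hψ

theorem mul (hφ : SmoothOnTorus φ) (hψ : SmoothOnTorus ψ) :
    SmoothOnTorus (fun x => φ x * ψ x) := ContDiff.mul hφ hψ

theorem comp {F : ℝ → ℝ} (hF : ContDiff ℝ ∞ F) (hφ : SmoothOnTorus φ) :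
    SmoothOnTorus (fun x => F (φ x)) := ContDiff.comp hF hφ

theorem sum {ι : Type*} (A : Finset ι) {f : ι → Torus n → ℝ} (hf : ∀ i ∈ A, SmoothOnTorus (f i)) :
    SmoothOnTorus (fun x => ∑ i ∈ A, f i x) := ContDiff.sum hf

theorem hasDerivAt (hφ : SmoothOnTorus φ) (i : Fin n) (x : Torus n) (s : ℝ) :
    HasDerivAt (fun s : ℝ => φ (x + Pi.single i (s : UnitAddCircle)))
      (FokkerPlanck.partialDeriv i φ (x + Pi.single i (s : UnitAddCircle))) s := by
  obtain ⟨y, rfl⟩ := proj_surjective n x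
  simp only [← proj_add_single]
  rw [hφ.partialDeriv_proj]
  have h1 := ((ContDiff.differentiable hφ (by simp)) (y + s • Pi.single i 1)).hasFDerivAt
  have h2 : HasDerivAt (fun s : ℝ => y + s • (Pi.single i 1 : Fin n → ℝ)) (Pi.single i 1) s := by
    simpa using ((hasDerivAt_id s).smul_const (Pi.single i 1 : Fin n → ℝ)).const_add y
  exact h1.comp_hasDerivAt s h2

theorem hasDerivAt_zero (hφ : SmoothOnTorus φ) (i : Fin n) (x : Torus n) :
    HasDerivAt (fun s : ℝ => φ (x + Pi.single i (s : UnitAddCircle)))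
      (FokkerPlanck.partialDeriv i φ x) 0 := by
  simpa using hφ.hasDerivAt i x 0

theorem partialDeriv_add (hφ : SmoothOnTorus φ) (hψ : SmoothOnTorus ψ) (i : Fin n) (x : Torus n) :
    FokkerPlanck.partialDeriv i (fun x => φ x + ψ x) x =
      FokkerPlanck.partialDeriv i φ x + FokkerPlanck.partialDeriv i ψ x :=
  ((hφ.hasDerivAt_zero i x).add (hψ.hasDerivAt_zero i x)).deriv

theorem partialDeriv_mul (hφ : SmoothOnTorus φ) (hψ : SmoothOnTorus ψ) (i : Fin n) (x : Torus n) :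
    FokkerPlanck.partialDeriv i (fun x => φ x * ψ x) x =
      FokkerPlanck.partialDeriv i φ x * ψ x + φ x * FokkerPlanck.partialDeriv i ψ x := by
  simpa [FokkerPlanck.partialDeriv] using
    ((hφ.hasDerivAt_zero i x).fun_mul (hψ.hasDerivAt_zero i x)).deriv

theorem partialDeriv_comp {F : ℝ → ℝ} {F' : ℝ → ℝ} (hF : ∀ s, HasDerivAt F (F' s) s)
    (hφ : SmoothOnTorus φ) (i : Fin n) (x : Torus n) :
    FokkerPlanck.partialDeriv i (fun x => F (φ x)) x =
      F' (φ x) * FokkerPlanck.partialDeriv i φ x := by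
  have h := hφ.hasDerivAt_zero i x
  have h2 : HasDerivAt F (F' (φ x)) (φ (x + Pi.single i ((0 : ℝ) : UnitAddCircle))) := by
    simpa using hF (φ x)
  exact (h2.comp (0 : ℝ) h).deriv

theorem partialDeriv_const (c : ℝ) (i : Fin n) (x : Torus n) :
    FokkerPlanck.partialDeriv i (fun _ => c) x = 0 := by
  simp [FokkerPlanck.partialDeriv]

theorem partialDeriv_const_mul (c : ℝ) (φ : Torus n → ℝ) (i : Fin n) (x : Torus n) :
    FokkerPlanck.partialDeriv i (fun x => c * φ x) x = c * FokkerPlanck.partialDeriv i φ x := by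
  simp [FokkerPlanck.partialDeriv]

theorem continuous_grad (hφ : SmoothOnTorus φ) : Continuous (grad φ) := by
  unfold grad
  exact (PiLp.continuous_toLp 2 _).comp (continuous_pi fun i => hφ.continuous_partialDeriv i)

/-- By translation invariance the integral of φ shifted by s in direction i is constant in s;
differentiating under the integral at s = 0 gives the claim. -/
theorem integral_partialDeriv (hφ : SmoothOnTorus φ) (i : Fin n) :
    ∫ x, FokkerPlanck.partialDeriv i φ x = 0 := by
  obtain ⟨B, _, hB⟩ := (hφ.continuous_partialDeriv i).exists_bound_torus
  have hc := hφ.continuous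
  have hc' := hφ.continuous_partialDeriv i
  have key := (hasDerivAt_integral_of_dominated_loc_of_deriv_le (𝕜 := ℝ)
    (μ := (volume : Measure (Torus n))) (s := univ) (x₀ := (0 : ℝ))
    (F := fun (s : ℝ) x => φ (x + Pi.single i (s : UnitAddCircle)))
    (F' := fun (s : ℝ) x => FokkerPlanck.partialDeriv i φ (x + Pi.single i (s : UnitAddCircle)))
    (bound := fun _ => B) univ_mem
    (Eventually.of_forall fun s => (hc.comp (by fun_prop)).aestronglyMeasurable)
    ((hc.comp (by fun_prop)).integrable_torus)
    ((hc'.comp (by fun_prop)).aestronglyMeasurable)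
    (Eventually.of_forall fun x s _ => hB _) (integrable_const B)
    (Eventually.of_forall fun x s _ => hφ.hasDerivAt i x s)).2
  simp only [integral_add_right_eq_self (fun x => φ x)] at key
  simpa using key.unique (hasDerivAt_const _ _)

theorem integral_mul_partialDeriv (hφ : SmoothOnTorus φ) (hψ : SmoothOnTorus ψ) (i : Fin n) :
    ∫ x, φ x * FokkerPlanck.partialDeriv i ψ x = -∫ x, FokkerPlanck.partialDeriv i φ x * ψ x := by
  have h := (hφ.mul hψ).integral_partialDeriv i
  simp only [hφ.partialDeriv_mul hψ] at h
  rw [integral_add (f := fun x => FokkerPlanck.partialDeriv i φ x * ψ x)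
    (g := fun x => φ x * FokkerPlanck.partialDeriv i ψ x)
    ((hφ.continuous_partialDeriv i).mul hψ.continuous).integrable_torus
    (hφ.continuous.mul (hψ.continuous_partialDeriv i)).integrable_torus] at h
  linarith

end SmoothOnTorus

theorem grad_apply (φ : Torus n → ℝ) (x : Torus n) (i : Fin n) :
    grad φ x i = partialDeriv i φ x := rfl

theorem grad_const_mul (c : ℝ) (φ : Torus n → ℝ) (x : Torus n) :
    grad (fun x => c * φ x) x = c • grad φ x := by
  ext i; simp [grad_apply, SmoothOnTorus.partialDeriv_const_mul]

theorem grad_mul {φ ψ : Torus n → ℝ} (hφ : SmoothOnTorus φ) (hψ : SmoothOnTorus ψ) (x : Torus n) :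
    grad (fun x => φ x * ψ x) x = ψ x • grad φ x + φ x • grad ψ x := by
  ext i; simp [grad_apply, hφ.partialDeriv_mul hψ]; ring

theorem grad_comp {F F' : ℝ → ℝ} (hF : ∀ s, HasDerivAt F (F' s) s) {φ : Torus n → ℝ}
    (hφ : SmoothOnTorus φ) (x : Torus n) :
    grad (fun x => F (φ x)) x = F' (φ x) • grad φ x := by
  ext i; simp [grad_apply, SmoothOnTorus.partialDeriv_comp hF hφ]

/-! ### Smooth functions inside H¹, and norms as integrals -/

/-- A smooth function as an element of `H¹`. -/
def H1.ofSmooth (φ : Torus n → ℝ) (hφ : SmoothOnTorus φ) : H1 n :=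
  ⟨WithLp.toLp 2 ((hφ.continuous.memLp_torus 2).toLp φ,
    (hφ.continuous_grad.memLp_torus 2).toLp (grad φ)), by
    intro ψ hψ i
    have h1 : ∫ x, (hφ.continuous.memLp_torus 2).toLp φ x * partialDeriv i ψ x =
        ∫ x, φ x * partialDeriv i ψ x := by
      refine integral_congr_ae ?_
      filter_upwards [(hφ.continuous.memLp_torus 2).coeFn_toLp] with x hx
      rw [hx]
    have h2 : ∫ x, (hφ.continuous_grad.memLp_torus 2).toLp (grad φ) x i * ψ x =
        ∫ x, partialDeriv i φ x * ψ x := by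
      refine integral_congr_ae ?_
      filter_upwards [(hφ.continuous_grad.memLp_torus 2).coeFn_toLp] with x hx
      rw [hx, grad_apply]
    change ∫ x, (hφ.continuous.memLp_torus 2).toLp φ x * partialDeriv i ψ x =
      -∫ x, (hφ.continuous_grad.memLp_torus 2).toLp (grad φ) x i * ψ x
    rw [h1, h2, hφ.integral_mul_partialDeriv hψ]⟩

theorem H1.toL2_ofSmooth {φ : Torus n → ℝ} (hφ : SmoothOnTorus φ) :
    H1.toL2 (H1.ofSmooth φ hφ) =ᵐ[volume] φ :=
  (hφ.continuous.memLp_torus 2).coeFn_toLp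

theorem H1.weakGrad_ofSmooth {φ : Torus n → ℝ} (hφ : SmoothOnTorus φ) :
    H1.weakGrad (H1.ofSmooth φ hφ) =ᵐ[volume] grad φ :=
  (hφ.continuous_grad.memLp_torus 2).coeFn_toLp

/-- The inclusion `H¹ → L²` as a continuous linear map. -/
def H1.toL2L (n : ℕ) : H1 n →L[ℝ] L2 n :=
  (WithLp.fstL 2 ℝ (L2 n) (L2Vec n)).comp (H1 n).subtypeL

/-- The weak gradient as a continuous linear map. -/
def H1.weakGradL (n : ℕ) : H1 n →L[ℝ] L2Vec n :=
  (WithLp.sndL 2 ℝ (L2 n) (L2Vec n)).comp (H1 n).subtypeL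

@[simp] theorem H1.toL2L_apply (u : H1 n) : H1.toL2L n u = H1.toL2 u := rfl

@[simp] theorem H1.weakGradL_apply (u : H1 n) : H1.weakGradL n u = H1.weakGrad u := rfl

theorem H1.inner_eq (u v : H1 n) : inner ℝ u v =
    inner ℝ (H1.toL2 u) (H1.toL2 v) + inner ℝ (H1.weakGrad u) (H1.weakGrad v) := rfl

theorem H1.norm_sq_eq (u : H1 n) : ‖u‖ ^ 2 = ‖H1.toL2 u‖ ^ 2 + ‖H1.weakGrad u‖ ^ 2 := by
  rw [← real_inner_self_eq_norm_sq, ← real_inner_self_eq_norm_sq, ← real_inner_self_eq_norm_sq,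
    H1.inner_eq]

theorem L2.inner_eq_integral_mul (u v : L2 n) : inner ℝ u v = ∫ x, u x * v x := by
  rw [MeasureTheory.L2.inner_def]
  refine integral_congr_ae (Eventually.of_forall fun x => ?_)
  simp [mul_comm]

theorem L2.norm_sq_eq_integral (u : L2 n) : ‖u‖ ^ 2 = ∫ x, u x ^ 2 := by
  rw [← real_inner_self_eq_norm_sq, L2.inner_eq_integral_mul]
  simp only [sq]

theorem L2Vec.inner_eq_integral (u v : L2Vec n) : inner ℝ u v = ∫ x, inner ℝ (u x) (v x) :=
  MeasureTheory.L2.inner_def u v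

theorem L2Vec.norm_sq_eq_integral (u : L2Vec n) : ‖u‖ ^ 2 = ∫ x, ‖u x‖ ^ 2 := by
  rw [← real_inner_self_eq_norm_sq, L2Vec.inner_eq_integral]
  simp only [real_inner_self_eq_norm_sq]

/-- There is a countable family of smooth functions that is dense in the `C¹` topology. -/
theorem exists_countable_dense_smooth (n : ℕ) :
    ∃ S : Set (Torus n → ℝ), S.Countable ∧ (∀ ψ ∈ S, SmoothOnTorus ψ) ∧
      ∀ φ, SmoothOnTorus φ → ∀ ε > 0, ∃ ψ ∈ S, ∀ x,
        |ψ x - φ x| < ε ∧ ∀ i, |partialDeriv i ψ x - partialDeriv i φ x| < ε := by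
  let J : {φ : Torus n → ℝ // SmoothOnTorus φ} → C(Torus n, ℝ) × (Fin n → C(Torus n, ℝ)) :=
    fun φ => (⟨φ.1, φ.2.continuous⟩, fun i => ⟨partialDeriv i φ.1, φ.2.continuous_partialDeriv i⟩)
  -- The set of 1-jets is a subset of a separable metric space, hence separable itself, so the dense
  -- sequence can be taken inside it and consists of jets of smooth functions.
  obtain ⟨D, hDc, hDd⟩ := TopologicalSpace.exists_countable_dense (range J)
  choose f hf using fun p : range J => p.2
  refine ⟨(fun p => (f p).1) '' D, hDc.image _, ?_, ?_⟩
  · rintro _ ⟨p, _, rfl⟩; exact (f p).2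
  · intro φ hφ ε hε
    obtain ⟨p, hpD, hp⟩ := hDd.exists_dist_lt (⟨J ⟨φ, hφ⟩, mem_range_self _⟩ : range J) hε
    refine ⟨_, mem_image_of_mem _ hpD, ?_⟩
    rw [Subtype.dist_eq, dist_comm, ← hf p] at hp
    have h1 := (max_lt_iff.1 hp).1
    have h2 := (dist_pi_lt_iff hε).1 (max_lt_iff.1 hp).2
    intro x
    refine ⟨(ContinuousMap.dist_apply_le_dist x).trans_lt h1, fun i => ?_⟩
    exact (ContinuousMap.dist_apply_le_dist x).trans_lt (h2 i)

/-! ### Parseval frames -/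

section ParsevalFrame

variable {K ι : Type*} [NormedAddCommGroup K] [InnerProductSpace ℝ K]

/-- A family of vectors satisfying Parseval's identity. -/
def IsParsevalFrame (f : ι → K) : Prop := ∀ w, HasSum (fun i => inner ℝ w (f i) ^ 2) (‖w‖ ^ 2)

namespace IsParsevalFrame

variable {f : ι → K}

theorem sum_sq_le (hf : IsParsevalFrame f) (A : Finset ι) (w : K) :
    ∑ i ∈ A, inner ℝ w (f i) ^ 2 ≤ ‖w‖ ^ 2 :=
  sum_le_hasSum A (fun _ _ => sq_nonneg _) (hf w)

/-- The adjoint of Bessel's inequality: for the sum v, ‖v‖² = ∑ aᵢ⟨v, fᵢ⟩, and Cauchy–Schwarz with ∑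
⟨v, fᵢ⟩² ≤ ‖v‖² leaves a factor ‖v‖ to cancel. Orthogonality of the family is not needed. -/
theorem norm_sum_sq_le (hf : IsParsevalFrame f) (A : Finset ι) (a : ι → ℝ) :
    ‖∑ i ∈ A, a i • f i‖ ^ 2 ≤ ∑ i ∈ A, a i ^ 2 := by
  set v := ∑ i ∈ A, a i • f i with hv
  have h1 : ‖v‖ ^ 2 = ∑ i ∈ A, a i * inner ℝ v (f i) := by
    rw [← real_inner_self_eq_norm_sq]
    conv_lhs => rw [hv, inner_sum, ← hv]
    simp [inner_smul_right]
  have h2 := Finset.sum_mul_sq_le_sq_mul_sq A a (fun i => inner ℝ v (f i))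
  rw [← h1] at h2
  have h3 := hf.sum_sq_le A v
  have h4 : 0 ≤ ∑ i ∈ A, a i ^ 2 := Finset.sum_nonneg fun _ _ => sq_nonneg _
  by_cases hv0 : ‖v‖ ^ 2 = 0
  · rw [hv0]; exact h4
  · have h5 : 0 < ‖v‖ ^ 2 := lt_of_le_of_ne (sq_nonneg _) (Ne.symm hv0)
    have h6 : (‖v‖ ^ 2) ^ 2 ≤ (∑ i ∈ A, a i ^ 2) * ‖v‖ ^ 2 :=
      h2.trans (mul_le_mul_of_nonneg_left h3 h4)
    nlinarith

theorem norm_sub_sum_sq_le (hf : IsParsevalFrame f) (A : Finset ι) (w : K) :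
    ‖w - ∑ i ∈ A, inner ℝ w (f i) • f i‖ ^ 2 ≤ ‖w‖ ^ 2 - ∑ i ∈ A, inner ℝ w (f i) ^ 2 := by
  have h1 := hf.norm_sum_sq_le A (fun i => inner ℝ w (f i))
  rw [norm_sub_sq_real]
  have h2 : inner ℝ w (∑ i ∈ A, inner ℝ w (f i) • f i) = ∑ i ∈ A, inner ℝ w (f i) ^ 2 := by
    simp [inner_sum, inner_smul_right, sq]
  rw [h2]; linarith

/-- The squared error of a partial sum is at most the remainder of Parseval's series, so the frame
expansion reconstructs w without completeness of the space. -/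
theorem hasSum (hf : IsParsevalFrame f) (w : K) : HasSum (fun i => inner ℝ w (f i) • f i) w := by
  have h : Tendsto (fun A => ‖w‖ ^ 2 - ∑ i ∈ A, inner ℝ w (f i) ^ 2) atTop (𝓝 0) := by
    rw [← sub_self (‖w‖ ^ 2)]
    exact Tendsto.const_sub _ (hf w)
  have h2 : Tendsto (fun A : Finset ι => ‖w - ∑ i ∈ A, inner ℝ w (f i) • f i‖ ^ 2) atTop (𝓝 0) :=
    squeeze_zero (fun _ => sq_nonneg _) (fun A => hf.norm_sub_sum_sq_le A w) h
  have h3 := h2.sqrt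
  simp only [Real.sqrt_sq (norm_nonneg _), Real.sqrt_zero] at h3
  have h4 := (tendsto_zero_iff_norm_tendsto_zero.2 h3).const_sub w
  simpa [HasSum] using h4

end IsParsevalFrame

end ParsevalFrame

/-! ### Trigonometric modes and Parseval's identity in L² and H¹ -/

/-- Frequencies together with the choice between cosine (`true`) and sine (`false`). -/
abbrev ModeIndex (n : ℕ) : Type := (Fin n → ℤ) × Bool

/-- The real trigonometric modes `cos (2π k·x)` and `sin (2π k·x)` on the torus. -/
def mode (i : ModeIndex n) (x : Torus n) : ℝ :=
  if i.2 then (UnitAddTorus.mFourier i.1 x).re else (UnitAddTorus.mFourier i.1 x).im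

/-- The index of the conjugate mode. -/
def ModeIndex.conj (i : ModeIndex n) : ModeIndex n := (i.1, !i.2)

/-- The factor `∓ 2π k_j` in the `j`-th derivative of a mode. -/
def ModeIndex.derivFactor (j : Fin n) (i : ModeIndex n) : ℝ :=
  (if i.2 then -1 else 1) * (2 * Real.pi * i.1 j)

theorem mFourier_proj (k : Fin n → ℤ) (x : Fin n → ℝ) :
    UnitAddTorus.mFourier k (proj n x) =
      Complex.exp (((2 * Real.pi * ∑ j, k j * x j : ℝ) : ℂ) * Complex.I) := by
  have : UnitAddTorus.mFourier k (proj n x) = ∏ j, fourier (k j) (x j : UnitAddCircle) := rfl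
  rw [this]
  simp only [fourier_coe_apply]
  rw [← Complex.exp_sum]
  congr 1
  push_cast
  rw [Finset.mul_sum, Finset.sum_mul]
  refine Finset.sum_congr rfl fun j _ => ?_
  simp; ring

theorem mode_proj (i : ModeIndex n) (x : Fin n → ℝ) :
    mode i (proj n x) = if i.2 then Real.cos (2 * Real.pi * ∑ j, i.1 j * x j)
      else Real.sin (2 * Real.pi * ∑ j, i.1 j * x j) := by
  unfold mode
  rw [mFourier_proj]
  simp only [Complex.exp_ofReal_mul_I_re, Complex.exp_ofReal_mul_I_im]

theorem smooth_mode (i : ModeIndex n) : SmoothOnTorus (mode i) := by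
  unfold SmoothOnTorus
  simp only [mode_proj]
  split_ifs
  · exact Real.contDiff_cos.comp (by fun_prop)
  · exact Real.contDiff_sin.comp (by fun_prop)

theorem partialDeriv_mode (j : Fin n) (i : ModeIndex n) (x : Torus n) :
    partialDeriv j (mode i) x = i.derivFactor j * mode i.conj x := by
  obtain ⟨y, rfl⟩ := proj_surjective n x
  have hlin : HasDerivAt (fun s : ℝ => 2 * Real.pi * ∑ l, (i.1 l : ℝ) * (y + s • Pi.single j 1 : Fin n → ℝ) l)
      (2 * Real.pi * i.1 j) 0 := by
    have : (fun s : ℝ => 2 * Real.pi * ∑ l, (i.1 l : ℝ) * (y + s • Pi.single j 1 : Fin n → ℝ) l) =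
        fun s => 2 * Real.pi * (∑ l, (i.1 l : ℝ) * y l + s * i.1 j) := by
      funext s
      congr 1
      simp only [Pi.add_apply, Pi.smul_apply, smul_eq_mul, mul_add, Finset.sum_add_distrib]
      congr 1
      rw [Finset.sum_eq_single j]
      · simp; ring
      · intro b _ hb; simp [hb]
      · simp
    rw [this]
    simpa using (((hasDerivAt_id (0 : ℝ)).mul_const (i.1 j : ℝ)).const_add _).const_mul
      (2 * Real.pi)
  unfold partialDeriv
  simp only [← proj_add_single, mode_proj, ModeIndex.conj, ModeIndex.derivFactor]
  rcases hb : i.2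
  · simp only [Bool.false_eq_true, if_false, Bool.not_false, if_true]
    rw [hlin.sin.deriv]; simp; ring
  · simp only [if_true, Bool.not_true, Bool.false_eq_true, if_false]
    rw [hlin.cos.deriv]; simp; ring

theorem mode_sq_add_sq (k : Fin n → ℤ) (x : Torus n) :
    mode (k, true) x ^ 2 + mode (k, false) x ^ 2 = 1 := by
  obtain ⟨y, rfl⟩ := proj_surjective n x
  simp [mode_proj]

/-- The `L²` coefficient of a function with respect to a mode. -/
def modeCoeff (f : Torus n → ℝ) (i : ModeIndex n) : ℝ := ∫ x, f x * mode i x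

theorem hasSum_sq_mFourierCoeff_pi
    (f : Lp ℂ 2 (Measure.pi fun _ : Fin n => AddCircle.haarAddCircle (T := (1 : ℝ)))) :
    HasSum (fun k : Fin n → ℤ => ‖∫ x, UnitAddTorus.mFourier (-k) x • f x
        ∂(Measure.pi fun _ : Fin n => AddCircle.haarAddCircle (T := (1 : ℝ)))‖ ^ 2)
      (∫ x, ‖f x‖ ^ 2 ∂(Measure.pi fun _ : Fin n => AddCircle.haarAddCircle (T := (1 : ℝ)))) :=
  UnitAddTorus.hasSum_sq_mFourierCoeff f

theorem hasSum_sq_mFourierCoeff_volume (f : Lp ℂ 2 (volume : Measure (Torus n))) :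
    HasSum (fun k : Fin n → ℤ => ‖∫ x, UnitAddTorus.mFourier (-k) x • f x‖ ^ 2)
      (∫ x, ‖f x‖ ^ 2) := by
  -- The type of f depends on the measure, so the equality of the two measures is substituted with
  -- both generalised.
  have key : ∀ μ : Measure (Torus n),
      μ = (Measure.pi fun _ : Fin n => AddCircle.haarAddCircle (T := (1 : ℝ))) →
      ∀ f : Lp ℂ 2 μ, HasSum (fun k : Fin n → ℤ => ‖∫ x, UnitAddTorus.mFourier (-k) x • f x ∂μ‖ ^ 2)
        (∫ x, ‖f x‖ ^ 2 ∂μ) := by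
    rintro μ rfl f
    exact hasSum_sq_mFourierCoeff_pi f
  exact key _ (torus_volume_eq n) f

/-- For real f the Fourier coefficient at k is c - i s, with c and s the cosine and sine
coefficients, so its squared modulus is c² + s². Each nonconstant function occurs for both k and -k,
up to sign, and the sine mode at k = 0 vanishes: the modes are a Parseval frame and not an
orthonormal basis. -/
theorem hasSum_modeCoeff_sq {f : Torus n → ℝ} (hf : MemLp f 2 volume) :
    HasSum (fun i : ModeIndex n => modeCoeff f i ^ 2) (∫ x, f x ^ 2) := by
  have hF : MemLp (fun x => (f x : ℂ)) 2 (volume : Measure (Torus n)) := hf.ofReal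
  have hmul : ∀ i : ModeIndex n, Integrable (fun x => f x * mode i x) := fun i =>
    MemLp.integrable_mul (p := 2) (q := 2) hf ((smooth_mode i).continuous.memLp_torus 2)
  have h := hasSum_sq_mFourierCoeff_volume (hF.toLp _)
  have h1 : ∫ x, ‖hF.toLp _ x‖ ^ 2 = ∫ x, f x ^ 2 := by
    refine integral_congr_ae ?_
    filter_upwards [hF.coeFn_toLp] with x hx
    rw [hx]; simp
  have h2 : ∀ k : Fin n → ℤ, ‖∫ x, UnitAddTorus.mFourier (-k) x • hF.toLp _ x‖ ^ 2 =
      ∑ b : Bool, modeCoeff f (k, b) ^ 2 := by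
    intro k
    have h3 : ∫ x, UnitAddTorus.mFourier (-k) x • hF.toLp _ x =
        ∫ x, (((f x * mode (k, true) x : ℝ) : ℂ) - ((f x * mode (k, false) x : ℝ) : ℂ) * Complex.I) := by
      refine integral_congr_ae ?_
      filter_upwards [hF.coeFn_toLp] with x hx
      rw [hx, UnitAddTorus.mFourier_neg]
      apply Complex.ext <;> simp [mode] <;> ring
    rw [h3, integral_sub (hmul _).ofReal ((hmul _).ofReal.mul_const _), integral_mul_const,
      integral_complex_ofReal, integral_complex_ofReal, ← Complex.normSq_eq_norm_sq, Complex.normSq_apply]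
    simp [modeCoeff]; ring
  rw [h1] at h
  simp only [h2] at h
  have hs : Summable (fun i : ModeIndex n => modeCoeff f i ^ 2) := by
    rw [summable_prod_of_nonneg (fun _ => sq_nonneg _)]
    refine ⟨fun k => Summable.of_finite, ?_⟩
    simpa only [tsum_fintype] using h.summable
  have h4 := hs.hasSum.prod_fiberwise (fun k => hasSum_fintype _)
  rw [h.unique h4]
  exact hs.hasSum

/-- The mode as an element of `H¹`. -/
def modeH1 (i : ModeIndex n) : H1 n := H1.ofSmooth (mode i) (smooth_mode i)

theorem inner_toL2_modeH1 (u : L2 n) (i : ModeIndex n) :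
    inner ℝ u (H1.toL2 (modeH1 i)) = modeCoeff u i := by
  rw [L2.inner_eq_integral_mul]
  refine integral_congr_ae ?_
  filter_upwards [H1.toL2_ofSmooth (smooth_mode i)] with x hx
  rw [modeH1, hx]

theorem isParsevalFrame_modeL2 : IsParsevalFrame fun i : ModeIndex n => H1.toL2 (modeH1 i) := by
  intro u
  simp only [inner_toL2_modeH1]
  rw [L2.norm_sq_eq_integral]
  exact hasSum_modeCoeff_sq (Lp.memLp u)

theorem memLp_weakGrad_apply (G : L2Vec n) (j : Fin n) :
    MemLp (fun x => G x j) 2 (volume : Measure (Torus n)) :=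
  (EuclideanSpace.proj (𝕜 := ℝ) j).comp_memLp' (Lp.memLp G)

theorem modeCoeff_weakGrad (w : H1 n) (j : Fin n) (i : ModeIndex n) :
    modeCoeff (fun x => H1.weakGrad w x j) i =
      -(i.derivFactor j * modeCoeff (H1.toL2 w) i.conj) := by
  have h := w.2 (mode i) (smooth_mode i) j
  simp only [partialDeriv_mode] at h
  have h2 : ∫ x, H1.toL2 w x * (i.derivFactor j * mode i.conj x) =
      i.derivFactor j * modeCoeff (H1.toL2 w) i.conj := by
    rw [modeCoeff, ← integral_const_mul]
    congr 1; funext x; ring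
  change ∫ x, H1.toL2 w x * (i.derivFactor j * mode i.conj x) = _ at h
  rw [h2] at h
  rw [h, neg_neg]; rfl

/-- The eigenvalue `4π²|k|²` of `-Δ` on a mode. -/
def ModeIndex.eigenvalue (i : ModeIndex n) : ℝ := ∑ j, (2 * Real.pi * i.1 j) ^ 2

theorem ModeIndex.eigenvalue_nonneg (i : ModeIndex n) : 0 ≤ i.eigenvalue :=
  Finset.sum_nonneg fun _ _ => sq_nonneg _

theorem ModeIndex.conj_conj (i : ModeIndex n) : i.conj.conj = i := by
  simp [ModeIndex.conj]

theorem ModeIndex.derivFactor_sq (j : Fin n) (i : ModeIndex n) :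
    i.derivFactor j ^ 2 = (2 * Real.pi * i.1 j) ^ 2 := by
  unfold ModeIndex.derivFactor; split_ifs <;> ring

theorem ModeIndex.derivFactor_conj (j : Fin n) (i : ModeIndex n) :
    i.conj.derivFactor j = -i.derivFactor j := by
  unfold ModeIndex.derivFactor ModeIndex.conj; rcases i with ⟨k, b⟩; cases b <;> simp

theorem L2Vec.norm_sq_eq_sum (G : L2Vec n) : ‖G‖ ^ 2 = ∑ j, ∫ x, G x j ^ 2 := by
  rw [L2Vec.norm_sq_eq_integral, ← integral_finsetSum _ fun j _ =>
    (memLp_weakGrad_apply G j).integrable_sq]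
  simp [EuclideanSpace.norm_sq_eq]

/-- Parseval's identity for each component of Dw. Differentiation exchanges cosine and sine and
multiplies by ∓2πkⱼ, so the series is first reindexed by the conjugation of modes. -/
theorem hasSum_eigenvalue_modeCoeff_sq (w : H1 n) :
    HasSum (fun i : ModeIndex n => i.eigenvalue * modeCoeff (H1.toL2 w) i ^ 2)
      (‖H1.weakGrad w‖ ^ 2) := by
  rw [L2Vec.norm_sq_eq_sum]
  simp only [ModeIndex.eigenvalue, Finset.sum_mul]
  refine hasSum_sum fun j _ => ?_
  have h := hasSum_modeCoeff_sq (memLp_weakGrad_apply (H1.weakGrad w) j)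
  let e : ModeIndex n ≃ ModeIndex n :=
    ⟨ModeIndex.conj, ModeIndex.conj, ModeIndex.conj_conj, ModeIndex.conj_conj⟩
  rw [← e.hasSum_iff] at h
  refine h.congr_fun fun i => ?_
  change _ = modeCoeff (fun x => H1.weakGrad w x j) i.conj ^ 2
  rw [modeCoeff_weakGrad, neg_sq, mul_pow (i.conj.derivFactor j), ModeIndex.derivFactor_sq, ModeIndex.conj_conj]
  rfl

theorem inner_modeH1 (w : H1 n) (i : ModeIndex n) :
    inner ℝ w (modeH1 i) = (1 + i.eigenvalue) * modeCoeff (H1.toL2 w) i := by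
  have h1 : inner ℝ (H1.weakGrad w) (H1.weakGrad (modeH1 i)) =
      ∑ j, ∫ x, H1.weakGrad w x j * partialDeriv j (mode i) x := by
    rw [L2Vec.inner_eq_integral, ← integral_finsetSum _ fun j _ =>
      integrable_L2Vec_mul _ j ((smooth_mode i).continuous_partialDeriv j)]
    refine integral_congr_ae ?_
    filter_upwards [H1.weakGrad_ofSmooth (smooth_mode i)] with x hx
    rw [modeH1, hx, PiLp.inner_apply]
    simp [grad_apply, mul_comm]
  have h2 : ∀ j, ∫ x, H1.weakGrad w x j * partialDeriv j (mode i) x =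
      (2 * Real.pi * i.1 j) ^ 2 * modeCoeff (H1.toL2 w) i := by
    intro j
    simp only [partialDeriv_mode]
    have h3 : ∫ x, H1.weakGrad w x j * (i.derivFactor j * mode i.conj x) =
        i.derivFactor j * modeCoeff (fun x => H1.weakGrad w x j) i.conj := by
      rw [modeCoeff, ← integral_const_mul]
      congr 1; funext x; ring
    rw [h3, modeCoeff_weakGrad, ModeIndex.conj_conj, ModeIndex.derivFactor_conj,
      ← ModeIndex.derivFactor_sq]
    ring
  rw [H1.inner_eq, h1, inner_toL2_modeH1]
  simp only [h2, ← Finset.sum_mul]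
  rw [ModeIndex.eigenvalue]; ring

theorem H1.inner_smul_right (u v : H1 n) (c : ℝ) : inner ℝ u (c • v) = c * inner ℝ u v :=
  real_inner_smul_right u v c

theorem ModeIndex.one_add_eigenvalue_pos (i : ModeIndex n) : 0 < 1 + i.eigenvalue := by
  linarith [i.eigenvalue_nonneg]

/-- The H¹ inner product with a mode is (1 + λ) times the L² coefficient; dividing the mode by √(1 +
λ) turns the squared coefficients into the terms of ‖w‖² + ‖Dw‖². The H¹ expansion thus has the same
coefficients as the L² expansion, so one truncation serves both spaces. -/
theorem isParsevalFrame_modeH1 :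
    IsParsevalFrame fun i : ModeIndex n => (√(1 + i.eigenvalue))⁻¹ • modeH1 i := by
  intro w
  rw [H1.norm_sq_eq]
  have h1 := isParsevalFrame_modeL2 (H1.toL2 w)
  simp only [inner_toL2_modeH1] at h1
  refine (h1.add (hasSum_eigenvalue_modeCoeff_sq w)).congr_fun fun i => ?_
  beta_reduce
  rw [H1.inner_smul_right, inner_modeH1, mul_pow, inv_pow, Real.sq_sqrt i.one_add_eigenvalue_pos.le]
  field_simp [i.one_add_eigenvalue_pos.ne']

/-- The truncation of the trigonometric series of an element of `H¹`. -/
def truncH1 (A : Finset (ModeIndex n)) (w : H1 n) : H1 n :=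
  ∑ i ∈ A, modeCoeff (H1.toL2 w) i • modeH1 i

theorem inner_smul_modeH1_frame (w : H1 n) (i : ModeIndex n) :
    inner ℝ w ((√(1 + i.eigenvalue))⁻¹ • modeH1 i) • (√(1 + i.eigenvalue))⁻¹ • modeH1 i =
      modeCoeff (H1.toL2 w) i • modeH1 i := by
  rw [H1.inner_smul_right, inner_modeH1, smul_smul]
  congr 1
  have h := i.one_add_eigenvalue_pos
  have h2 : √(1 + i.eigenvalue) ^ 2 = 1 + i.eigenvalue := Real.sq_sqrt h.le
  have h3 : √(1 + i.eigenvalue) ≠ 0 := (Real.sqrt_pos.2 h).ne'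
  field_simp
  rw [h2]

theorem inner_modeH1_frame_sq (w : H1 n) (i : ModeIndex n) :
    inner ℝ w ((√(1 + i.eigenvalue))⁻¹ • modeH1 i) ^ 2 =
      (1 + i.eigenvalue) * modeCoeff (H1.toL2 w) i ^ 2 := by
  rw [H1.inner_smul_right, inner_modeH1, mul_pow, inv_pow, Real.sq_sqrt i.one_add_eigenvalue_pos.le]
  field_simp [i.one_add_eigenvalue_pos.ne']

theorem hasSum_truncH1 (w : H1 n) :
    HasSum (fun i => modeCoeff (H1.toL2 w) i • modeH1 i) w := by
  simpa only [inner_smul_modeH1_frame] using isParsevalFrame_modeH1.hasSum w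

theorem tendsto_truncH1 (w : H1 n) : Tendsto (fun A => truncH1 A w) atTop (𝓝 w) :=
  hasSum_truncH1 w

theorem norm_truncH1_sq_le_sum (A : Finset (ModeIndex n)) (w : H1 n) :
    ‖truncH1 A w‖ ^ 2 ≤ ∑ i ∈ A, (1 + i.eigenvalue) * modeCoeff (H1.toL2 w) i ^ 2 := by
  simpa only [inner_smul_modeH1_frame, inner_modeH1_frame_sq, truncH1] using
    isParsevalFrame_modeH1.norm_sum_sq_le A
      (fun i => inner ℝ w ((√(1 + i.eigenvalue))⁻¹ • modeH1 i))

theorem hasSum_norm_H1_sq (w : H1 n) :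
    HasSum (fun i : ModeIndex n => (1 + i.eigenvalue) * modeCoeff (H1.toL2 w) i ^ 2)
      (‖w‖ ^ 2) := by
  simpa only [inner_modeH1_frame_sq] using isParsevalFrame_modeH1 w

theorem norm_truncH1_le (A : Finset (ModeIndex n)) (w : H1 n) : ‖truncH1 A w‖ ≤ ‖w‖ := by
  refine abs_le_of_sq_le_sq' ?_ (norm_nonneg _) |>.2
  exact (norm_truncH1_sq_le_sum A w).trans
    (sum_le_hasSum A (fun i _ => mul_nonneg i.one_add_eigenvalue_pos.le (sq_nonneg _))
      (hasSum_norm_H1_sq w))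

/-- The truncation of the trigonometric series as a trigonometric polynomial. -/
def truncFun (A : Finset (ModeIndex n)) (u : Torus n → ℝ) (x : Torus n) : ℝ :=
  ∑ i ∈ A, modeCoeff u i * mode i x

theorem smooth_truncFun (A : Finset (ModeIndex n)) (u : Torus n → ℝ) :
    SmoothOnTorus (truncFun A u) :=
  SmoothOnTorus.sum A fun i _ => (SmoothOnTorus.const _).mul (smooth_mode i)

theorem H1.ext_toL2 {u v : H1 n} (h1 : H1.toL2 u = H1.toL2 v)
    (h2 : H1.weakGrad u = H1.weakGrad v) : u = v := by
  have h : ‖u - v‖ ^ 2 = 0 := by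
    rw [H1.norm_sq_eq, ← H1.toL2L_apply, ← H1.weakGradL_apply, map_sub, map_sub]
    simp [h1, h2]
  exact sub_eq_zero.1 (norm_eq_zero.1 (pow_eq_zero_iff two_ne_zero |>.1 h))

theorem H1.ofSmooth_add {φ ψ : Torus n → ℝ} (hφ : SmoothOnTorus φ) (hψ : SmoothOnTorus ψ) :
    H1.ofSmooth φ hφ + H1.ofSmooth ψ hψ = H1.ofSmooth (fun x => φ x + ψ x) (hφ.add hψ) := by
  apply H1.ext_toL2
  · rfl
  · apply Lp.ext
    refine (Lp.coeFn_add (H1.weakGrad (H1.ofSmooth φ hφ)) (H1.weakGrad (H1.ofSmooth ψ hψ))).trans ?_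
    filter_upwards [H1.weakGrad_ofSmooth hφ, H1.weakGrad_ofSmooth hψ,
      H1.weakGrad_ofSmooth (hφ.add hψ)] with x h1 h2 h3
    rw [Pi.add_apply, h1, h2, h3]
    ext i; simp [grad_apply, hφ.partialDeriv_add hψ]

theorem H1.smul_ofSmooth (c : ℝ) {φ : Torus n → ℝ} (hφ : SmoothOnTorus φ) :
    c • H1.ofSmooth φ hφ =
      H1.ofSmooth (fun x => c * φ x) ((SmoothOnTorus.const c).mul hφ) := by
  apply H1.ext_toL2
  · rfl
  · apply Lp.ext
    refine (Lp.coeFn_smul c (H1.weakGrad (H1.ofSmooth φ hφ))).trans ?_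
    filter_upwards [H1.weakGrad_ofSmooth hφ,
      H1.weakGrad_ofSmooth ((SmoothOnTorus.const c).mul hφ)] with x h1 h2
    rw [Pi.smul_apply, h1, h2, grad_const_mul]

theorem sum_smul_modeH1 (A : Finset (ModeIndex n)) (a : ModeIndex n → ℝ) :
    ∑ i ∈ A, a i • modeH1 i = H1.ofSmooth (fun x => ∑ i ∈ A, a i * mode i x)
      (SmoothOnTorus.sum A fun i _ => (SmoothOnTorus.const _).mul (smooth_mode i)) := by
  classical
  induction A using Finset.induction_on with
  | empty =>
    apply H1.ext_toL2
    · simp only [Finset.sum_empty]; rfl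
    · symm
      apply Lp.ext
      refine (H1.weakGrad_ofSmooth (SmoothOnTorus.const 0)).trans ?_
      refine EventuallyEq.trans ?_ (Lp.coeFn_zero _ _ _).symm
      refine Eventually.of_forall fun x => ?_
      ext i; simp [grad_apply, SmoothOnTorus.partialDeriv_const]
  | insert i A hi ih =>
    simp only [Finset.sum_insert hi, ih]
    rw [modeH1, H1.smul_ofSmooth, H1.ofSmooth_add]

/-- Provides a smooth pointwise representative of the truncation, which weights and nonlinear
compositions require. -/
theorem truncH1_eq_ofSmooth (A : Finset (ModeIndex n)) (w : H1 n) :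
    truncH1 A w = H1.ofSmooth (truncFun A (H1.toL2 w)) (smooth_truncFun A _) :=
  sum_smul_modeH1 A _

/-! ### Weighted Bernstein and Gagliardo–Nirenberg inequalities -/

section Hoelder

variable {α : Type*} [MeasurableSpace α] {μ : Measure α}

/-- Hölder's inequality combined with the interpolation of `L^{2q'}` between `L²` and `L^∞`. -/
theorem lintegral_enorm_mul_sq_le {q : ℝ≥0∞} (hq : 1 ≤ q) {d f : α → ℝ}
    (hd : AEStronglyMeasurable d μ) (hf : AEStronglyMeasurable f μ) {P B : ℝ≥0∞}
    (hP : ∀ x, ‖f x‖ₑ ^ 2 ≤ P * B) (hB : ∫⁻ x, ‖f x‖ₑ ^ 2 ∂μ ≤ B) :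
    ∫⁻ x, ‖d x‖ₑ * ‖f x‖ₑ ^ 2 ∂μ ≤ eLpNorm d q μ * (P ^ q.toReal⁻¹ * B) := by
  rcases eq_or_ne q ⊤ with rfl | hqt
  -- Since `⊤.toReal⁻¹ = 0`, the factor P drops out, which is the correct bound for a bounded
  -- weight.
  · simp only [ENNReal.toReal_top, inv_zero, ENNReal.rpow_zero, one_mul]
    calc ∫⁻ x, ‖d x‖ₑ * ‖f x‖ₑ ^ 2 ∂μ
        ≤ ∫⁻ x, eLpNorm d ⊤ μ * ‖f x‖ₑ ^ 2 ∂μ := by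
          refine lintegral_mono_ae ?_
          filter_upwards [enorm_ae_le_eLpNormEssSup d μ] with x hx
          rw [eLpNorm_exponent_top]
          gcongr
      _ = eLpNorm d ⊤ μ * ∫⁻ x, ‖f x‖ₑ ^ 2 ∂μ := by
          rw [lintegral_const_mul'' _ (hf.enorm.pow_const 2)]
      _ ≤ _ := by gcongr
  rcases eq_or_lt_of_le hq with rfl | hq1
  · simp only [ENNReal.toReal_one, inv_one, ENNReal.rpow_one]
    calc ∫⁻ x, ‖d x‖ₑ * ‖f x‖ₑ ^ 2 ∂μ
        ≤ ∫⁻ x, ‖d x‖ₑ * (P * B) ∂μ := by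
          refine lintegral_mono fun x => ?_
          gcongr
          exact hP x
      _ = _ := by
          rw [lintegral_mul_const'' _ hd.enorm, eLpNorm_one_eq_lintegral_enorm]
  · have hq1' : 1 < q.toReal := by
      rw [← ENNReal.toReal_one]; exact (ENNReal.toReal_lt_toReal (by simp) hqt).2 hq1
    have hpq := Real.HolderConjugate.conjExponent hq1'
    set p := q.toReal with hp
    set p' := p.conjExponent with hp'
    have hp'1 : 1 < p' := hpq.symm.lt
    have hp'0 : 0 < p' := by linarith
    have hinv : 1 / p' = 1 - p⁻¹ := by rw [one_div]; linarith [hpq.inv_add_inv_eq_one]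
    have h1 := ENNReal.lintegral_mul_le_Lp_mul_Lq μ hpq hd.enorm (hf.enorm.pow_const 2)
    have h2 : (∫⁻ x, ‖d x‖ₑ ^ p ∂μ) ^ (1 / p) = eLpNorm d q μ := by
      rw [eLpNorm_eq_lintegral_rpow_enorm_toReal (by positivity) hqt]
    -- Interpolation: p' - 1 of the powers of f² are estimated by the supremum and the last one by
    -- the integral.
    have h3 : ∫⁻ x, (‖f x‖ₑ ^ 2) ^ p' ∂μ ≤ (P * B) ^ (p' - 1) * B := by
      calc ∫⁻ x, (‖f x‖ₑ ^ 2) ^ p' ∂μ ≤ ∫⁻ x, (P * B) ^ (p' - 1) * ‖f x‖ₑ ^ 2 ∂μ := by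
            refine lintegral_mono fun x => ?_
            calc (‖f x‖ₑ ^ 2) ^ p' = (‖f x‖ₑ ^ 2) ^ (p' - 1) * (‖f x‖ₑ ^ 2) ^ (1 : ℝ) := by
                  rw [← ENNReal.rpow_add_of_nonneg _ _ (by linarith) zero_le_one]; simp
              _ ≤ _ := by
                  rw [ENNReal.rpow_one]
                  gcongr
                  exact hP x
        _ = (P * B) ^ (p' - 1) * ∫⁻ x, ‖f x‖ₑ ^ 2 ∂μ := by
            rw [lintegral_const_mul'' _ (hf.enorm.pow_const 2)]
        _ ≤ _ := by gcongr
    refine h1.trans ?_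
    rw [h2]
    gcongr
    calc (∫⁻ x, (‖f x‖ₑ ^ 2) ^ p' ∂μ) ^ (1 / p') ≤ ((P * B) ^ (p' - 1) * B) ^ (1 / p') := by
          gcongr
      _ = P ^ p⁻¹ * (B ^ p⁻¹ * B ^ (1 - p⁻¹)) := by
          have h4 : (p' - 1) * (1 / p') = p⁻¹ := by
            rw [sub_mul, mul_one_div_cancel hp'0.ne', hinv]; ring
          rw [ENNReal.mul_rpow_of_nonneg _ _ (by positivity), ← ENNReal.rpow_mul, h4,
            ENNReal.mul_rpow_of_nonneg _ _ (by positivity), hinv, mul_assoc]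
      _ = P ^ p⁻¹ * B := by
          have h5 : p⁻¹ ≤ 1 := inv_le_one_of_one_le₀ hq1'.le
          rw [← ENNReal.rpow_add_of_nonneg _ _ (by positivity) (by linarith)]; simp

/-- Reading ∫ |d| f² as a squared L² norm makes the triangle inequality available for the sum over
dyadic blocks. -/
theorem eLpNorm_two_withDensity_sq {d f : α → ℝ} (hd : AEStronglyMeasurable d μ)
    (hf : AEStronglyMeasurable f μ) :
    eLpNorm f 2 (μ.withDensity fun x => ‖d x‖ₑ) ^ 2 = ∫⁻ x, ‖d x‖ₑ * ‖f x‖ₑ ^ 2 ∂μ := by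
  have h := eLpNorm_nnreal_pow_eq_lintegral (f := f) (p := 2)
    (μ := μ.withDensity fun x => ‖d x‖ₑ) two_ne_zero
  simp only [NNReal.coe_ofNat, ENNReal.rpow_ofNat, ENNReal.coe_ofNat] at h
  rw [h, lintegral_withDensity_eq_lintegral_mul₀ hd.enorm (hf.enorm.pow_const 2)]
  rfl

end Hoelder

/-- Cauchy–Schwarz; since cos² + sin² = 1, each frequency contributes exactly 1 to the sum of the
squared modes. -/
theorem sq_sum_mode_le (K : Finset (Fin n → ℤ)) (c : ModeIndex n → ℝ) (x : Torus n) :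
    (∑ i ∈ K ×ˢ Finset.univ, c i * mode i x) ^ 2 ≤
      K.card * ∑ i ∈ K ×ˢ Finset.univ, c i ^ 2 := by
  refine (Finset.sum_mul_sq_le_sq_mul_sq _ _ _).trans_eq ?_
  rw [mul_comm]
  congr 1
  rw [Finset.sum_product]
  simp [mode_sq_add_sq]

theorem lintegral_sq_sum_mode_le (A : Finset (ModeIndex n)) (c : ModeIndex n → ℝ) :
    ∫⁻ x, ‖∑ i ∈ A, c i * mode i x‖ₑ ^ 2 ≤ ENNReal.ofReal (∑ i ∈ A, c i ^ 2) := by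
  have hs : SmoothOnTorus (fun x => ∑ i ∈ A, c i * mode i x) :=
    SmoothOnTorus.sum A fun i _ => (SmoothOnTorus.const _).mul (smooth_mode i)
  have h1 := isParsevalFrame_modeL2.norm_sum_sq_le A c
  have h2 : ‖∑ i ∈ A, c i • H1.toL2 (modeH1 i)‖ ^ 2 = ∫ x, (∑ i ∈ A, c i * mode i x) ^ 2 := by
    have : ∑ i ∈ A, c i • H1.toL2 (modeH1 i) = H1.toL2 (∑ i ∈ A, c i • modeH1 i) := by
      simp only [← H1.toL2L_apply, map_sum, map_smul]
    rw [this, sum_smul_modeH1, L2.norm_sq_eq_integral]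
    refine integral_congr_ae ?_
    filter_upwards [H1.toL2_ofSmooth hs] with x hx
    rw [hx]
  rw [h2] at h1
  refine le_trans (le_of_eq ?_) (ENNReal.ofReal_le_ofReal h1)
  rw [ofReal_integral_eq_lintegral_ofReal (f := fun x => (∑ i ∈ A, c i * mode i x) ^ 2)
    ((hs.continuous.pow 2).integrable_torus)
    (Eventually.of_forall fun _ => sq_nonneg _)]
  refine lintegral_congr fun x => ?_
  rw [← sq_abs, ENNReal.ofReal_pow (abs_nonneg _), ← Real.enorm_eq_ofReal_abs]

/-- The norm is the sup norm, so the frequencies lie in a cube with 2⌊R⌋ + 1 ≤ 3R integers on each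
side. -/
theorem card_le_of_norm_le {K : Finset (Fin n → ℤ)} {R : ℝ} (hR : 1 ≤ R)
    (hK : ∀ k ∈ K, ‖k‖ ≤ R) : (K.card : ℝ) ≤ (3 * R) ^ n := by
  have hsub : K ⊆ Fintype.piFinset (fun _ : Fin n => Finset.Icc (-⌊R⌋) ⌊R⌋) := by
    intro k hk
    rw [Fintype.mem_piFinset]
    intro j
    have h1 : ‖k j‖ ≤ R := (norm_le_pi_norm k j).trans (hK k hk)
    rw [Int.norm_eq_abs, ← Int.cast_abs] at h1
    rw [Finset.mem_Icc, ← abs_le]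
    exact Int.le_floor.2 h1
  have h1 : K.card ≤ (2 * ⌊R⌋ + 1).toNat ^ n := by
    refine (Finset.card_le_card hsub).trans_eq ?_
    rw [Fintype.card_piFinset_const, Int.card_Icc]
    congr 2; ring
  have hfl : (0 : ℤ) ≤ 2 * ⌊R⌋ + 1 := by
    have : 0 ≤ ⌊R⌋ := Int.floor_nonneg.2 (by linarith)
    linarith
  have h2 : ((2 * ⌊R⌋ + 1).toNat : ℝ) ≤ 3 * R := by
    have : ((2 * ⌊R⌋ + 1).toNat : ℝ) = ((2 * ⌊R⌋ + 1 : ℤ) : ℝ) := by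
      exact_mod_cast Int.toNat_of_nonneg hfl
    rw [this]; push_cast
    linarith [Int.floor_le R]
  calc (K.card : ℝ) ≤ ((2 * ⌊R⌋ + 1).toNat : ℝ) ^ n := by exact_mod_cast h1
    _ ≤ _ := by gcongr

theorem ModeIndex.norm_sq_le_eigenvalue (i : ModeIndex n) : ‖i.1‖ ^ 2 ≤ i.eigenvalue := by
  have h : ‖i.1‖ ≤ √i.eigenvalue := by
    refine (pi_norm_le_iff_of_nonneg (Real.sqrt_nonneg _)).2 fun j => ?_
    refine Real.le_sqrt_of_sq_le ?_
    have h1 : (2 * Real.pi * (i.1 j : ℝ)) ^ 2 ≤ i.eigenvalue :=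
      Finset.single_le_sum (f := fun j => (2 * Real.pi * (i.1 j : ℝ)) ^ 2)
        (fun _ _ => sq_nonneg _) (Finset.mem_univ j)
    have h2 : ‖i.1 j‖ ^ 2 = (i.1 j : ℝ) ^ 2 := by rw [Int.norm_eq_abs, sq_abs]
    rw [h2]
    refine le_trans ?_ h1
    have := Real.pi_gt_three
    rw [mul_pow]
    exact le_mul_of_one_le_left (sq_nonneg _) (by nlinarith)
  calc ‖i.1‖ ^ 2 ≤ √i.eigenvalue ^ 2 := by gcongr
    _ = _ := Real.sq_sqrt i.eigenvalue_nonneg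

/-- Bernstein's inequality, in a weighted `L²` space. -/
theorem eLpNorm_sum_mode_withDensity_le {q : ℝ≥0∞} (hq : 1 ≤ q) {d : Torus n → ℝ}
    (hd : MemLp d q volume) {K : Finset (Fin n → ℤ)} {R a : ℝ} (hR : 1 ≤ R) (ha : 0 ≤ a)
    (hK : ∀ k ∈ K, ‖k‖ ≤ R) (c : ModeIndex n → ℝ)
    (hc : ∑ i ∈ K ×ˢ Finset.univ, c i ^ 2 ≤ a ^ 2) :
    eLpNorm (fun x => ∑ i ∈ K ×ˢ Finset.univ, c i * mode i x) 2
        (volume.withDensity fun x => ‖d x‖ₑ) ≤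
      ENNReal.ofReal (√((eLpNorm d q volume).toReal) * (3 * R) ^ (n / 2 * q.toReal⁻¹) * a) := by
  have hs : SmoothOnTorus (fun x => ∑ i ∈ K ×ˢ Finset.univ, c i * mode i x) :=
    SmoothOnTorus.sum _ fun i _ => (SmoothOnTorus.const _).mul (smooth_mode i)
  have hm := hs.continuous.aestronglyMeasurable (μ := (volume : Measure (Torus n)))
  rw [← ENNReal.pow_le_pow_left_iff two_ne_zero, eLpNorm_two_withDensity_sq hd.1 hm]
  have h3R : (0 : ℝ) ≤ 3 * R := by linarith
  -- P bounds the number of frequencies and B the ℓ² norm squared of the coefficients: P·B controls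
  -- the supremum of f², and B its integral.
  have h1 := lintegral_enorm_mul_sq_le hq hd.1 hm (P := ENNReal.ofReal ((3 * R) ^ n))
    (B := ENNReal.ofReal (a ^ 2)) (fun x => by
      rw [← ENNReal.ofReal_mul (by positivity), Real.enorm_eq_ofReal_abs,
        ← ENNReal.ofReal_pow (abs_nonneg _), sq_abs]
      refine ENNReal.ofReal_le_ofReal ((sq_sum_mode_le K c x).trans ?_)
      exact mul_le_mul (card_le_of_norm_le hR hK) hc
        (Finset.sum_nonneg fun _ _ => sq_nonneg _) (by positivity))
    ((lintegral_sq_sum_mode_le _ c).trans (ENNReal.ofReal_le_ofReal hc))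
  refine h1.trans_eq ?_
  obtain ⟨D, hD0, hD⟩ : ∃ D : ℝ, 0 ≤ D ∧ eLpNorm d q volume = ENNReal.ofReal D :=
    ⟨_, ENNReal.toReal_nonneg, (ENNReal.ofReal_toReal hd.2.ne).symm⟩
  rw [hD, ENNReal.toReal_ofReal hD0, ENNReal.ofReal_rpow_of_nonneg (by positivity) (by positivity),
    ← ENNReal.ofReal_mul (by positivity), ← ENNReal.ofReal_mul hD0,
    ← ENNReal.ofReal_pow (by positivity)]
  congr 1
  rw [mul_pow _ a, mul_pow (√D), Real.sq_sqrt hD0, ← Real.rpow_natCast (3 * R) n, ← Real.rpow_mul h3R,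
    ← Real.rpow_natCast ((3 * R) ^ _), ← Real.rpow_mul h3R, mul_assoc]
  congr 3
  push_cast; ring

/-- Index 0 collects the low frequencies, up to N; index m + 1 collects those between 2^m N and
2^(m+1) N. -/
theorem exists_dyadic_index {N : ℝ} (hN : 1 ≤ N) :
    ∃ J : (Fin n → ℤ) → ℕ, ∀ k, ‖k‖ ≤ 2 ^ J k * N ∧ ∀ m, J k = m + 1 → 2 ^ m * N ≤ ‖k‖ := by
  have hN0 : 0 < N := by linarith
  have : ∀ k : Fin n → ℤ, ∃ j : ℕ, ‖k‖ ≤ 2 ^ j * N ∧ ∀ m, j = m + 1 → 2 ^ m * N ≤ ‖k‖ := by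
    intro k
    by_cases hk : ‖k‖ ≤ N
    · exact ⟨0, by simpa using hk, fun m hm => by omega⟩
    · obtain ⟨j, h1, h2⟩ := exists_nat_pow_near (x := ‖k‖ / N) (y := (2 : ℝ))
        ((one_le_div hN0).2 (not_le.1 hk).le) one_lt_two
      refine ⟨j + 1, ((div_lt_iff₀ hN0).1 h2).le, fun m hm => ?_⟩
      obtain rfl : j = m := by omega
      exact (le_div_iff₀ hN0).1 h1
  choose J hJ using this
  exact ⟨J, hJ⟩

theorem sum_modeCoeff_sq_le (A : Finset (ModeIndex n)) (u : L2 n) :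
    ∑ i ∈ A, modeCoeff u i ^ 2 ≤ ‖u‖ ^ 2 := by
  simpa only [inner_toL2_modeH1] using isParsevalFrame_modeL2.sum_sq_le A u

/-- Bernstein's inequality on each dyadic block. The low block is paid for with ‖w‖. On the block at
height 2^m N the coefficients have ℓ² norm at most ‖Dw‖/(2^m N), against a Bernstein factor of order
(2^m N)^s, where s = n/(2q). The resulting series in 2^(m(s-1)) is geometric because s < 1, and the
bound does not depend on the truncation. -/
theorem eLpNorm_truncFun_withDensity_le {q : ℝ≥0∞} (hq : 1 ≤ q)
    (hs : (n : ℝ) / 2 * q.toReal⁻¹ < 1) {d : Torus n → ℝ} (hd : MemLp d q volume)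
    (K : Finset (Fin n → ℤ)) (w : H1 n) {N : ℝ} (hN : 1 ≤ N) :
    eLpNorm (truncFun (K ×ˢ Finset.univ) (H1.toL2 w)) 2 (volume.withDensity fun x => ‖d x‖ₑ) ≤
      ENNReal.ofReal (√((eLpNorm d q volume).toReal) * 3 ^ ((n : ℝ) / 2 * q.toReal⁻¹) *
        (N ^ ((n : ℝ) / 2 * q.toReal⁻¹) * ‖H1.toL2 w‖ +
          2 ^ ((n : ℝ) / 2 * q.toReal⁻¹) / (1 - 2 ^ ((n : ℝ) / 2 * q.toReal⁻¹ - 1)) *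
            N ^ ((n : ℝ) / 2 * q.toReal⁻¹ - 1) * ‖H1.weakGrad w‖)) := by
  classical
  have hB := @eLpNorm_sum_mode_withDensity_le n q hq d hd
  set s : ℝ := (n : ℝ) / 2 * q.toReal⁻¹ with hsdef
  set D := √((eLpNorm d q volume).toReal) with hD
  set ν := (volume : Measure (Torus n)).withDensity fun x => ‖d x‖ₑ with hν
  have hN0 : 0 < N := by linarith
  have hD0 : 0 ≤ D := Real.sqrt_nonneg _
  set c := modeCoeff (H1.toL2 w) with hc
  obtain ⟨J, hJ⟩ := exists_dyadic_index (n := n) hN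
  obtain ⟨L, hL⟩ : ∃ L, ∀ k ∈ K, J k ∈ Finset.range (L + 1) :=
    ⟨K.sup J, fun k hk => Finset.mem_range.2 (Nat.lt_succ_of_le (Finset.le_sup hk))⟩
  let f : ℕ → Torus n → ℝ := fun j x =>
    ∑ i ∈ (K.filter (fun k => J k = j)) ×ˢ Finset.univ, c i * mode i x
  have hsplit : truncFun (K ×ˢ Finset.univ) (H1.toL2 w) = ∑ j ∈ Finset.range (L + 1), f j := by
    funext x
    rw [Finset.sum_apply]
    simp only [f, truncFun, Finset.sum_product]
    exact (Finset.sum_fiberwise_of_maps_to hL _).symm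
  have hfc : ∀ j, Continuous (f j) := fun j =>
    (SmoothOnTorus.sum _ fun i _ => (SmoothOnTorus.const _).mul (smooth_mode i)).continuous
  set β : ℝ := 2 ^ (s - 1) with hβ
  have hβ0 : 0 < β := Real.rpow_pos_of_pos two_pos _
  have hβ1 : β < 1 := Real.rpow_lt_one_of_one_lt_of_neg one_lt_two (by linarith)
  have h0 : eLpNorm (f 0) 2 ν ≤ ENNReal.ofReal (D * 3 ^ s * (N ^ s * ‖H1.toL2 w‖)) := by
    refine (hB (K := K.filter fun k => J k = 0) hN (norm_nonneg (H1.toL2 w)) ?_ c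
      (sum_modeCoeff_sq_le _ _)).trans_eq ?_
    · intro k hk
      have := (hJ k).1
      rw [(Finset.mem_filter.1 hk).2] at this
      simpa using this
    · rw [Real.mul_rpow (by norm_num) hN0.le]; congr 1; ring
  have hm : ∀ m, eLpNorm (f (m + 1)) 2 ν ≤
      ENNReal.ofReal (D * 3 ^ s * (2 ^ s * N ^ (s - 1) * ‖H1.weakGrad w‖) * β ^ m) := by
    intro m
    have hR0 : 0 < 2 ^ m * N := by positivity
    have h1R : 1 ≤ 2 ^ (m + 1) * N :=
      hN.trans (le_mul_of_one_le_left hN0.le (one_le_pow₀ one_le_two))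
    refine (hB (K := K.filter fun k => J k = m + 1) (R := 2 ^ (m + 1) * N)
      (a := ‖H1.weakGrad w‖ / (2 ^ m * N)) h1R (by positivity) ?_ c ?_).trans_eq ?_
    · intro k hk
      have := (hJ k).1
      rwa [(Finset.mem_filter.1 hk).2] at this
    -- On this block |k|² ≥ (2^m N)² and the eigenvalue is at least |k|², so Parseval's identity for
    -- Dw bounds the coefficients.
    · rw [div_pow, le_div_iff₀ (by positivity)]
      refine le_trans ?_ (sum_le_hasSum (K.filter (fun k => J k = m + 1) ×ˢ Finset.univ)
        (fun i _ => mul_nonneg (ModeIndex.eigenvalue_nonneg i) (sq_nonneg _))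
        (hasSum_eigenvalue_modeCoeff_sq w))
      rw [Finset.sum_mul]
      refine Finset.sum_le_sum fun i hi => ?_
      rw [mul_comm]
      refine mul_le_mul_of_nonneg_right (le_trans ?_ (ModeIndex.norm_sq_le_eigenvalue i)) (sq_nonneg _)
      have := (hJ i.1).2 m (Finset.mem_filter.1 (Finset.mem_product.1 hi).1).2
      gcongr
    · have e1 : (3 * (2 ^ (m + 1) * N)) ^ s = 3 ^ s * 2 ^ s * (2 ^ m * N) ^ s := by
        rw [← Real.mul_rpow (by norm_num) (by norm_num), ← Real.mul_rpow (by norm_num) hR0.le]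
        congr 1; ring
      have e2 : (2 ^ m * N) ^ s = (2 ^ m * N) ^ (s - 1) * (2 ^ m * N) := by
        rw [Real.rpow_sub_one hR0.ne']; field_simp
      have e3 : (2 ^ m * N) ^ (s - 1) = β ^ m * N ^ (s - 1) := by
        rw [Real.mul_rpow (by positivity) hN0.le, hβ, ← Real.rpow_natCast 2 m,
          ← Real.rpow_mul (by norm_num), ← Real.rpow_natCast _ m,
          ← Real.rpow_mul (by norm_num), mul_comm (s - 1)]
      rw [e1, e2, e3]
      congr 1; field_simp
  rw [hsplit]
  refine (eLpNorm_sum_le (fun j _ => (hfc j).aestronglyMeasurable) (by norm_num)).trans ?_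
  rw [Finset.sum_range_succ']
  have hgeom : ∑ m ∈ Finset.range L, β ^ m ≤ (1 - β)⁻¹ := by
    rw [← tsum_geometric_of_lt_one hβ0.le hβ1]
    exact (summable_geometric_of_lt_one hβ0.le hβ1).sum_le_tsum _ fun _ _ => by positivity
  refine (add_le_add (Finset.sum_le_sum fun m _ => hm m) h0).trans ?_
  rw [← ENNReal.ofReal_sum_of_nonneg (fun _ _ => by positivity), ← ENNReal.ofReal_add
    (Finset.sum_nonneg fun _ _ => by positivity) (by positivity)]
  refine ENNReal.ofReal_le_ofReal ?_
  rw [← Finset.mul_sum]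
  have h5 := mul_le_mul_of_nonneg_left hgeom
    (show 0 ≤ D * 3 ^ s * (2 ^ s * N ^ (s - 1) * ‖H1.weakGrad w‖) by positivity)
  rw [div_eq_mul_inv]
  linarith

/-- The modes with frequencies in a box. -/
def boxModes (n m : ℕ) : Finset (ModeIndex n) :=
  (Fintype.piFinset fun _ => Finset.Icc (-(m : ℤ)) m) ×ˢ Finset.univ

theorem tendsto_boxModes : Tendsto (boxModes n) atTop atTop := by
  refine tendsto_atTop_finset_of_monotone ?_ ?_
  · intro a b hab i hi
    simp only [boxModes, Finset.mem_product, Fintype.mem_piFinset, Finset.mem_Icc,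
      Finset.mem_univ, and_true] at hi ⊢
    intro j
    have := hi j
    omega
  · intro i
    refine ⟨∑ j, (i.1 j).natAbs, ?_⟩
    simp only [boxModes, Finset.mem_product, Fintype.mem_piFinset, Finset.mem_Icc,
      Finset.mem_univ, and_true]
    intro j
    have : (i.1 j).natAbs ≤ ∑ j, (i.1 j).natAbs :=
      Finset.single_le_sum (f := fun j => (i.1 j).natAbs) (fun _ _ => zero_le) (Finset.mem_univ j)
    omega

/-- Trigonometric polynomials approximate in `H¹` and almost everywhere. -/
theorem exists_truncFun_tendsto (w : H1 n) : ∃ m : ℕ → ℕ,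
    Tendsto (fun j => truncH1 (boxModes n (m j)) w) atTop (𝓝 w) ∧
    ∀ᵐ x, Tendsto (fun j => truncFun (boxModes n (m j)) (H1.toL2 w) x) atTop
      (𝓝 (H1.toL2 w x)) := by
  have h1 : Tendsto (fun j => truncH1 (boxModes n j) w) atTop (𝓝 w) :=
    (tendsto_truncH1 w).comp tendsto_boxModes
  have h2 : Tendsto (fun j => H1.toL2L n (truncH1 (boxModes n j) w)) atTop (𝓝 (H1.toL2L n w)) :=
    ((H1.toL2L n).continuous.tendsto w).comp h1
  obtain ⟨m, hm, hae⟩ := (tendstoInMeasure_of_tendsto_Lp h2).exists_seq_tendsto_ae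
  refine ⟨m, h1.comp hm.tendsto_atTop, ?_⟩
  have h3 : ∀ᵐ x, ∀ j, H1.toL2 (truncH1 (boxModes n (m j)) w) x =
      truncFun (boxModes n (m j)) (H1.toL2 w) x := by
    rw [ae_all_iff]
    intro j
    rw [truncH1_eq_ofSmooth]
    exact H1.toL2_ofSmooth _
  filter_upwards [hae, h3] with x hx hx3
  exact hx.congr hx3

theorem ofReal_integral_abs_mul_sq {f g : Torus n → ℝ} (hfg : Integrable fun x => |f x| * g x ^ 2) :
    ENNReal.ofReal (∫ x, |f x| * g x ^ 2) = ∫⁻ x, ‖f x‖ₑ * ‖g x‖ₑ ^ 2 := by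
  rw [ofReal_integral_eq_lintegral_ofReal hfg (Eventually.of_forall fun _ => by positivity)]
  refine lintegral_congr fun x => ?_
  rw [ENNReal.ofReal_mul (abs_nonneg _), ← sq_abs, ENNReal.ofReal_pow (abs_nonneg _),
    ← Real.enorm_eq_ofReal_abs, ← Real.enorm_eq_ofReal_abs]

/-- A Gagliardo–Nirenberg inequality with an `L^q` weight, in additive form. -/
theorem exists_weighted_gagliardoNirenberg {q : ℝ≥0∞} (hq : 1 ≤ q)
    (hs : (n : ℝ) / 2 * q.toReal⁻¹ < 1) :
    ∃ C : ℝ, 0 ≤ C ∧ ∀ d : Torus n → ℝ, MemLp d q volume → ∀ w : H1 n, ∀ N : ℝ, 1 ≤ N →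
      Integrable (fun x => |d x| * H1.toL2 w x ^ 2) ∧
      ∫ x, |d x| * H1.toL2 w x ^ 2 ≤ C * (eLpNorm d q volume).toReal *
        (N ^ (2 * ((n : ℝ) / 2 * q.toReal⁻¹)) * ‖H1.toL2 w‖ ^ 2 +
          N ^ (2 * ((n : ℝ) / 2 * q.toReal⁻¹) - 2) * ‖H1.weakGrad w‖ ^ 2) := by
  have hB := @eLpNorm_truncFun_withDensity_le n q hq hs
  set s : ℝ := (n : ℝ) / 2 * q.toReal⁻¹ with hsdef
  set C' : ℝ := 2 ^ s / (1 - 2 ^ (s - 1)) with hC'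
  refine ⟨2 * (3 ^ s) ^ 2 * (1 + C' ^ 2), by positivity, fun d hd w N hN => ?_⟩
  set a := (eLpNorm d q volume).toReal with ha
  have ha0 : 0 ≤ a := ENNReal.toReal_nonneg
  have hN0 : 0 < N := by linarith
  set E := N ^ s * ‖H1.toL2 w‖ + C' * N ^ (s - 1) * ‖H1.weakGrad w‖ with hE
  set RHS := 2 * (3 ^ s) ^ 2 * (1 + C' ^ 2) * a * (N ^ (2 * s) * ‖H1.toL2 w‖ ^ 2 +
          N ^ (2 * s - 2) * ‖H1.weakGrad w‖ ^ 2) with hRHS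
  have hle : (√a * 3 ^ s * E) ^ 2 ≤ RHS := by
    have e1 : N ^ (2 * s) = (N ^ s) ^ 2 := by
      rw [← Real.rpow_natCast, ← Real.rpow_mul hN0.le]; congr 1; push_cast; ring
    have e2 : N ^ (2 * s - 2) = (N ^ (s - 1)) ^ 2 := by
      rw [← Real.rpow_natCast, ← Real.rpow_mul hN0.le]; congr 1; push_cast; ring
    rw [hRHS, e1, e2, mul_pow, mul_pow, Real.sq_sqrt ha0, hE]
    have h3 : 0 ≤ a * (3 ^ s : ℝ) ^ 2 := by positivity
    set X := N ^ s * ‖H1.toL2 w‖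
    set Y := N ^ (s - 1) * ‖H1.weakGrad w‖
    have h4 : (X + C' * Y) ^ 2 ≤ 2 * (1 + C' ^ 2) * (X ^ 2 + Y ^ 2) := by
      nlinarith [sq_nonneg (X - C' * Y), sq_nonneg (C' * X), sq_nonneg Y]
    have h5 := mul_le_mul_of_nonneg_left h4 h3
    simp only [X, Y] at h5
    refine le_trans (le_of_eq ?_) (h5.trans (le_of_eq ?_)) <;> ring
  have hcont : ∀ m, Continuous (truncFun (boxModes n m) (H1.toL2 w)) :=
    fun m => (smooth_truncFun _ _).continuous
  -- Fatou's lemma along almost everywhere convergent truncations. Finiteness of the weighted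
  -- integral is a conclusion here, which is why the argument runs in [0, ∞].
  have hlint : ∫⁻ x, ‖d x‖ₑ * ‖H1.toL2 w x‖ₑ ^ 2 ≤ ENNReal.ofReal RHS := by
    obtain ⟨m, -, hae⟩ := exists_truncFun_tendsto w
    have h1 : ∀ j, ∫⁻ x, ‖d x‖ₑ * ‖truncFun (boxModes n (m j)) (H1.toL2 w) x‖ₑ ^ 2 ≤
        ENNReal.ofReal RHS := by
      intro j
      rw [← eLpNorm_two_withDensity_sq hd.1 (hcont _).aestronglyMeasurable]
      refine (pow_le_pow_left₀ zero_le (hB hd _ w hN) 2).trans ?_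
      rw [← ENNReal.ofReal_pow (by
        have : (2 : ℝ) ^ (s - 1) < 1 := Real.rpow_lt_one_of_one_lt_of_neg one_lt_two (by linarith)
        have hC0 : 0 ≤ C' := div_nonneg (by positivity) (by linarith)
        positivity)]
      exact ENNReal.ofReal_le_ofReal hle
    calc ∫⁻ x, ‖d x‖ₑ * ‖H1.toL2 w x‖ₑ ^ 2
        = ∫⁻ x, liminf (fun j => ‖d x‖ₑ * ‖truncFun (boxModes n (m j)) (H1.toL2 w) x‖ₑ ^ 2)
            atTop := by
          refine lintegral_congr_ae ?_
          filter_upwards [hae] with x hx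
          refine (Tendsto.liminf_eq ?_).symm
          exact ENNReal.Tendsto.const_mul (((ENNReal.continuous_pow 2).tendsto _).comp
            ((continuous_enorm.tendsto _).comp hx))
            (Or.inr enorm_ne_top)
      _ ≤ liminf (fun j => ∫⁻ x, ‖d x‖ₑ * ‖truncFun (boxModes n (m j)) (H1.toL2 w) x‖ₑ ^ 2)
            atTop :=
          lintegral_liminf_le' fun j =>
            hd.1.enorm.mul ((hcont _).aestronglyMeasurable.enorm.pow_const 2)
      _ ≤ ENNReal.ofReal RHS :=
          liminf_le_of_le (by isBoundedDefault) fun b hb => by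
            obtain ⟨j, hj⟩ := hb.exists
            exact hj.trans (h1 j)
  have hint : Integrable (fun x => |d x| * H1.toL2 w x ^ 2) := by
    refine ⟨hd.1.norm.mul ((Lp.aestronglyMeasurable _).pow 2), ?_⟩
    refine lt_of_eq_of_lt (lintegral_congr fun x => ?_) (hlint.trans_lt ENNReal.ofReal_lt_top)
    rw [enorm_mul, enorm_pow, Real.enorm_abs]
  refine ⟨hint, ?_⟩
  rw [← ofReal_integral_abs_mul_sq hint] at hlint
  exact (ENNReal.ofReal_le_ofReal_iff (by positivity)).1 hlint

/-! ### Poincaré's inequality and absorption of the divergence term -/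

theorem mode_zero_true (x : Torus n) : mode (0, true) x = 1 := by
  simp [mode, UnitAddTorus.mFourier_zero]

theorem mode_zero_false (x : Torus n) : mode (0, false) x = 0 := by
  simp [mode, UnitAddTorus.mFourier_zero]

theorem modeCoeff_zero_true (u : Torus n → ℝ) : modeCoeff u (0, true) = ∫ x, u x := by
  simp [modeCoeff, mode_zero_true]

/-- Poincaré's inequality. -/
theorem norm_toL2_sq_sub_mean_sq_le (w : H1 n) :
    ‖H1.toL2 w‖ ^ 2 - (∫ x, H1.toL2 w x) ^ 2 ≤ ‖H1.weakGrad w‖ ^ 2 := by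
  have h1 := isParsevalFrame_modeL2 (H1.toL2 w)
  simp only [inner_toL2_modeH1] at h1
  have h2 : HasSum (fun i : ModeIndex n => if i = (0, true) then (∫ x, H1.toL2 w x) ^ 2 else 0)
      ((∫ x, H1.toL2 w x) ^ 2) := hasSum_ite_eq _ _
  -- Termwise comparison of the series: subtracting the squared mean removes the constant mode, and
  -- every other frequency has eigenvalue at least 1.
  refine hasSum_le (fun i => ?_) (h1.sub h2) (hasSum_eigenvalue_modeCoeff_sq w)
  rcases i with ⟨k, b⟩
  by_cases hk : k = 0
  · subst hk
    have he : 0 ≤ (ModeIndex.eigenvalue ((0, b) : ModeIndex n)) * modeCoeff (H1.toL2 w) (0, b) ^ 2 :=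
      mul_nonneg (ModeIndex.eigenvalue_nonneg _) (sq_nonneg _)
    cases b
    · have : modeCoeff (H1.toL2 w) ((0, false) : ModeIndex n) = 0 := by
        simp [modeCoeff, mode_zero_false]
      simp [this]
    · simpa [modeCoeff_zero_true] using he
  · have hne : ¬ ((k, b) : ModeIndex n) = (0, true) := fun h => hk (congrArg Prod.fst h)
    rw [if_neg hne, sub_zero]
    refine le_mul_of_one_le_left (sq_nonneg _) (le_trans ?_ (ModeIndex.norm_sq_le_eigenvalue (k, b)))
    obtain ⟨j, hj⟩ := Function.ne_iff.1 hk
    have h3 : (1 : ℝ) ≤ ‖k j‖ := by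
      rw [Int.norm_eq_abs, ← Int.cast_abs]
      exact_mod_cast Int.one_le_abs hj
    exact one_le_pow₀ (h3.trans (norm_le_pi_norm k j))

theorem SmoothOnTorus.weakGrad_ofSmooth_const (c : ℝ) :
    H1.weakGrad (H1.ofSmooth (fun _ : Torus n => c) (SmoothOnTorus.const c)) = 0 := by
  apply Lp.ext
  refine (H1.weakGrad_ofSmooth (SmoothOnTorus.const c)).trans ?_
  refine EventuallyEq.trans ?_ (Lp.coeFn_zero _ _ _).symm
  refine Eventually.of_forall fun x => ?_
  ext i; simp [grad_apply, SmoothOnTorus.partialDeriv_const]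

theorem eLpNorm_one_toReal_le {q : ℝ≥0∞} (hq : 1 ≤ q) {d : Torus n → ℝ} (hd : MemLp d q volume) :
    ∫ x, |d x| ≤ (eLpNorm d q volume).toReal := by
  have h := eLpNorm_le_eLpNorm_of_exponent_le hq hd.1
  have h2 : ∫ x, |d x| = (eLpNorm d 1 volume).toReal := by
    rw [eLpNorm_one_eq_lintegral_enorm]
    exact integral_norm_eq_lintegral_enorm hd.1
  rw [h2]
  exact ENNReal.toReal_mono hd.2.ne h

/-- The energy contribution of the divergence is absorbed by the Dirichlet energy, up to terms
controlled by the mean value and the `L²` norm. -/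
theorem exists_weighted_energy_bound {q : ℝ≥0∞} (hq : 1 ≤ q) {r : ℝ} (hr : 1 ≤ r)
    (hqr : (n : ℝ) / 2 * q.toReal⁻¹ + r⁻¹ ≤ 1) :
    ∃ K : ℝ, 0 ≤ K ∧ ∀ d : Torus n → ℝ, MemLp d q volume → ∀ w : H1 n,
      ∫ x, |d x| * H1.toL2 w x ^ 2 ≤ ‖H1.weakGrad w‖ ^ 2 +
        K * (1 + (eLpNorm d q volume).toReal ^ r) * (∫ x, H1.toL2 w x) ^ 2 +
        K * (eLpNorm d q volume).toReal ^ r * ‖H1.toL2 w‖ ^ 2 := by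
  have hr0 : 0 < r := by linarith
  have hs1 : (n : ℝ) / 2 * q.toReal⁻¹ < 1 := by
    have : 0 < r⁻¹ := by positivity
    linarith
  obtain ⟨C, hC0, hC⟩ := exists_weighted_gagliardoNirenberg hq hs1
  set s : ℝ := (n : ℝ) / 2 * q.toReal⁻¹ with hsdef
  have hs0 : 0 ≤ s := by positivity
  refine ⟨2 + (4 * C) ^ r, by positivity, fun d hd w => ?_⟩
  set a := (eLpNorm d q volume).toReal with ha
  have ha0 : 0 ≤ a := ENNReal.toReal_nonneg
  set m := ∫ x, H1.toL2 w x with hm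
  have h1s : SmoothOnTorus (fun _ : Torus n => m) := SmoothOnTorus.const m
  -- Removing the mean is what lets Poincaré's inequality control the L² norm by the gradient; the
  -- mean is paid for separately.
  set v : H1 n := w - H1.ofSmooth _ h1s with hv
  have hvL2 : H1.toL2 v =ᵐ[volume] fun x => H1.toL2 w x - m := by
    have : H1.toL2 v = H1.toL2 w - H1.toL2 (H1.ofSmooth _ h1s) := rfl
    rw [this]
    filter_upwards [Lp.coeFn_sub (H1.toL2 w) (H1.toL2 (H1.ofSmooth _ h1s)),
      H1.toL2_ofSmooth h1s] with x h1 h2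
    rw [h1, Pi.sub_apply, h2]
  have hvD : H1.weakGrad v = H1.weakGrad w := by
    have : H1.weakGrad v = H1.weakGrad w - H1.weakGrad (H1.ofSmooth _ h1s) := rfl
    rw [this, SmoothOnTorus.weakGrad_ofSmooth_const, sub_zero]
  have hwi : Integrable (fun x => H1.toL2 w x) :=
    (Lp.memLp (H1.toL2 w)).integrable (by norm_num)
  have hmv : ∫ x, H1.toL2 v x = 0 := by
    rw [integral_congr_ae hvL2, integral_sub hwi (integrable_const _)]
    simp [hm]
  have hE : ‖H1.toL2 v‖ ^ 2 ≤ ‖H1.toL2 w‖ ^ 2 := by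
    have hwi2 : Integrable (fun x => H1.toL2 w x ^ 2) := (Lp.memLp (H1.toL2 w)).integrable_sq
    have : ‖H1.toL2 v‖ ^ 2 = ‖H1.toL2 w‖ ^ 2 - m ^ 2 := by
      rw [L2.norm_sq_eq_integral, L2.norm_sq_eq_integral]
      have e : ∫ x, H1.toL2 v x ^ 2 = ∫ x, (H1.toL2 w x ^ 2 - 2 * m * H1.toL2 w x + m ^ 2) := by
        refine integral_congr_ae ?_
        filter_upwards [hvL2] with x hx
        rw [hx]; ring
      rw [e, integral_add (f := fun x => H1.toL2 w x ^ 2 - 2 * m * H1.toL2 w x)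
        (hwi2.sub (hwi.const_mul _)) (integrable_const _),
        integral_sub hwi2 (hwi.const_mul _), integral_const_mul, ← hm]
      simp; ring
    rw [this]; linarith [sq_nonneg m]
  have hED : ‖H1.toL2 v‖ ^ 2 ≤ ‖H1.weakGrad w‖ ^ 2 := by
    have := norm_toL2_sq_sub_mean_sq_le v
    rw [hmv, hvD] at this
    simpa using this
  have hdi : Integrable (fun x => |d x|) := (hd.integrable hq).norm
  have hsplit : ∫ x, |d x| * H1.toL2 w x ^ 2 ≤
      2 * m ^ 2 * a + 2 * ∫ x, |d x| * H1.toL2 v x ^ 2 := by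
    have i2 := (hC d hd v 1 le_rfl).1
    calc ∫ x, |d x| * H1.toL2 w x ^ 2
        ≤ ∫ x, (2 * m ^ 2 * |d x| + 2 * (|d x| * H1.toL2 v x ^ 2)) := by
          refine integral_mono_ae (hC d hd w 1 le_rfl).1
            ((hdi.const_mul _).add (i2.const_mul _)) ?_
          filter_upwards [hvL2] with x hx
          rw [hx]
          nlinarith [abs_nonneg (d x), mul_nonneg (abs_nonneg (d x))
            (sq_nonneg (H1.toL2 w x - m - m))]
      _ = 2 * m ^ 2 * (∫ x, |d x|) + 2 * ∫ x, |d x| * H1.toL2 v x ^ 2 := by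
          rw [integral_add (hdi.const_mul _) (i2.const_mul _), integral_const_mul,
            integral_const_mul]
      _ ≤ _ := by
          gcongr
          exact eLpNorm_one_toReal_le hq hd
  have har : 0 ≤ a ^ r := by positivity
  have ha1 : a ≤ 1 + a ^ r := by
    rcases le_total a 1 with h | h
    · linarith
    · have := Real.rpow_le_rpow_of_exponent_le h hr
      rw [Real.rpow_one] at this
      linarith
  have hmain : 2 * ∫ x, |d x| * H1.toL2 v x ^ 2 ≤
      ‖H1.weakGrad w‖ ^ 2 + (4 * C) ^ r * a ^ r * ‖H1.toL2 v‖ ^ 2 := by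
    -- A small weight is absorbed with N = 1, Poincaré's inequality bounding ‖v‖ by ‖Dw‖. A large
    -- weight needs N > 1, at the price of a multiple of ‖v‖².
    rcases le_total (4 * C * a) 1 with hy | hy
    · have := (hC d hd v 1 le_rfl).2
      simp only [Real.one_rpow, one_mul, hvD] at this
      have h2 : C * a * (‖H1.toL2 v‖ ^ 2 + ‖H1.weakGrad w‖ ^ 2) ≤
          C * a * (2 * ‖H1.weakGrad w‖ ^ 2) := by
        refine mul_le_mul_of_nonneg_left (by linarith) (by positivity)
      have h3 : 0 ≤ (4 * C) ^ r * a ^ r * ‖H1.toL2 v‖ ^ 2 := by positivity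
      nlinarith [sq_nonneg ‖H1.weakGrad w‖]
    · set y := 4 * C * a with hydef
      have hy0 : 0 < y := by linarith
      have hs2 : 0 < 2 - 2 * s := by linarith
      -- This N solves y N^(2s-2) = 1, so that the gradient term gets the coefficient 1/4; then y
      -- N^(2s) = y^(1/(1-s)).
      have hN : 1 ≤ y ^ (1 / (2 - 2 * s)) := Real.one_le_rpow hy (by positivity)
      have := (hC d hd v _ hN).2
      rw [hvD, ← Real.rpow_mul hy0.le, ← Real.rpow_mul hy0.le] at this
      have e1 : 1 / (2 - 2 * s) * (2 * s - 2) = -1 := by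
        rw [show 2 * s - 2 = -(2 - 2 * s) by ring, mul_neg, one_div_mul_cancel hs2.ne']
      have e2 : y * y ^ (1 / (2 - 2 * s) * (2 * s)) = y ^ (1 / (1 - s)) := by
        rw [← Real.rpow_one_add' hy0.le (by positivity)]
        congr 1
        have : 1 - s ≠ 0 := by linarith
        field_simp; ring
      -- The exponent condition enters here: s + 1/r ≤ 1 means 1/(1-s) ≤ r, and y ≥ 1.
      have e3 : y ^ (1 / (1 - s)) ≤ (4 * C) ^ r * a ^ r := by
        rw [← Real.mul_rpow (by positivity) ha0, ← hydef]
        refine Real.rpow_le_rpow_of_exponent_le hy ?_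
        have : r⁻¹ ≤ 1 - s := by linarith
        rw [one_div, inv_le_comm₀ (by linarith) hr0]
        exact this
      rw [e1, Real.rpow_neg_one] at this
      have e4 : C * a = y / 4 := by rw [hydef]; ring
      rw [e4] at this
      have e5 : y / 4 * (y ^ (1 / (2 - 2 * s) * (2 * s)) * ‖H1.toL2 v‖ ^ 2 +
          y⁻¹ * ‖H1.weakGrad w‖ ^ 2) =
          y ^ (1 / (1 - s)) / 4 * ‖H1.toL2 v‖ ^ 2 + ‖H1.weakGrad w‖ ^ 2 / 4 := by
        rw [← e2]; field_simp
      rw [e5] at this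
      have h6 := mul_le_mul_of_nonneg_right e3 (sq_nonneg ‖H1.toL2 v‖)
      have h7 : 0 ≤ (4 * C) ^ r * a ^ r * ‖H1.toL2 v‖ ^ 2 := by positivity
      nlinarith [sq_nonneg ‖H1.weakGrad w‖]
  have hK : 0 ≤ (4 * C) ^ r := by positivity
  have h8 : (4 * C) ^ r * a ^ r * ‖H1.toL2 v‖ ^ 2 ≤ (4 * C) ^ r * a ^ r * ‖H1.toL2 w‖ ^ 2 := by
    gcongr
  have h9 : 2 * m ^ 2 * a ≤ 2 * (1 + a ^ r) * m ^ 2 := by nlinarith [sq_nonneg m]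
  have h10 : 0 ≤ (4 * C) ^ r * (1 + a ^ r) * m ^ 2 := by positivity
  have h11 : 0 ≤ 2 * a ^ r * ‖H1.toL2 w‖ ^ 2 := by positivity
  calc ∫ x, |d x| * H1.toL2 w x ^ 2 ≤ _ := hsplit
    _ ≤ 2 * (1 + a ^ r) * m ^ 2 + (‖H1.weakGrad w‖ ^ 2 +
        (4 * C) ^ r * a ^ r * ‖H1.toL2 w‖ ^ 2) := by linarith
    _ ≤ _ := by linarith

/-! ### Smooth truncations and limits of integrals -/

section Truncation

variable {ε : ℝ}

theorem one_le_sqrt_one_add_sq (ε s : ℝ) : 1 ≤ √(1 + (ε * s) ^ 2) :=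
  Real.one_le_sqrt.2 (by linarith [sq_nonneg (ε * s)])

theorem sq_sqrt_one_add_sq (ε s : ℝ) : √(1 + (ε * s) ^ 2) ^ 2 = 1 + (ε * s) ^ 2 :=
  Real.sq_sqrt (by positivity)

/-- A smooth bounded truncation of the identity. -/
def truncId (ε s : ℝ) : ℝ := s / √(1 + (ε * s) ^ 2)

/-- The derivative of `truncId`. -/
def truncIdDeriv (ε s : ℝ) : ℝ := 1 / √(1 + (ε * s) ^ 2) ^ 3

/-- The primitive of `truncId` vanishing at `0`. -/
def truncIdPrim (ε s : ℝ) : ℝ := s ^ 2 / (1 + √(1 + (ε * s) ^ 2))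

theorem contDiff_sqrt_one_add_sq (ε : ℝ) : ContDiff ℝ ∞ fun s : ℝ => √(1 + (ε * s) ^ 2) :=
  ContDiff.sqrt (by fun_prop) fun s => by positivity

theorem contDiff_truncId (ε : ℝ) : ContDiff ℝ ∞ (truncId ε) :=
  contDiff_id.div (contDiff_sqrt_one_add_sq ε) fun s => by positivity

theorem contDiff_truncIdPrim (ε : ℝ) : ContDiff ℝ ∞ (truncIdPrim ε) :=
  (contDiff_id.pow 2).div (contDiff_const.add (contDiff_sqrt_one_add_sq ε)) fun s => by positivity

theorem hasDerivAt_sqrt_one_add_sq (ε s : ℝ) :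
    HasDerivAt (fun s : ℝ => √(1 + (ε * s) ^ 2)) (ε ^ 2 * s / √(1 + (ε * s) ^ 2)) s := by
  have h : HasDerivAt (fun s : ℝ => 1 + (ε * s) ^ 2) (2 * ε ^ 2 * s) s := by
    have := ((((hasDerivAt_id s).const_mul ε).pow 2).const_add 1)
    simp only [id] at this
    refine this.congr_deriv ?_
    push_cast; ring
  refine (h.sqrt (by positivity)).congr_deriv ?_
  field_simp

theorem hasDerivAt_truncId (ε s : ℝ) : HasDerivAt (truncId ε) (truncIdDeriv ε s) s := by
  have hR : √(1 + (ε * s) ^ 2) ≠ 0 := by positivity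
  refine ((hasDerivAt_id s).div (hasDerivAt_sqrt_one_add_sq ε s) hR).congr_deriv ?_
  have h2 := sq_sqrt_one_add_sq ε s
  unfold truncIdDeriv
  set R := √(1 + (ε * s) ^ 2)
  simp only [id]
  field_simp
  linear_combination h2

/-- Rationalising, s²/(1 + R) = (R - 1)/ε² with R = √(1 + ε²s²), and the latter is easy to
differentiate. The first form makes the bounds 0 and s² and the limit s²/2 as ε → 0 visible. -/
theorem hasDerivAt_truncIdPrim (hε : ε ≠ 0) (s : ℝ) :
    HasDerivAt (truncIdPrim ε) (truncId ε s) s := by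
  have he : truncIdPrim ε = fun s => (√(1 + (ε * s) ^ 2) - 1) / ε ^ 2 := by
    funext s
    have h2 := sq_sqrt_one_add_sq ε s
    have h1 := one_le_sqrt_one_add_sq ε s
    unfold truncIdPrim
    set R := √(1 + (ε * s) ^ 2)
    rw [div_eq_div_iff (by positivity) (by positivity)]
    linear_combination -h2
  rw [he]
  refine (((hasDerivAt_sqrt_one_add_sq ε s).sub_const 1).div_const (ε ^ 2)).congr_deriv ?_
  unfold truncId
  field_simp

theorem abs_truncId_le_abs (ε s : ℝ) : |truncId ε s| ≤ |s| := by
  unfold truncId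
  rw [abs_div, abs_of_nonneg (Real.sqrt_nonneg _)]
  exact div_le_self (abs_nonneg _) (one_le_sqrt_one_add_sq ε s)

theorem abs_truncId_le (hε : 0 < ε) (s : ℝ) : |truncId ε s| ≤ 1 / ε := by
  unfold truncId
  have h1 := one_le_sqrt_one_add_sq ε s
  rw [abs_div, abs_of_nonneg (Real.sqrt_nonneg _), div_le_div_iff₀ (by linarith) hε, one_mul]
  refine Real.le_sqrt_of_sq_le ?_
  rw [mul_pow, sq_abs, mul_pow]; nlinarith

theorem truncIdDeriv_nonneg (ε s : ℝ) : 0 ≤ truncIdDeriv ε s := by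
  unfold truncIdDeriv; positivity

theorem truncIdDeriv_le_one (ε s : ℝ) : truncIdDeriv ε s ≤ 1 := by
  unfold truncIdDeriv
  exact div_le_one_of_le₀ (one_le_pow₀ (one_le_sqrt_one_add_sq ε s)) (by positivity)

theorem continuous_truncIdDeriv (ε : ℝ) : Continuous (truncIdDeriv ε) :=
  continuous_const.div ((contDiff_sqrt_one_add_sq ε).continuous.pow 3) fun s => by positivity

theorem truncIdPrim_nonneg (ε s : ℝ) : 0 ≤ truncIdPrim ε s := by
  unfold truncIdPrim; positivity

theorem truncIdPrim_le (ε s : ℝ) : truncIdPrim ε s ≤ s ^ 2 := by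
  unfold truncIdPrim
  exact div_le_self (sq_nonneg _) (by linarith [one_le_sqrt_one_add_sq ε s])

theorem abs_truncIdPrim_sub_le (hε : 0 < ε) (s t : ℝ) :
    |truncIdPrim ε s - truncIdPrim ε t| ≤ 1 / ε * |s - t| := by
  have := Convex.norm_image_sub_le_of_norm_hasDerivWithin_le (f := truncIdPrim ε)
    (f' := truncId ε) (s := univ) (C := 1 / ε) (x := t) (y := s)
    (fun x _ => (hasDerivAt_truncIdPrim hε.ne' x).hasDerivWithinAt)
    (fun x _ => abs_truncId_le hε x) convex_univ (mem_univ _) (mem_univ _)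
  exact this

theorem tendsto_sqrt_one_add_sq (s : ℝ) :
    Tendsto (fun ε : ℝ => √(1 + (ε * s) ^ 2)) (𝓝 0) (𝓝 1) := by
  have h : Continuous (fun ε : ℝ => √(1 + (ε * s) ^ 2)) := by fun_prop
  simpa using h.tendsto 0

theorem tendsto_truncId (s : ℝ) : Tendsto (fun ε => truncId ε s) (𝓝 0) (𝓝 s) := by
  simpa using! tendsto_const_nhds (x := s) |>.div (tendsto_sqrt_one_add_sq s) one_ne_zero

theorem tendsto_truncIdDeriv (s : ℝ) : Tendsto (fun ε => truncIdDeriv ε s) (𝓝 0) (𝓝 1) := by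
  simpa using! tendsto_const_nhds (x := (1 : ℝ)) |>.div ((tendsto_sqrt_one_add_sq s).pow 3)
    (by norm_num)

theorem tendsto_truncIdPrim (s : ℝ) :
    Tendsto (fun ε => truncIdPrim ε s) (𝓝 0) (𝓝 (s ^ 2 / 2)) := by
  have := tendsto_const_nhds (x := s ^ 2) |>.div ((tendsto_sqrt_one_add_sq s).const_add 1)
    (by norm_num)
  simpa [one_add_one_eq_two] using! this

end Truncation

section Limits

variable {α : Type*} [MeasurableSpace α] {μ : Measure α}

/-- Write h_j φ_j = (h_j - h₀) φ_j + h₀ φ_j: the first part vanishes by L¹ convergence, the second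
converges by domination. -/
theorem tendsto_integral_mul_of_bounded {h : ℕ → α → ℝ} {h₀ : α → ℝ} {φ : ℕ → α → ℝ} {φ₀ : α → ℝ}
    {B : ℝ} (hi : ∀ j, Integrable (h j) μ) (h₀i : Integrable h₀ μ)
    (hh : Tendsto (fun j => ∫ x, |h j x - h₀ x| ∂μ) atTop (𝓝 0))
    (hφm : ∀ j, AEStronglyMeasurable (φ j) μ) (hφB : ∀ j x, |φ j x| ≤ B)
    (hφ : ∀ᵐ x ∂μ, Tendsto (fun j => φ j x) atTop (𝓝 (φ₀ x))) :
    Tendsto (fun j => ∫ x, h j x * φ j x ∂μ) atTop (𝓝 (∫ x, h₀ x * φ₀ x ∂μ)) := by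
  have hB : ∀ j, ∀ᵐ x ∂μ, ‖φ j x‖ ≤ B := fun j => Eventually.of_forall (hφB j)
  have i1 : ∀ j, Integrable (fun x => h j x * φ j x) μ := fun j => (hi j).mul_bdd (hφm j) (hB j)
  have i2 : ∀ j, Integrable (fun x => h₀ x * φ j x) μ := fun j => h₀i.mul_bdd (hφm j) (hB j)
  have t1 : Tendsto (fun j => ∫ x, h₀ x * φ j x ∂μ) atTop (𝓝 (∫ x, h₀ x * φ₀ x ∂μ)) := by
    refine tendsto_integral_of_dominated_convergence (fun x => |h₀ x| * B)
      (fun j => (i2 j).aestronglyMeasurable) (h₀i.abs.mul_const B) ?_ ?_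
    · intro j
      refine Eventually.of_forall fun x => ?_
      rw [norm_mul]
      exact mul_le_mul_of_nonneg_left (hφB j x) (norm_nonneg _)
    · filter_upwards [hφ] with x hx
      exact hx.const_mul _
  have t2 : Tendsto (fun j => ∫ x, h j x * φ j x ∂μ - ∫ x, h₀ x * φ j x ∂μ) atTop (𝓝 0) := by
    refine squeeze_zero_norm (fun j => ?_) (by simpa using hh.mul_const B)
    rw [← integral_sub (i1 j) (i2 j), ← integral_mul_const]
    refine norm_integral_le_of_norm_le (((hi j).sub h₀i).abs.mul_const B)
      (Eventually.of_forall fun x => ?_)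
    rw [← sub_mul, norm_mul]
    exact mul_le_mul_of_nonneg_left (hφB j x) (norm_nonneg _)
  simpa using t2.add t1

/-- Young's inequality with a free parameter δ in place of Cauchy–Schwarz: δ is chosen first to make
δ ∫ X small, then j. It serves products of L² fields and weighted integrals alike. -/
theorem tendsto_integral_of_le_add_div {F Y : ℕ → α → ℝ} {X : α → ℝ} (hF : ∀ j x, 0 ≤ F j x)
    (hX : Integrable X μ) (hX0 : ∀ x, 0 ≤ X x) (hY : ∀ j, Integrable (Y j) μ)
    (h : ∀ δ > 0, ∀ j x, F j x ≤ δ * X x + Y j x / δ)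
    (hlim : Tendsto (fun j => ∫ x, Y j x ∂μ) atTop (𝓝 0)) :
    Tendsto (fun j => ∫ x, F j x ∂μ) atTop (𝓝 0) := by
  have hXi : 0 ≤ ∫ x, X x ∂μ := integral_nonneg hX0
  refine tendsto_order.2 ⟨fun a ha => Eventually.of_forall fun j =>
    ha.trans_le (integral_nonneg (hF j)), fun ε hε => ?_⟩
  set δ := ε / (2 * (∫ x, X x ∂μ + 1)) with hδ
  have hδ0 : 0 < δ := by positivity
  have h1 : δ * ∫ x, X x ∂μ < ε / 2 := by
    rw [hδ, div_mul_eq_mul_div, div_lt_div_iff₀ (by positivity) two_pos]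
    nlinarith
  filter_upwards [hlim.eventually (gt_mem_nhds (show 0 < ε / 2 * δ by positivity))] with j hj
  have h2 : ∫ x, F j x ∂μ ≤ ∫ x, (δ * X x + Y j x / δ) ∂μ :=
    integral_mono_of_nonneg (Eventually.of_forall (hF j))
      ((hX.const_mul δ).add ((hY j).div_const δ)) (Eventually.of_forall (h δ hδ0 j))
  rw [integral_add (hX.const_mul δ) ((hY j).div_const δ), integral_const_mul,
    integral_div] at h2
  have h3 : (∫ x, Y j x ∂μ) / δ < ε / 2 := (div_lt_iff₀ hδ0).2 hj
  linarith

theorem mul_le_add_div {δ a y : ℝ} (hδ : 0 < δ) (ha : 0 ≤ a) : a * y ≤ δ * a + a * y ^ 2 / δ := by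
  rw [← sub_nonneg]
  have : δ * a + a * y ^ 2 / δ - a * y = a / δ * ((δ - y / 2) ^ 2 + 3 / 4 * y ^ 2) := by
    field_simp; ring
  rw [this]; positivity

theorem mul_le_sq_add_div {δ a y : ℝ} (hδ : 0 < δ) : a * y ≤ δ * a ^ 2 + y ^ 2 / δ := by
  rw [← sub_nonneg]
  have : δ * a ^ 2 + y ^ 2 / δ - a * y = 1 / δ * ((δ * a - y / 2) ^ 2 + 3 / 4 * y ^ 2) := by
    field_simp; ring
  rw [this]; positivity

end Limits

/-! ### The pairing of div(bv) with v -/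

theorem integrable_inner_of_memLp {b c : Torus n → Vec n} (hb : MemLp b 2 volume)
    (hc : MemLp c 2 volume) : Integrable (fun x => inner ℝ (b x) (c x)) := by
  refine (MemLp.integrable_mul hb.norm hc.norm : Integrable (fun x => ‖b x‖ * ‖c x‖)).mono
    (hb.1.inner (𝕜 := ℝ) hc.1) (Eventually.of_forall fun x => ?_)
  rw [Pi.mul_apply, norm_mul, norm_norm, norm_norm]
  exact norm_inner_le_norm _ _

/-- Hahn–Banach extends L to L² × L², where Riesz representation applies; completeness of H¹ is not
used. Having integrals in place of an abstract functional permits almost everywhere limits inside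
the pairing. -/
theorem H1.exists_riesz (L : H1 n →L[ℝ] ℝ) : ∃ (α : L2 n) (β : L2Vec n), ∀ w : H1 n,
    L w = (∫ x, α x * H1.toL2 w x) + ∫ x, inner ℝ (β x) (H1.weakGrad w x) := by
  obtain ⟨g, hg, -⟩ := exists_extension_norm_eq (H1 n) L
  set p := (InnerProductSpace.toDual ℝ (WithLp 2 (L2 n × L2Vec n))).symm g with hp
  refine ⟨p.fst, p.snd, fun w => ?_⟩
  rw [← hg w, ← L2.inner_eq_integral_mul, ← L2Vec.inner_eq_integral]
  exact (InnerProductSpace.toDual_symm_apply (x := (w : WithLp 2 (L2 n × L2Vec n))) (y := g)).symm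

/-- Convergence in `H¹` implies convergence in `L¹` of the products with an `L²` field. -/
theorem tendsto_integral_abs_inner_sub {b : Torus n → Vec n} (hb : MemLp b 2 volume)
    {p : ℕ → Torus n → ℝ} (hp : ∀ j, SmoothOnTorus (p j)) {v : H1 n}
    (hlim : Tendsto (fun j => H1.ofSmooth (p j) (hp j)) atTop (𝓝 v)) :
    Tendsto (fun j => ∫ x, |inner ℝ (b x) (grad (p j) x) - inner ℝ (b x) (H1.weakGrad v x)|) atTop
      (𝓝 0) := by
  have hG := Lp.memLp (H1.weakGrad v)
  have hgr : ∀ j, MemLp (fun x => grad (p j) x - H1.weakGrad v x) 2 volume :=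
    fun j => ((hp j).continuous_grad.memLp_torus 2).sub hG
  have hlim2 : Tendsto (fun j => ∫ x, ‖grad (p j) x - H1.weakGrad v x‖ ^ 2) atTop (𝓝 0) := by
    have h1 := (((H1.weakGradL n).continuous.tendsto v).comp hlim)
    have h2 := (tendsto_iff_norm_sub_tendsto_zero.1 h1).pow 2
    simp only [ne_eq, OfNat.ofNat_ne_zero, not_false_eq_true, zero_pow] at h2
    refine h2.congr fun j => ?_
    rw [L2Vec.norm_sq_eq_integral]
    refine integral_congr_ae ?_
    filter_upwards [Lp.coeFn_sub (H1.weakGrad (H1.ofSmooth (p j) (hp j))) (H1.weakGrad v),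
      H1.weakGrad_ofSmooth (hp j)] with x h1 h2
    simp only [Function.comp, H1.weakGradL_apply]
    rw [h1, Pi.sub_apply, h2]
  refine tendsto_integral_of_le_add_div (X := fun x => ‖b x‖ ^ 2) (fun _ _ => abs_nonneg _)
    (hb.norm.integrable_sq) (fun _ => sq_nonneg _) (fun j => (hgr j).norm.integrable_sq) ?_ hlim2
  intro δ hδ j x
  rw [← inner_sub_right]
  exact (abs_real_inner_le_norm _ _).trans (mul_le_sq_add_div hδ)

/-- Convergence in `H¹` implies convergence in `L¹` with respect to an admissible weight. -/
theorem tendsto_integral_abs_mul_sub {d : Torus n → ℝ} (hd : Integrable d) {C : ℝ}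
    (hC : ∀ w : H1 n, Integrable (fun x => |d x| * H1.toL2 w x ^ 2) ∧
      ∫ x, |d x| * H1.toL2 w x ^ 2 ≤ C * ‖w‖ ^ 2)
    {p : ℕ → Torus n → ℝ} (hp : ∀ j, SmoothOnTorus (p j)) {v : H1 n}
    (hlim : Tendsto (fun j => H1.ofSmooth (p j) (hp j)) atTop (𝓝 v)) :
    Tendsto (fun j => ∫ x, |d x| * |p j x - H1.toL2 v x|) atTop (𝓝 0) := by
  have hae : ∀ j, (fun x => |d x| * H1.toL2 (H1.ofSmooth (p j) (hp j) - v) x ^ 2) =ᵐ[volume]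
      fun x => |d x| * |p j x - H1.toL2 v x| ^ 2 := by
    intro j
    have : H1.toL2 (H1.ofSmooth (p j) (hp j) - v) =
      H1.toL2 (H1.ofSmooth (p j) (hp j)) - H1.toL2 v := rfl
    filter_upwards [Lp.coeFn_sub (H1.toL2 (H1.ofSmooth (p j) (hp j))) (H1.toL2 v),
      H1.toL2_ofSmooth (hp j)] with x h1 h2
    rw [this, h1, Pi.sub_apply, h2, sq_abs]
  refine tendsto_integral_of_le_add_div (X := fun x => |d x|)
    (fun _ _ => by positivity) hd.abs (fun _ => abs_nonneg _)
    (fun j => (hC (H1.ofSmooth (p j) (hp j) - v)).1.congr (hae j))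
    (fun δ hδ j x => mul_le_add_div hδ (abs_nonneg _)) ?_
  have h2 := ((tendsto_iff_norm_sub_tendsto_zero.1 hlim).pow 2).const_mul C
  simp only [ne_eq, OfNat.ofNat_ne_zero, not_false_eq_true, zero_pow, mul_zero] at h2
  refine squeeze_zero (fun j => integral_nonneg fun x => by positivity) (fun j => ?_) h2
  rw [← integral_congr_ae (hae j)]
  exact (hC _).2

theorem integral_inner_grad_mul {b : Torus n → Vec n} {d : Torus n → ℝ} (hb : MemLp b 2 volume)
    (hA : ∀ ψ, SmoothOnTorus ψ → ∫ x, inner ℝ (b x) (grad ψ x) = -∫ x, d x * ψ x)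
    {p φ : Torus n → ℝ} (hp : SmoothOnTorus p) (hφ : SmoothOnTorus φ) :
    (∫ x, inner ℝ (b x) (grad p x) * φ x) + ∫ x, p x * inner ℝ (b x) (grad φ x) =
      -∫ x, d x * p x * φ x := by
  have h := hA _ (hp.mul hφ)
  obtain ⟨B, -, hB⟩ := hφ.continuous.exists_bound_torus
  obtain ⟨B', -, hB'⟩ := hp.continuous.exists_bound_torus
  have i1 := integrable_inner_of_memLp hb (hp.continuous_grad.memLp_torus 2)
  have i2 := integrable_inner_of_memLp hb (hφ.continuous_grad.memLp_torus 2)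
  rw [← integral_add (i1.mul_bdd hφ.continuous.aestronglyMeasurable (Eventually.of_forall hB))
    (i2.bdd_mul hp.continuous.aestronglyMeasurable (Eventually.of_forall hB'))]
  simp only [mul_assoc]
  rw [← h]
  congr 1; funext x
  rw [grad_mul hp hφ, inner_add_right, inner_smul_right, inner_smul_right]
  ring

/-- If `b` has divergence `d`, then `⟨div (b v), v⟩ = ½ ∫ d v²` for every `v ∈ H¹` for which
`div (b v)` belongs to `H⁻¹`. -/
theorem pairing_eq_half_integral_div {b : Torus n → Vec n} {d : Torus n → ℝ}
    (hb : MemLp b 2 volume) (hd : Integrable d) {C : ℝ}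
    (hC : ∀ w : H1 n, Integrable (fun x => |d x| * H1.toL2 w x ^ 2) ∧
      ∫ x, |d x| * H1.toL2 w x ^ 2 ≤ C * ‖w‖ ^ 2)
    (hA : ∀ ψ, SmoothOnTorus ψ → ∫ x, inner ℝ (b x) (grad ψ x) = -∫ x, d x * ψ x)
    (v : H1 n) (L : H1 n →L[ℝ] ℝ)
    (hL : ∀ ψ, ∀ h : SmoothOnTorus ψ,
      L (H1.ofSmooth ψ h) = ∫ x, H1.toL2 v x * inner ℝ (b x) (grad ψ x)) :
    L v = -(1 / 2) * ∫ x, d x * H1.toL2 v x ^ 2 := by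
  obtain ⟨α, β, hαβ⟩ := H1.exists_riesz L
  obtain ⟨m, hm, hae⟩ := exists_truncFun_tendsto v
  set u := H1.toL2 v with hu
  set G := H1.weakGrad v with hG
  obtain ⟨p, hp, hlim, hpu⟩ : ∃ (p : ℕ → Torus n → ℝ) (hp : ∀ j, SmoothOnTorus (p j)),
      Tendsto (fun j => H1.ofSmooth (p j) (hp j)) atTop (𝓝 v) ∧
      ∀ᵐ x, Tendsto (fun j => p j x) atTop (𝓝 (u x)) :=
    ⟨fun j => truncFun (boxModes n (m j)) u, fun j => smooth_truncFun _ _,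
      by simpa only [truncH1_eq_ofSmooth] using hm, hae⟩
  have hum : MemLp u 2 volume := Lp.memLp u
  have hGm : MemLp G 2 volume := Lp.memLp G
  have hαi : Integrable α := (Lp.memLp α).integrable (by norm_num)
  have hbG := integrable_inner_of_memLp hb hGm
  have hβG := integrable_inner_of_memLp (Lp.memLp β) hGm
  have hbp : ∀ j, Integrable (fun x => inner ℝ (b x) (grad (p j) x)) :=
    fun j => integrable_inner_of_memLp hb ((hp j).continuous_grad.memLp_torus 2)
  have hβp : ∀ j, Integrable (fun x => inner ℝ (β x) (grad (p j) x)) :=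
    fun j => integrable_inner_of_memLp (Lp.memLp β) ((hp j).continuous_grad.memLp_torus 2)
  have tb := tendsto_integral_abs_inner_sub hb hp hlim
  have tβ := tendsto_integral_abs_inner_sub (Lp.memLp β) hp hlim
  have td := tendsto_integral_abs_mul_sub hd hC hp hlim
  rw [← hu] at td
  have hdu2 : Integrable (fun x => |d x| * u x ^ 2) := (hC v).1
  have hdu : Integrable (fun x => d x * u x) := by
    refine (hd.abs.add hdu2).mono (hd.1.mul hum.1) (Eventually.of_forall fun x => ?_)
    have h1 := mul_le_add_div (δ := 1) (y := |u x|) one_pos (abs_nonneg (d x))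
    rw [sq_abs, one_mul, div_one] at h1
    rw [Pi.add_apply, norm_mul, Real.norm_eq_abs, Real.norm_eq_abs, Real.norm_eq_abs]
    exact h1.trans (le_abs_self _)
  have hdp : ∀ j, Integrable (fun x => d x * p j x) := fun j => by
    obtain ⟨B, -, hB⟩ := (hp j).continuous.exists_bound_torus
    exact hd.mul_bdd (hp j).continuous.aestronglyMeasurable (Eventually.of_forall hB)
  have td' : Tendsto (fun j => ∫ x, |d x * p j x - d x * u x|) atTop (𝓝 0) := by
    refine td.congr fun j => ?_
    congr 1; funext x; rw [← mul_sub, abs_mul]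
  -- the product identity
  have hprod : ∀ φ, SmoothOnTorus φ → ∫ x, u x * inner ℝ (b x) (grad φ x) =
      -(∫ x, inner ℝ (b x) (G x) * φ x) - ∫ x, d x * u x * φ x := by
    intro φ hφ
    obtain ⟨B, -, hB⟩ := hφ.continuous.exists_bound_torus
    have hφm := hφ.continuous.aestronglyMeasurable (μ := (volume : Measure (Torus n)))
    have t1 := tendsto_integral_mul_of_bounded hbp hbG tb (fun _ => hφm) (fun _ => hB)
      (Eventually.of_forall fun x => tendsto_const_nhds)
    have t2 := tendsto_integral_mul_of_bounded hdp hdu td' (fun _ => hφm) (fun _ => hB)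
      (Eventually.of_forall fun x => tendsto_const_nhds)
    have t3 : Tendsto (fun j => ∫ x, p j x * inner ℝ (b x) (grad φ x)) atTop
        (𝓝 (-(∫ x, inner ℝ (b x) (G x) * φ x) - ∫ x, d x * u x * φ x)) := by
      refine (t1.neg.sub t2).congr fun j => ?_
      have := integral_inner_grad_mul hb hA (hp j) hφ
      linarith
    -- With φ smooth, b·Dφ is in L², so L² convergence of the approximants suffices for the
    -- left-hand side.
    have hW : MemLp (fun x => inner ℝ (b x) (grad φ x)) 2 (volume : Measure (Torus n)) := by
      obtain ⟨B', -, hB'⟩ := hφ.continuous_grad.exists_bound_torus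
      refine MemLp.of_le_mul (c := B') hb
        (hb.1.inner (𝕜 := ℝ) hφ.continuous_grad.aestronglyMeasurable)
        (Eventually.of_forall fun x => (norm_inner_le_norm _ _).trans ?_)
      rw [mul_comm]
      exact mul_le_mul_of_nonneg_right (hB' x) (norm_nonneg _)
    have t4 : Tendsto (fun j => inner ℝ (H1.toL2L n (H1.ofSmooth (p j) (hp j))) (hW.toLp _)) atTop
        (𝓝 (inner ℝ (H1.toL2L n v) (hW.toLp _))) :=
      (((H1.toL2L n).continuous.tendsto v).comp hlim).inner tendsto_const_nhds
    have e : ∀ (w : L2 n) (f : Torus n → ℝ), w =ᵐ[volume] f →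
        inner ℝ w (hW.toLp _) = ∫ x, f x * inner ℝ (b x) (grad φ x) := by
      intro w f hwf
      rw [L2.inner_eq_integral_mul]
      refine integral_congr_ae ?_
      filter_upwards [hwf, hW.coeFn_toLp] with x h1 h2
      rw [h1, h2]
    rw [e (H1.toL2L n v) u EventuallyEq.rfl] at t4
    refine tendsto_nhds_unique (t4.congr fun j => ?_) t3
    exact e _ _ (H1.toL2_ofSmooth (hp j))
  -- the identity for truncations
  have htrunc : ∀ ε : ℝ, 0 < ε →
      (∫ x, α x * truncId ε (u x)) + ∫ x, inner ℝ (β x) (G x) * truncIdDeriv ε (u x) =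
        (∫ x, d x * truncIdPrim ε (u x)) - ∫ x, d x * u x * truncId ε (u x) := by
    intro ε hε
    have hTs : ∀ j, SmoothOnTorus (fun x => truncId ε (p j x)) :=
      fun j => (hp j).comp (contDiff_truncId ε)
    have hSs : ∀ j, SmoothOnTorus (fun x => truncIdPrim ε (p j x)) :=
      fun j => (hp j).comp (contDiff_truncIdPrim ε)
    have hTm : ∀ j, AEStronglyMeasurable (fun x => truncId ε (p j x))
      (volume : Measure (Torus n)) := fun j => (hTs j).continuous.aestronglyMeasurable
    have hTl : ∀ᵐ x, Tendsto (fun j => truncId ε (p j x)) atTop (𝓝 (truncId ε (u x))) := by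
      filter_upwards [hpu] with x hx
      exact ((contDiff_truncId ε).continuous.tendsto _).comp hx
    have hT'm : ∀ j, AEStronglyMeasurable (fun x => truncIdDeriv ε (p j x))
      (volume : Measure (Torus n)) := fun j =>
        ((continuous_truncIdDeriv ε).comp (hp j).continuous).aestronglyMeasurable
    have hT'l : ∀ᵐ x, Tendsto (fun j => truncIdDeriv ε (p j x)) atTop
        (𝓝 (truncIdDeriv ε (u x))) := by
      filter_upwards [hpu] with x hx
      exact ((continuous_truncIdDeriv ε).tendsto _).comp hx
    have hT'B : ∀ j x, |truncIdDeriv ε (p j x)| ≤ 1 := fun j x => by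
      rw [abs_of_nonneg (truncIdDeriv_nonneg _ _)]; exact truncIdDeriv_le_one _ _
    have z : ∀ f : Torus n → ℝ, Tendsto (fun _ : ℕ => ∫ x, |f x - f x|) atTop (𝓝 0) := by simp
    have s1 := tendsto_integral_mul_of_bounded (fun _ => hαi) hαi (z α) hTm
      (fun j x => abs_truncId_le hε _) hTl
    have s2 := tendsto_integral_mul_of_bounded hβp hβG tβ hT'm hT'B hT'l
    have s3 := tendsto_integral_mul_of_bounded (fun _ => hbG) hbG (z _) hTm
      (fun j x => abs_truncId_le hε _) hTl
    have s4 := tendsto_integral_mul_of_bounded (fun _ => hdu) hdu (z _) hTm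
      (fun j x => abs_truncId_le hε _) hTl
    have s5 := tendsto_integral_mul_of_bounded hbp hbG tb hTm
      (fun j x => abs_truncId_le hε _) hTl
    -- The truncation is applied to the trigonometric polynomials p_j, not to u, so that the test
    -- functions are smooth; the limit in j reaches T_ε(u), with T_ε and its derivative bounded.
    have hLT : ∀ j, (∫ x, α x * truncId ε (p j x)) +
        ∫ x, inner ℝ (β x) (grad (p j) x) * truncIdDeriv ε (p j x) =
        -(∫ x, inner ℝ (b x) (G x) * truncId ε (p j x)) - ∫ x, d x * u x * truncId ε (p j x) := by
      intro j
      rw [← hprod _ (hTs j), ← hL _ (hTs j), hαβ]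
      congr 1
      · refine integral_congr_ae ?_
        filter_upwards [H1.toL2_ofSmooth (hTs j)] with x hx
        rw [hx]
      · refine integral_congr_ae ?_
        filter_upwards [H1.weakGrad_ofSmooth (hTs j)] with x hx
        rw [hx, grad_comp (hasDerivAt_truncId ε) (hp j), inner_smul_right, mul_comm]
    have r1 := tendsto_nhds_unique ((s1.add s2).congr hLT) (s3.neg.sub s4)
    have hdS : Integrable (fun x => d x * truncIdPrim ε (u x)) := by
      refine hdu2.mono (hd.1.mul
        ((contDiff_truncIdPrim ε).continuous.comp_aestronglyMeasurable hum.1))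
        (Eventually.of_forall fun x => ?_)
      rw [norm_mul, norm_mul, Real.norm_eq_abs, Real.norm_eq_abs, Real.norm_eq_abs, abs_abs,
        abs_of_nonneg (truncIdPrim_nonneg _ _), Real.norm_of_nonneg (sq_nonneg (u x))]
      exact mul_le_mul_of_nonneg_left (truncIdPrim_le _ _) (abs_nonneg _)
    have hdSp : ∀ j, Integrable (fun x => d x * truncIdPrim ε (p j x)) := fun j => by
      obtain ⟨B, -, hB⟩ := (hSs j).continuous.exists_bound_torus
      exact hd.mul_bdd (hSs j).continuous.aestronglyMeasurable (Eventually.of_forall hB)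
    have hdabs : ∀ j, Integrable (fun x => |d x| * |p j x - u x|) := fun j => by
      refine ((hdp j).sub hdu).abs.congr (Eventually.of_forall fun x => ?_)
      simp only [Pi.sub_apply]
      rw [← mul_sub, abs_mul]
    have s6 : Tendsto (fun j => ∫ x, d x * truncIdPrim ε (p j x)) atTop
        (𝓝 (∫ x, d x * truncIdPrim ε (u x))) := by
      rw [tendsto_iff_norm_sub_tendsto_zero]
      refine squeeze_zero (fun _ => norm_nonneg _) (fun j => ?_)
        (by simpa using td.const_mul (1 / ε))
      rw [← integral_sub (hdSp j) hdS, ← integral_const_mul]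
      refine norm_integral_le_of_norm_le ((hdabs j).const_mul _) (Eventually.of_forall fun x => ?_)
      rw [← mul_sub, norm_mul, Real.norm_eq_abs, Real.norm_eq_abs]
      have := mul_le_mul_of_nonneg_left (abs_truncIdPrim_sub_le hε (p j x) (u x)) (abs_nonneg (d x))
      refine this.trans (le_of_eq ?_)
      ring
    -- Chain rule: the divergence identity is tested with S_ε(p_j), whose gradient is T_ε(p_j) Dp_j.
    have r2 : ∫ x, inner ℝ (b x) (G x) * truncId ε (u x) = -∫ x, d x * truncIdPrim ε (u x) := by
      refine tendsto_nhds_unique s5 (s6.neg.congr fun j => ?_)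
      rw [← hA _ (hSs j)]
      congr 1; funext x
      rw [grad_comp (hasDerivAt_truncIdPrim hε.ne') (hp j), inner_smul_right, mul_comm]
    rw [r1, r2, neg_neg]
  -- removal of the truncation
  have hek : Tendsto (fun k : ℕ => 1 / ((k : ℝ) + 1)) atTop (𝓝 0) :=
    tendsto_one_div_add_atTop_nhds_zero_nat
  have hTum : ∀ ε, AEStronglyMeasurable (fun x => truncId ε (u x)) (volume : Measure (Torus n)) :=
    fun ε => (contDiff_truncId ε).continuous.comp_aestronglyMeasurable hum.1
  have hαu : Integrable (fun x => |α x| * |u x|) :=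
    (MemLp.integrable_mul (p := 2) (q := 2) (Lp.memLp α).norm hum.norm)
  have l1 : Tendsto (fun k : ℕ => ∫ x, α x * truncId (1 / ((k : ℝ) + 1)) (u x)) atTop
      (𝓝 (∫ x, α x * u x)) := by
    refine tendsto_integral_of_dominated_convergence (fun x => |α x| * |u x|)
      (fun k => (Lp.aestronglyMeasurable α).mul (hTum _)) hαu
      (fun k => Eventually.of_forall fun x => ?_)
      (Eventually.of_forall fun x => ((tendsto_truncId _).comp hek).const_mul _)
    rw [norm_mul]
    exact mul_le_mul_of_nonneg_left (abs_truncId_le_abs _ _) (abs_nonneg _)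
  have l2 : Tendsto (fun k : ℕ => ∫ x, inner ℝ (β x) (G x) *
      truncIdDeriv (1 / ((k : ℝ) + 1)) (u x)) atTop (𝓝 (∫ x, inner ℝ (β x) (G x) * 1)) := by
    refine tendsto_integral_of_dominated_convergence (fun x => |inner ℝ (β x) (G x)|)
      (fun k => hβG.1.mul ((continuous_truncIdDeriv _).comp_aestronglyMeasurable hum.1)) hβG.abs
      (fun k => Eventually.of_forall fun x => ?_)
      (Eventually.of_forall fun x => ((tendsto_truncIdDeriv _).comp hek).const_mul _)
    rw [norm_mul, Real.norm_of_nonneg (truncIdDeriv_nonneg _ _)]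
    exact mul_le_of_le_one_right (norm_nonneg _) (truncIdDeriv_le_one _ _)
  have l3 : Tendsto (fun k : ℕ => ∫ x, d x * truncIdPrim (1 / ((k : ℝ) + 1)) (u x)) atTop
      (𝓝 (∫ x, d x * (u x ^ 2 / 2))) := by
    refine tendsto_integral_of_dominated_convergence (fun x => |d x| * u x ^ 2)
      (fun k => hd.1.mul ((contDiff_truncIdPrim _).continuous.comp_aestronglyMeasurable hum.1))
      hdu2 (fun k => Eventually.of_forall fun x => ?_)
      (Eventually.of_forall fun x => ((tendsto_truncIdPrim _).comp hek).const_mul _)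
    rw [norm_mul, Real.norm_of_nonneg (truncIdPrim_nonneg _ _)]
    exact mul_le_mul_of_nonneg_left (truncIdPrim_le _ _) (norm_nonneg _)
  have l4 : Tendsto (fun k : ℕ => ∫ x, d x * u x * truncId (1 / ((k : ℝ) + 1)) (u x)) atTop
      (𝓝 (∫ x, d x * u x * u x)) := by
    refine tendsto_integral_of_dominated_convergence (fun x => |d x| * u x ^ 2)
      (fun k => hdu.1.mul (hTum _)) hdu2 (fun k => Eventually.of_forall fun x => ?_)
      (Eventually.of_forall fun x => ((tendsto_truncId _).comp hek).const_mul _)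
    rw [norm_mul, norm_mul, ← sq_abs (u x), sq, mul_assoc]
    exact mul_le_mul_of_nonneg_left
      (mul_le_mul_of_nonneg_left (abs_truncId_le_abs _ _) (abs_nonneg _)) (norm_nonneg _)
  -- As ε → 0 the right-hand side becomes ½ ∫ d u² - ∫ d u², whence the factor -1/2.
  have hfin := tendsto_nhds_unique
    ((l1.add l2).congr fun k => htrunc _ Nat.one_div_pos_of_nat) (l3.sub l4)
  rw [hαβ v]
  simp only [mul_one] at hfin
  rw [hfin]
  have e3 : ∫ x, d x * (u x ^ 2 / 2) = 1 / 2 * ∫ x, d x * u x ^ 2 := by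
    rw [← integral_const_mul]; congr 1; funext x; ring
  have e4 : ∫ x, d x * u x * u x = ∫ x, d x * u x ^ 2 := by
    congr 1; funext x; ring
  rw [e3, e4]; ring

/-! ### Primitives and weak derivatives in time -/

theorem integrableOn_Icc_of_timeMeasure {E : Type*} [NormedAddCommGroup E] {T : ℝ} {f : ℝ → E}
    (hf : Integrable f (timeMeasure T)) : IntegrableOn f (Icc 0 T) :=
  (integrableOn_Icc_iff_integrableOn_Ioo (by simp) (by simp)).2 hf

theorem intervalIntegrable_of_timeMeasure {E : Type*} [NormedAddCommGroup E] {T : ℝ} {f : ℝ → E}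
    (hf : Integrable f (timeMeasure T)) {s t : ℝ} (hs : s ∈ Icc 0 T) (ht : t ∈ Icc 0 T) :
    IntervalIntegrable f volume s t :=
  ((integrableOn_Icc_of_timeMeasure hf).mono_set (uIcc_subset_Icc hs ht)).intervalIntegrable

theorem integral_timeMeasure {E : Type*} [NormedAddCommGroup E] [NormedSpace ℝ E] {T : ℝ}
    (hT : 0 ≤ T) (f : ℝ → E) : ∫ t, f t ∂(timeMeasure T) = ∫ t in (0 : ℝ)..T, f t := by
  rw [intervalIntegral.integral_of_le hT, integral_Ioc_eq_integral_Ioo]; rfl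

theorem intervalIntegral_congr_timeMeasure {E : Type*} [NormedAddCommGroup E] [NormedSpace ℝ E]
    {T : ℝ} {f g : ℝ → E} (h : f =ᵐ[timeMeasure T] g) {s t : ℝ} (hs : s ∈ Icc 0 T)
    (ht : t ∈ Icc 0 T) : ∫ x in s..t, f x = ∫ x in s..t, g x := by
  refine intervalIntegral.integral_congr_ae ?_
  have h' := (ae_restrict_iff' measurableSet_Ioo).1 h
  have hne : ∀ᵐ x : ℝ, x ≠ T := by simp [ae_iff, measure_singleton]
  filter_upwards [h', hne] with x hx hxT hxm
  have h1 := uIcc_subset_Icc hs ht (uIoc_subset_uIcc hxm)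
  have h2 : 0 < x := by
    rcases le_total s t with hst | hst
    · rw [uIoc_of_le hst] at hxm; exact hs.1.trans_lt hxm.1
    · rw [uIoc_of_ge hst] at hxm; exact ht.1.trans_lt hxm.1
  exact hx ⟨h2, lt_of_le_of_ne h1.2 hxT⟩

/-- The product rule for primitives of integrable functions. -/
theorem primitive_mul_sub {T : ℝ} {f h : ℝ → ℝ} (hf : Integrable f (timeMeasure T))
    (hh : Integrable h (timeMeasure T)) (k l : ℝ) {s t : ℝ} (hs : s ∈ Icc 0 T)
    (ht : t ∈ Icc 0 T) :
    (k + ∫ x in (0 : ℝ)..t, f x) * (l + ∫ x in (0 : ℝ)..t, h x) -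
      (k + ∫ x in (0 : ℝ)..s, f x) * (l + ∫ x in (0 : ℝ)..s, h x) =
    ∫ y in s..t, (f y * (l + ∫ x in (0 : ℝ)..y, h x) + (k + ∫ x in (0 : ℝ)..y, f x) * h y) := by
  have h0 : (0 : ℝ) ∈ Icc 0 T := ⟨le_rfl, hs.1.trans hs.2⟩
  have hT : T ∈ Icc 0 T := ⟨hs.1.trans hs.2, le_rfl⟩
  have hsub : uIcc s t ⊆ uIcc 0 T := by
    rw [uIcc_of_le hT.1]; exact uIcc_subset_Icc hs ht
  have ac : ∀ {f : ℝ → ℝ}, Integrable f (timeMeasure T) → ∀ k,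
      AbsolutelyContinuousOnInterval (fun y => k + ∫ x in (0 : ℝ)..y, f x) s t := by
    intro f hf k
    have h1 := ((intervalIntegrable_of_timeMeasure hf h0 hT).absolutelyContinuousOnInterval_intervalIntegral
      (left_mem_uIcc)).mono hsub
    have h2 : AbsolutelyContinuousOnInterval (fun _ : ℝ => k) s t :=
      (LipschitzWith.const k).lipschitzOnWith.absolutelyContinuousOnInterval
    exact h2.fun_add h1
  have hd : ∀ {f : ℝ → ℝ}, Integrable f (timeMeasure T) → ∀ k, ∀ᵐ y, y ∈ uIcc s t →
      HasDerivAt (fun y => k + ∫ x in (0 : ℝ)..y, f x) (f y) y := by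
    intro f hf k
    filter_upwards [(intervalIntegrable_of_timeMeasure hf h0 hT).ae_hasDerivAt_integral] with y hy hys
    exact (hy (hsub hys) 0 left_mem_uIcc).const_add k
  rw [← (ac hf k).integral_deriv_mul_eq_sub (ac hh l)]
  refine intervalIntegral.integral_congr_ae ?_
  filter_upwards [hd hf k, hd hh l] with y h1 h2 hy
  have hy := uIoc_subset_uIcc hy
  rw [(h1 hy).deriv, (h2 hy).deriv]

theorem continuousOn_primitive_timeMeasure {T : ℝ} (hT : 0 ≤ T) {f : ℝ → ℝ}
    (hf : Integrable f (timeMeasure T)) (k : ℝ) :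
    ContinuousOn (fun y => k + ∫ x in (0 : ℝ)..y, f x) (Icc 0 T) := by
  have h := intervalIntegral.continuousOn_primitive_interval' (a := 0) (intervalIntegrable_of_timeMeasure hf
    ⟨le_rfl, hT⟩ ⟨hT, le_rfl⟩) left_mem_uIcc
  rw [uIcc_of_le hT] at h
  exact continuousOn_const.add h

theorem eq_add_integral_deriv {η : ℝ → ℝ} (hη : ContDiff ℝ ∞ η) (y : ℝ) :
    η y = η 0 + ∫ x in (0 : ℝ)..y, deriv η x := by
  rw [intervalIntegral.integral_deriv_eq_sub
    (fun x _ => (hη.differentiable (by simp)) x)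
    ((hη.continuous_deriv (by simp)).intervalIntegrable _ _)]
  ring

theorem integrable_timeMeasure_of_continuous (T : ℝ) {f : ℝ → ℝ} (hf : Continuous f) :
    Integrable f (timeMeasure T) :=
  (hf.continuousOn.integrableOn_compact (isCompact_Icc (a := 0) (b := T))).mono_set
    Ioo_subset_Icc_self

/-- Integration by parts of a primitive against a smooth function. -/
theorem integral_deriv_mul_primitive {T : ℝ} (hT : 0 ≤ T) {f : ℝ → ℝ}
    (hf : Integrable f (timeMeasure T)) (k : ℝ) {η : ℝ → ℝ} (hη : ContDiff ℝ ∞ η)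
    (hηT : η T = 0) :
    ∫ t, deriv η t * (k + ∫ x in (0 : ℝ)..t, f x) ∂(timeMeasure T) =
      -(η 0 * k) - ∫ t, η t * f t ∂(timeMeasure T) := by
  have h0 : (0 : ℝ) ∈ Icc 0 T := ⟨le_rfl, hT⟩
  have hT' : T ∈ Icc 0 T := ⟨hT, le_rfl⟩
  have hd := integrable_timeMeasure_of_continuous T (hη.continuous_deriv (by simp))
  have h := primitive_mul_sub hd hf (η 0) k h0 hT'
  simp only [← eq_add_integral_deriv hη] at h
  rw [hηT, intervalIntegral.integral_same, add_zero, intervalIntegral.integral_add] at h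
  · rw [integral_timeMeasure hT, integral_timeMeasure hT]
    linarith
  · refine (intervalIntegrable_of_timeMeasure hd h0 hT').mul_continuousOn ?_
    rw [uIcc_of_le hT]
    exact continuousOn_primitive_timeMeasure hT hf k
  · exact (intervalIntegrable_of_timeMeasure hf h0 hT').continuousOn_mul hη.continuous.continuousOn

theorem exists_Icc_of_isCompact_subset_Ioo {T : ℝ} (hT : 0 < T) {K : Set ℝ} (hK : IsCompact K)
    (hKT : K ⊆ Ioo 0 T) : ∃ a b, 0 < a ∧ a ≤ b ∧ b < T ∧ K ⊆ Icc a b := by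
  rcases K.eq_empty_or_nonempty with rfl | hne
  · exact ⟨T / 2, T / 2, by linarith, le_rfl, by linarith, empty_subset _⟩
  · obtain ⟨a, ha, ha'⟩ := hK.exists_isLeast hne
    obtain ⟨b, hb, hb'⟩ := hK.exists_isGreatest hne
    exact ⟨a, b, (hKT ha).1, ha' hb, (hKT hb).2, fun x hx => ⟨ha' hx, hb' hx⟩⟩

/-- A test function on `(0,T)` of zero mean is the derivative of a test function on `(0,T)`. -/
theorem exists_test_primitive {T : ℝ} (hT : 0 < T) {φ : ℝ → ℝ} (hφ : ContDiff ℝ ∞ φ)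
    (hc : HasCompactSupport φ) (hs : tsupport φ ⊆ Ioo 0 T)
    (h0 : ∫ t, φ t ∂(timeMeasure T) = 0) :
    ∃ η : ℝ → ℝ, ContDiff ℝ ∞ η ∧ HasCompactSupport η ∧ tsupport η ⊆ Ioo 0 T ∧ deriv η = φ := by
  obtain ⟨a, b, ha, hab, hb, hK⟩ := exists_Icc_of_isCompact_subset_Ioo hT hc hs
  have hz : ∀ t, t ∉ Icc a b → φ t = 0 := fun t ht =>
    image_eq_zero_of_notMem_tsupport fun h => ht (hK h)
  set η : ℝ → ℝ := fun t => ∫ x in (0 : ℝ)..t, φ x with hη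
  have hd : ∀ t, HasDerivAt η (φ t) t := fun t =>
    intervalIntegral.integral_hasDerivAt_right (hφ.continuous.intervalIntegrable _ _)
      (hφ.continuous.stronglyMeasurableAtFilter _ _) hφ.continuous.continuousAt
  have hderiv : deriv η = φ := funext fun t => (hd t).deriv
  -- To the left of a the integrand vanishes. To the right of b the primitive has collected the
  -- whole integral, which is zero by assumption.
  have hηz : ∀ t, t ∉ Icc a b → η t = 0 := by
    intro t ht
    rw [integral_timeMeasure hT.le] at h0
    by_cases hta : t < a
    · refine intervalIntegral.integral_zero_ae (Eventually.of_forall fun x hx => hz x ?_)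
      rintro ⟨h1, -⟩
      have h2 := (uIoc_subset_uIcc hx).2
      rcases le_total 0 t with h | h
      · rw [sup_of_le_right h] at h2; linarith
      · rw [sup_of_le_left h] at h2; linarith
    · have htb : b < t := by
        by_contra h
        exact ht ⟨not_lt.1 hta, not_lt.1 h⟩
      have hadd := intervalIntegral.integral_add_adjacent_intervals
        (hφ.continuous.intervalIntegrable (μ := volume) 0 T)
        (hφ.continuous.intervalIntegrable T t)
      rw [h0, zero_add] at hadd
      rw [hη]
      simp only
      rw [← hadd]
      refine intervalIntegral.integral_zero_ae (Eventually.of_forall fun x hx => hz x ?_)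
      rintro ⟨-, h1⟩
      have h2 := (uIoc_subset_uIcc hx).1
      have : b < min T t := lt_min hb htb
      exact absurd (h2.trans h1) (not_le.2 this)
  refine ⟨η, ?_, ?_, ?_, hderiv⟩
  · rw [contDiff_infty_iff_deriv]
    exact ⟨fun t => (hd t).differentiableAt, hderiv ▸ hφ⟩
  · exact HasCompactSupport.intro isCompact_Icc hηz
  · refine (closure_minimal (fun t ht => ?_) isClosed_Icc).trans
      (Icc_subset_Ioo ha hb : Icc a b ⊆ Ioo 0 T)
    by_contra h
    exact ht (hηz t h)

theorem exists_test_bump {T : ℝ} (hT : 0 < T) : ∃ χ : ℝ → ℝ, ContDiff ℝ ∞ χ ∧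
    HasCompactSupport χ ∧ tsupport χ ⊆ Ioo 0 T ∧ ∫ t, χ t ∂(timeMeasure T) = 1 := by
  let f : ContDiffBump (T / 2) := ⟨T / 8, T / 4, by linarith, by linarith⟩
  have hs : tsupport (f.normed volume) ⊆ Ioo 0 T := by
    rw [f.tsupport_normed_eq]
    intro x hx
    rw [Real.closedBall_eq_Icc] at hx
    have h1 := hx.1
    have h2 := hx.2
    change T / 2 - T / 4 ≤ x at h1
    change x ≤ T / 2 + T / 4 at h2
    exact ⟨by linarith, by linarith⟩
  refine ⟨f.normed volume, f.contDiff_normed, f.hasCompactSupport_normed, hs, ?_⟩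
  rw [← f.integral_normed (μ := volume)]
  exact setIntegral_eq_integral_of_forall_compl_eq_zero fun x hx =>
    image_eq_zero_of_notMem_tsupport fun h => hx (hs h)

/-- **Du Bois-Reymond**: a function with integrable weak derivative is a.e. a primitive. -/
theorem exists_ae_eq_primitive {T : ℝ} (hT : 0 < T) {c g : ℝ → ℝ}
    (hc : Integrable c (timeMeasure T)) (hg : Integrable g (timeMeasure T))
    (h : ∀ η : ℝ → ℝ, ContDiff ℝ ∞ η → HasCompactSupport η → tsupport η ⊆ Ioo 0 T →
      ∫ t, deriv η t * c t ∂(timeMeasure T) = -∫ t, η t * g t ∂(timeMeasure T)) :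
    ∃ k : ℝ, ∀ᵐ t ∂(timeMeasure T), c t = k + ∫ x in (0 : ℝ)..t, g x := by
  set w : ℝ → ℝ := fun t => c t - (0 + ∫ x in (0 : ℝ)..t, g x) with hw
  have hGi : Integrable (fun t => 0 + ∫ x in (0 : ℝ)..t, g x) (timeMeasure T) :=
    ((continuousOn_primitive_timeMeasure hT.le hg 0).integrableOn_compact isCompact_Icc).mono_set
      Ioo_subset_Icc_self
  have hwi : Integrable w (timeMeasure T) := hc.sub hGi
  have hbd : ∀ φ : ℝ → ℝ, Continuous φ → HasCompactSupport φ → ∀ f : ℝ → ℝ,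
      Integrable f (timeMeasure T) → Integrable (fun t => φ t * f t) (timeMeasure T) := by
    intro φ hφ hφc f hf
    obtain ⟨B, hB⟩ := hφ.bounded_above_of_compact_support hφc
    exact hf.bdd_mul hφ.aestronglyMeasurable (Eventually.of_forall hB)
  have hz : ∀ φ : ℝ → ℝ, ContDiff ℝ ∞ φ → HasCompactSupport φ → tsupport φ ⊆ Ioo 0 T →
      ∫ t, φ t ∂(timeMeasure T) = 0 → ∫ t, φ t * w t ∂(timeMeasure T) = 0 := by
    intro φ h1 h2 h3 h4
    obtain ⟨η, e1, e2, e3, e4⟩ := exists_test_primitive hT h1 h2 h3 h4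
    have hη0 : η 0 = 0 := image_eq_zero_of_notMem_tsupport fun h => lt_irrefl _ (e3 h).1
    have hηT : η T = 0 := image_eq_zero_of_notMem_tsupport fun h => lt_irrefl _ (e3 h).2
    have r1 := h η e1 e2 e3
    have r2 := integral_deriv_mul_primitive hT.le hg 0 e1 hηT
    rw [e4] at r1 r2
    simp only [hw, mul_sub]
    rw [integral_sub (hbd φ h1.continuous h2 c hc) (hbd φ h1.continuous h2 _ hGi), r1, r2, hη0]
    ring
  obtain ⟨χ, x1, x2, x3, x4⟩ := exists_test_bump hT
  refine ⟨∫ t, χ t * w t ∂(timeMeasure T), ?_⟩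
  set k := ∫ t, χ t * w t ∂(timeMeasure T) with hk
  -- Subtracting (∫ φ) χ from φ gives a test function of zero mean, to which the previous step
  -- applies; k is the resulting constant value of w.
  have key : ∀ φ : ℝ → ℝ, ContDiff ℝ ∞ φ → HasCompactSupport φ → tsupport φ ⊆ Ioo 0 T →
      ∫ t, φ t • (w t - k) = 0 := by
    intro φ h1 h2 h3
    have e : ∫ t, φ t • (w t - k) = ∫ t, φ t * (w t - k) ∂(timeMeasure T) :=
      (setIntegral_eq_integral_of_forall_compl_eq_zero fun x hx => by
        rw [image_eq_zero_of_notMem_tsupport fun h => hx (h3 h), zero_smul]).symm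
    have hφi : Integrable φ (timeMeasure T) := integrable_timeMeasure_of_continuous T h1.continuous
    set m := ∫ t, φ t ∂(timeMeasure T) with hm
    have hχi : Integrable χ (timeMeasure T) := integrable_timeMeasure_of_continuous T x1.continuous
    have hts : tsupport (fun t => φ t - m * χ t) ⊆ tsupport φ ∪ tsupport χ := by
      refine closure_minimal (fun t ht => ?_) ((isClosed_tsupport _).union (isClosed_tsupport _))
      by_contra hcon
      rw [mem_union, not_or] at hcon
      refine ht ?_
      simp [image_eq_zero_of_notMem_tsupport hcon.1, image_eq_zero_of_notMem_tsupport hcon.2]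
    have hcs : HasCompactSupport (fun t => φ t - m * χ t) :=
      IsCompact.of_isClosed_subset (h2.isCompact.union x2.isCompact) (isClosed_tsupport _) hts
    have := hz (fun t => φ t - m * χ t) (h1.sub (contDiff_const.mul x1)) hcs
      (hts.trans (union_subset h3 x3)) (by
        rw [integral_sub hφi (hχi.const_mul m), integral_const_mul, x4, ← hm]; ring)
    simp only [sub_mul, mul_assoc] at this
    rw [integral_sub (hbd φ h1.continuous h2 w hwi)
      ((hbd χ x1.continuous x2 w hwi).const_mul m), integral_const_mul, ← hk] at this
    rw [e]
    simp only [mul_sub]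
    rw [integral_sub (hbd φ h1.continuous h2 w hwi) (hφi.mul_const k), integral_mul_const, ← hm]
    exact this
  have hloc : LocallyIntegrableOn (fun t => w t - k) (Ioo 0 T) := by
    have : IntegrableOn (fun t => w t - k) (Ioo 0 T) :=
      hwi.sub (integrable_timeMeasure_of_continuous T continuous_const)
    exact this.locallyIntegrableOn
  have hae := isOpen_Ioo.ae_eq_zero_of_integral_contDiff_smul_eq_zero hloc key
  refine (ae_restrict_iff' measurableSet_Ioo).2 ?_
  filter_upwards [hae] with t ht hmem
  have := ht hmem
  simp only [hw] at this
  linarith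

/-! ### The continuous representative and the energy identity in time -/

instance isFiniteMeasure_timeMeasure (T : ℝ) : IsFiniteMeasure (timeMeasure T) :=
  inferInstanceAs (IsFiniteMeasure (volume.restrict (Ioo 0 T)))

theorem monotone_boxModes : Monotone (boxModes n) := by
  intro a b hab i hi
  simp only [boxModes, Finset.mem_product, Fintype.mem_piFinset, Finset.mem_Icc,
    Finset.mem_univ, and_true] at hi ⊢
  intro j
  have := hi j
  omega

section Duality

variable {X : Type*} [NormedAddCommGroup X] [NormedSpace ℝ X] {μ : Measure ℝ} {ρ : ℝ → X}
  {g : ℝ → StrongDual ℝ X}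

theorem integrable_norm_mul_norm (hρ : MemLp ρ 2 μ) (hg : MemLp g 2 μ) :
    Integrable (fun t => ‖g t‖ * ‖ρ t‖) μ :=
  MemLp.integrable_mul (p := 2) (q := 2) hg.norm hρ.norm

theorem integrable_norm_mul_of_le (hρ : MemLp ρ 2 μ) (hg : MemLp g 2 μ) {f : ℝ → ℝ}
    (hf : AEStronglyMeasurable f μ) (h0 : ∀ t, 0 ≤ f t) (hle : ∀ t, f t ≤ ‖ρ t‖) :
    Integrable (fun t => ‖g t‖ * f t) μ := by
  refine (integrable_norm_mul_norm hρ hg).mono (hg.1.norm.mul hf) (Eventually.of_forall fun t => ?_)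
  rw [norm_mul, norm_mul, Real.norm_of_nonneg (h0 t), Real.norm_of_nonneg (norm_nonneg (ρ t))]
  exact mul_le_mul_of_nonneg_left (hle t) (norm_nonneg _)

theorem integrable_dual_apply (hρ : MemLp ρ 2 μ) (hg : MemLp g 2 μ) {w : ℝ → X}
    (hw : AEStronglyMeasurable w μ) (hle : ∀ t, ‖w t‖ ≤ ‖ρ t‖) :
    Integrable (fun t => g t (w t)) μ := by
  refine (integrable_norm_mul_norm hρ hg).mono
    (isBoundedBilinearMap_apply.continuous.comp_aestronglyMeasurable (hg.1.prodMk hw))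
    (Eventually.of_forall fun t => ?_)
  rw [norm_mul, norm_norm, norm_norm]
  exact ((g t).le_opNorm _).trans (mul_le_mul_of_nonneg_left (hle t) (norm_nonneg _))

theorem integrable_dual_apply_const [IsFiniteMeasure μ] (hg : MemLp g 2 μ) (v : X) :
    Integrable (fun t => g t v) μ :=
  ((ContinuousLinearMap.apply ℝ ℝ v).integrable_comp (hg.integrable (by norm_num)) :)

theorem dual_apply_le (φ : StrongDual ℝ X) {w : X} {c : ℝ} (h : ‖w‖ ≤ c) : ‖φ w‖ ≤ ‖φ‖ * c :=
  (φ.le_opNorm _).trans (mul_le_mul_of_nonneg_left h (norm_nonneg _))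

end Duality

theorem integrable_inner_toL2 {μ : Measure ℝ} [IsFiniteMeasure μ] {ρ : ℝ → H1 n}
    (hρ : MemLp ρ 2 μ) (z : L2 n) :
    Integrable (fun t => inner ℝ (H1.toL2 (ρ t)) z) μ :=
  Integrable.inner_const (𝕜 := ℝ)
    ((H1.toL2L n).integrable_comp (hρ.integrable (by norm_num))) z

theorem continuous_modeCoeff_toL2 (i : ModeIndex n) :
    Continuous fun w : H1 n => modeCoeff (H1.toL2 w) i := by
  simp only [← inner_toL2_modeH1]
  exact ((H1.toL2L n).continuous.inner continuous_const)

theorem continuous_truncH1 (A : Finset (ModeIndex n)) : Continuous (truncH1 (n := n) A) :=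
  continuous_finsetSum _ fun i _ => (continuous_modeCoeff_toL2 i).smul continuous_const

/-- The part of the squared `H¹` norm carried by the modes outside `A`. -/
def tailH1 (A : Finset (ModeIndex n)) (w : H1 n) : ℝ :=
  ‖w‖ ^ 2 - ∑ i ∈ A, (1 + ModeIndex.eigenvalue i) * modeCoeff (H1.toL2 w) i ^ 2

theorem continuous_tailH1 (A : Finset (ModeIndex n)) : Continuous (tailH1 (n := n) A) :=
  (continuous_norm.pow 2).sub (continuous_finsetSum _ fun i _ =>
    continuous_const.mul ((continuous_modeCoeff_toL2 i).pow 2))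

theorem tailH1_nonneg (A : Finset (ModeIndex n)) (w : H1 n) : 0 ≤ tailH1 A w :=
  sub_nonneg.2 (sum_le_hasSum A
    (fun i _ => mul_nonneg (ModeIndex.one_add_eigenvalue_pos i).le (sq_nonneg _))
    (hasSum_norm_H1_sq w))

theorem tailH1_le (A : Finset (ModeIndex n)) (w : H1 n) : tailH1 A w ≤ ‖w‖ ^ 2 :=
  sub_le_self _ (Finset.sum_nonneg fun i _ =>
    mul_nonneg (ModeIndex.one_add_eigenvalue_pos i).le (sq_nonneg _))

theorem tendsto_tailH1 (w : H1 n) :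
    Tendsto (fun m => tailH1 (boxModes n m) w) atTop (𝓝 0) := by
  have h := ((hasSum_norm_H1_sq w).comp tendsto_boxModes).const_sub (‖w‖ ^ 2)
  rwa [sub_self] at h

theorem sum_weighted_le_tailH1 {A F : Finset (ModeIndex n)} (h : Disjoint A F) (w : H1 n) :
    ∑ i ∈ A, (1 + ModeIndex.eigenvalue i) * modeCoeff (H1.toL2 w) i ^ 2 ≤ tailH1 F w := by
  classical
  have := sum_le_hasSum (A ∪ F)
    (fun i _ => mul_nonneg (ModeIndex.one_add_eigenvalue_pos i).le (sq_nonneg _))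
    (hasSum_norm_H1_sq w)
  rw [Finset.sum_union h] at this
  unfold tailH1
  linarith

theorem sum_sq_le_tailH1 {A F : Finset (ModeIndex n)} (h : Disjoint A F) (w : H1 n) :
    ∑ i ∈ A, modeCoeff (H1.toL2 w) i ^ 2 ≤ tailH1 F w := by
  refine (Finset.sum_le_sum fun i _ => ?_).trans (sum_weighted_le_tailH1 h w)
  nlinarith [ModeIndex.eigenvalue_nonneg i, sq_nonneg (modeCoeff (H1.toL2 w) i)]

theorem norm_truncH1_le_sqrt_tailH1 {A F : Finset (ModeIndex n)} (h : Disjoint A F) (w : H1 n) :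
    ‖truncH1 A w‖ ≤ √(tailH1 F w) :=
  Real.le_sqrt_of_sq_le ((norm_truncH1_sq_le_sum A w).trans (sum_weighted_le_tailH1 h w))

/-- The error bound for the truncation to the `m`-th box of modes. -/
def tailBound (T : ℝ) (ρ : ℝ → H1 n) (g : ℝ → HNeg1 n) (m : ℕ) : ℝ :=
  T⁻¹ * (∫ t, tailH1 (boxModes n m) (ρ t) ∂(timeMeasure T)) +
    2 * ∫ t, ‖g t‖ * √(tailH1 (boxModes n m) (ρ t)) ∂(timeMeasure T)

section TailBound

variable {T : ℝ} {ρ : ℝ → H1 n} {g : ℝ → HNeg1 n}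

theorem sqrt_tailH1_le (A : Finset (ModeIndex n)) (w : H1 n) : √(tailH1 A w) ≤ ‖w‖ :=
  Real.sqrt_le_iff.2 ⟨norm_nonneg _, tailH1_le A w⟩

theorem integrable_tailH1 {μ : Measure ℝ} (hρ : MemLp ρ 2 μ) (A : Finset (ModeIndex n)) :
    Integrable (fun t => tailH1 A (ρ t)) μ := by
  refine hρ.norm.integrable_sq.mono ((continuous_tailH1 A).comp_aestronglyMeasurable hρ.1)
    (Eventually.of_forall fun t => ?_)
  rw [Real.norm_of_nonneg (tailH1_nonneg _ _), Real.norm_of_nonneg (sq_nonneg _)]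
  exact tailH1_le _ _

theorem integrable_norm_mul_sqrt_tailH1 {μ : Measure ℝ} (hρ : MemLp ρ 2 μ) (hg : MemLp g 2 μ)
    (A : Finset (ModeIndex n)) : Integrable (fun t => ‖g t‖ * √(tailH1 A (ρ t))) μ :=
  integrable_norm_mul_of_le hρ hg
    ((Real.continuous_sqrt.comp (continuous_tailH1 A)).comp_aestronglyMeasurable hρ.1)
    (fun _ => Real.sqrt_nonneg _) (fun _ => sqrt_tailH1_le _ _)

/-- Pointwise in time the Parseval remainder tends to zero; ‖ρ‖² and ‖g‖‖ρ‖ dominate the two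
integrands. -/
theorem tendsto_tailBound (hρ : MemLp ρ 2 (timeMeasure T)) (hg : MemLp g 2 (timeMeasure T)) :
    Tendsto (tailBound T ρ g) atTop (𝓝 0) := by
  have h1 : Tendsto (fun m => ∫ t, tailH1 (boxModes n m) (ρ t) ∂(timeMeasure T)) atTop
      (𝓝 (∫ _, (0 : ℝ) ∂(timeMeasure T))) := by
    refine tendsto_integral_of_dominated_convergence (fun t => ‖ρ t‖ ^ 2)
      (fun m => (integrable_tailH1 hρ _).1) hρ.norm.integrable_sq
      (fun m => Eventually.of_forall fun t => ?_) (Eventually.of_forall fun t => tendsto_tailH1 _)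
    rw [Real.norm_of_nonneg (tailH1_nonneg _ _)]
    exact tailH1_le _ _
  have h2 : Tendsto (fun m => ∫ t, ‖g t‖ * √(tailH1 (boxModes n m) (ρ t)) ∂(timeMeasure T)) atTop
      (𝓝 (∫ _, (0 : ℝ) ∂(timeMeasure T))) := by
    refine tendsto_integral_of_dominated_convergence (fun t => ‖g t‖ * ‖ρ t‖)
      (fun m => (integrable_norm_mul_sqrt_tailH1 hρ hg _).1)
      (integrable_norm_mul_norm hρ hg)
      (fun m => Eventually.of_forall fun t => ?_) (Eventually.of_forall fun t => ?_)
    · rw [Real.norm_of_nonneg (mul_nonneg (ContinuousLinearMap.opNorm_nonneg _) (Real.sqrt_nonneg _))]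
      exact mul_le_mul_of_nonneg_left (sqrt_tailH1_le _ _) (ContinuousLinearMap.opNorm_nonneg _)
    · have := ((Real.continuous_sqrt.tendsto 0).comp (tendsto_tailH1 (ρ t))).const_mul ‖g t‖
      simpa using this
  unfold tailBound
  simpa using (h1.const_mul T⁻¹).add (h2.const_mul 2)

end TailBound

theorem eqOn_Icc_of_ae_eq {T : ℝ} (hT : 0 < T) {f h : ℝ → ℝ} (hf : ContinuousOn f (Icc 0 T))
    (hh : ContinuousOn h (Icc 0 T)) (hae : f =ᵐ[timeMeasure T] h) : EqOn f h (Icc 0 T) := by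
  have h1 : EqOn f h (Ioo 0 T) := Measure.eqOn_open_of_ae_eq hae isOpen_Ioo
    (hf.mono Ioo_subset_Icc_self) (hh.mono Ioo_subset_Icc_self)
  exact h1.of_subset_closure hf hh Ioo_subset_Icc_self (by rw [closure_Ioo hT.ne])

/-- The pairing of `ρ` with a fixed function is a.e. a primitive of the pairing with `∂ₜρ`. -/
theorem IsWeakTimeDeriv.exists_ae_inner_eq {T : ℝ} (hT : 0 < T) {ρ : ℝ → H1 n} {g : ℝ → HNeg1 n}
    (hρ : MemLp ρ 2 (timeMeasure T)) (hg : MemLp g 2 (timeMeasure T))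
    (h : IsWeakTimeDeriv T ρ g) (v : H1 n) :
    ∃ k : ℝ, ∀ᵐ t ∂(timeMeasure T),
      inner ℝ (H1.toL2 (ρ t)) (H1.toL2 v) = k + ∫ x in (0 : ℝ)..t, g x v :=
  exists_ae_eq_primitive hT (integrable_inner_toL2 hρ _) (integrable_dual_apply_const hg v)
    fun η h1 h2 h3 => h η h1 h2 h3 v

/-- **Lions–Magenes**: an element of the parabolic class has a continuous representative in `L²`,
for which the energy identity holds. -/
theorem IsWeakTimeDeriv.exists_continuous_representative {T : ℝ} (hT : 0 < T) {ρ : ℝ → H1 n}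
    {g : ℝ → HNeg1 n} (hρ : MemLp ρ 2 (timeMeasure T)) (hg : MemLp g 2 (timeMeasure T))
    (h : IsWeakTimeDeriv T ρ g) :
    ∃ u : ℝ → L2 n, ContinuousOn u (Icc 0 T) ∧
      (∀ᵐ t ∂(timeMeasure T), u t = H1.toL2 (ρ t)) ∧
      (∀ s ∈ Icc 0 T, ∀ t ∈ Icc 0 T,
        ‖u t‖ ^ 2 - ‖u s‖ ^ 2 = 2 * ∫ x in s..t, g x (ρ x)) ∧
      (∀ v : H1 n, ∀ t ∈ Icc 0 T, inner ℝ (u t) (H1.toL2 v) =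
        inner ℝ (u 0) (H1.toL2 v) + ∫ x in (0 : ℝ)..t, g x v) := by
  classical
  have h0T : (0 : ℝ) ∈ Icc 0 T := ⟨le_rfl, hT.le⟩
  have hTT : T ∈ Icc 0 T := ⟨hT.le, le_rfl⟩
  choose k hk using fun i : ModeIndex n => h.exists_ae_inner_eq hT hρ hg (modeH1 i)
  set U : ModeIndex n → ℝ → ℝ := fun i t => k i + ∫ x in (0 : ℝ)..t, g x (modeH1 i) with hUdef
  have hgi : ∀ i : ModeIndex n, Integrable (fun t => g t (modeH1 i)) (timeMeasure T) :=
    fun i => integrable_dual_apply_const hg _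
  have hUc : ∀ i, ContinuousOn (U i) (Icc 0 T) := fun i =>
    continuousOn_primitive_timeMeasure hT.le (hgi i) _
  have hU : ∀ᵐ t ∂(timeMeasure T), ∀ i, modeCoeff (H1.toL2 (ρ t)) i = U i t := by
    rw [ae_all_iff]
    intro i
    simpa only [inner_toL2_modeH1] using hk i
  -- Energy identity for finitely many modes: each coefficient is a scalar primitive, so the product
  -- rule applies to its square, and the terms reassemble into the pairing of g with the truncation.
  have hE : ∀ A : Finset (ModeIndex n), ∀ s ∈ Icc 0 T, ∀ t ∈ Icc 0 T,
      ∑ i ∈ A, U i t ^ 2 - ∑ i ∈ A, U i s ^ 2 = 2 * ∫ x in s..t, g x (truncH1 A (ρ x)) := by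
    intro A s hs t ht
    rw [← Finset.sum_sub_distrib, ← intervalIntegral.integral_const_mul]
    have h1 : ∀ i, U i t ^ 2 - U i s ^ 2 =
        ∫ y in s..t, (g y (modeH1 i) * U i y + U i y * g y (modeH1 i)) := by
      intro i
      rw [← primitive_mul_sub (hgi i) (hgi i) (k i) (k i) hs ht]
      simp only [hUdef]; ring
    rw [Finset.sum_congr rfl fun i _ => h1 i, ← intervalIntegral.integral_finsetSum]
    · refine intervalIntegral_congr_timeMeasure ?_ hs ht
      filter_upwards [hU] with x hx
      simp only [truncH1, map_sum, map_smul, smul_eq_mul, hx, Finset.mul_sum]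
      exact Finset.sum_congr rfl fun i _ => by ring
    · intro i _
      have hcont : ContinuousOn (U i) (uIcc s t) := (hUc i).mono (uIcc_subset_Icc hs ht)
      have hint := intervalIntegrable_of_timeMeasure (hgi i) hs ht
      exact (hint.mul_continuousOn hcont).add (hint.continuousOn_mul hcont)
  -- High modes are small uniformly in t. No particular starting time s has a controlled tail, so
  -- the finite energy identity is averaged over s in (0,T).
  have hδ : ∀ m, ∀ A : Finset (ModeIndex n), Disjoint A (boxModes n m) → ∀ t ∈ Icc 0 T,
      ∑ i ∈ A, U i t ^ 2 ≤ tailBound T ρ g m := by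
    intro m A hA t ht
    set J := ∫ t, ‖g t‖ * √(tailH1 (boxModes n m) (ρ t)) ∂(timeMeasure T) with hJ
    have hJi := integrable_norm_mul_sqrt_tailH1 hρ hg (boxModes n m)
    have h1 : ∀ᵐ s ∂(timeMeasure T),
        ∑ i ∈ A, U i t ^ 2 ≤ tailH1 (boxModes n m) (ρ s) + 2 * J := by
      filter_upwards [hU, ae_restrict_mem measurableSet_Ioo] with s hs hsm
      have hsI : s ∈ Icc 0 T := Ioo_subset_Icc_self hsm
      have e1 := hE A s hsI t ht
      have e2 := sum_sq_le_tailH1 hA (ρ s)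
      simp only [hs] at e2
      have e3 : ∫ x in s..t, g x (truncH1 A (ρ x)) ≤ J := by
        refine (le_abs_self _).trans ?_
        rw [← Real.norm_eq_abs]
        refine (intervalIntegral.norm_integral_le_integral_norm_uIoc).trans ?_
        have hsub : uIoc s t ⊆ Icc 0 T := uIoc_subset_uIcc.trans (uIcc_subset_Icc hsI ht)
        have hti : Integrable (fun x => g x (truncH1 A (ρ x))) (timeMeasure T) :=
          integrable_dual_apply hρ hg ((continuous_truncH1 A).comp_aestronglyMeasurable hρ.1)
            fun _ => norm_truncH1_le _ _
        refine (setIntegral_mono_set (integrableOn_Icc_of_timeMeasure hti).norm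
          (Eventually.of_forall fun _ => norm_nonneg _) hsub.eventuallyLE).trans ?_
        rw [integral_Icc_eq_integral_Ioo]
        refine integral_mono hti.norm hJi fun x => ?_
        exact dual_apply_le (g x) (norm_truncH1_le_sqrt_tailH1 hA _)
      linarith
    have h2 := integral_mono_ae (integrable_const _)
      ((integrable_tailH1 hρ (boxModes n m)).add (integrable_const _)) h1
    have hvol : (timeMeasure T).real univ = T := by
      simp [timeMeasure, Measure.real, hT.le]
    simp only [Pi.add_apply] at h2
    rw [integral_add (integrable_tailH1 hρ (boxModes n m)) (integrable_const _)] at h2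
    simp only [integral_const, hvol, smul_eq_mul] at h2
    unfold tailBound
    rw [← hJ]
    have h3 : T * (T⁻¹ * ∫ t, tailH1 (boxModes n m) (ρ t) ∂(timeMeasure T)) =
        ∫ t, tailH1 (boxModes n m) (ρ t) ∂(timeMeasure T) := by
      rw [← mul_assoc, mul_inv_cancel₀ hT.ne', one_mul]
    refine le_of_mul_le_mul_left ?_ hT
    rw [mul_add, h3]
    linarith
  set S : ℕ → ℝ → L2 n := fun m t => ∑ i ∈ boxModes n m, U i t • H1.toL2 (modeH1 i) with hS
  have hSc : ∀ m, ContinuousOn (S m) (Icc 0 T) := fun m =>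
    continuousOn_finsetSum _ fun i _ => (hUc i).smul continuousOn_const
  have hdiff : ∀ m l, m ≤ l → ∀ t ∈ Icc 0 T, ‖S l t - S m t‖ ^ 2 ≤ tailBound T ρ g m := by
    intro m l hml t ht
    have : S l t - S m t =
        ∑ i ∈ boxModes n l \ boxModes n m, U i t • H1.toL2 (modeH1 i) := by
      rw [sub_eq_iff_eq_add, hS]
      exact (Finset.sum_sdiff (monotone_boxModes hml)).symm
    rw [this]
    exact (isParsevalFrame_modeL2.norm_sum_sq_le _ _).trans
      (hδ m _ Finset.sdiff_disjoint t ht)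
  have hcau : UniformCauchySeqOn S atTop (Icc 0 T) := by
    rw [Metric.uniformCauchySeqOn_iff]
    intro ε hε
    obtain ⟨N, hN⟩ := eventually_atTop.1
      ((tendsto_tailBound hρ hg).eventually (gt_mem_nhds (by positivity : (0 : ℝ) < (ε / 2) ^ 2)))
    refine ⟨N, fun m hm l hl t ht => ?_⟩
    have key : ∀ m ≥ N, ‖S m t - S N t‖ < ε / 2 := fun m hm =>
      lt_of_pow_lt_pow_left₀ 2 (by positivity) ((hdiff N m hm t ht).trans_lt (hN N le_rfl))
    rw [dist_eq_norm]
    have := norm_sub_le (S m t - S N t) (S l t - S N t)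
    rw [sub_sub_sub_cancel_right] at this
    linarith [key m hm, key l hl]
  -- Outside [0,T] the value may be a default one; only [0,T] is used below.
  set u : ℝ → L2 n := fun t => limUnder atTop fun m => S m t with hu
  have hut : ∀ t ∈ Icc 0 T, Tendsto (fun m => S m t) atTop (𝓝 (u t)) := fun t ht =>
    (hcau.cauchySeq ht).tendsto_limUnder
  have huc : ContinuousOn u (Icc 0 T) :=
    (hcau.tendstoUniformlyOn_of_tendsto hut).continuousOn (Frequently.of_forall hSc)
  have huρ : ∀ᵐ t ∂(timeMeasure T), u t = H1.toL2 (ρ t) := by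
    filter_upwards [hU, ae_restrict_mem measurableSet_Ioo] with t ht htm
    refine tendsto_nhds_unique (hut t (Ioo_subset_Icc_self htm)) ?_
    have := ((isParsevalFrame_modeL2.hasSum (H1.toL2 (ρ t))).comp tendsto_boxModes)
    simp only [inner_toL2_modeH1, ht] at this
    exact this
  have hpair : ∀ v : H1 n, ∃ k : ℝ, ∀ t ∈ Icc 0 T,
      inner ℝ (u t) (H1.toL2 v) = k + ∫ x in (0 : ℝ)..t, g x v := by
    intro v
    obtain ⟨k, hk⟩ := h.exists_ae_inner_eq hT hρ hg v
    refine ⟨k, eqOn_Icc_of_ae_eq hT (huc.inner continuousOn_const)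
      (continuousOn_primitive_timeMeasure hT.le (integrable_dual_apply_const hg v) k) ?_⟩
    filter_upwards [hk, huρ] with t h1 h2
    rw [h2, h1]
  -- Both sides are continuous, so almost everywhere equality becomes equality at every time, the
  -- endpoints included.
  have hcoeff : ∀ t ∈ Icc 0 T, ∀ i, modeCoeff (u t) i = U i t := by
    intro t ht i
    refine eqOn_Icc_of_ae_eq (f := fun t => modeCoeff (u t) i) hT ?_ (hUc i) ?_ ht
    · simp only [← inner_toL2_modeH1]
      exact huc.inner continuousOn_const
    · filter_upwards [hU, huρ] with t h1 h2
      rw [h2, h1]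
  refine ⟨u, huc, huρ, fun s hs t ht => ?_, fun v t ht => ?_⟩
  · have hnorm : ∀ t ∈ Icc 0 T, Tendsto (fun m => ∑ i ∈ boxModes n m, U i t ^ 2) atTop
        (𝓝 (‖u t‖ ^ 2)) := by
      intro t ht
      have := (isParsevalFrame_modeL2 (u t)).comp tendsto_boxModes
      simp only [inner_toL2_modeH1, hcoeff t ht] at this
      exact this
    have hsub : uIcc s t ⊆ Icc 0 T := uIcc_subset_Icc hs ht
    have hint : Tendsto (fun m => ∫ x in s..t, g x (truncH1 (boxModes n m) (ρ x))) atTop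
        (𝓝 (∫ x in s..t, g x (ρ x))) := by
      refine intervalIntegral.tendsto_integral_filter_of_dominated_convergence
        (fun x => ‖g x‖ * ‖ρ x‖) (Eventually.of_forall fun m => ?_)
        (Eventually.of_forall fun m => Eventually.of_forall fun x _ => ?_)
        (intervalIntegrable_of_timeMeasure (integrable_norm_mul_norm hρ hg) hs ht)
        (Eventually.of_forall fun x _ => ?_)
      · have hti : Integrable (fun x => g x (truncH1 (boxModes n m) (ρ x))) (timeMeasure T) :=
          integrable_dual_apply hρ hg ((continuous_truncH1 _).comp_aestronglyMeasurable hρ.1)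
            fun _ => norm_truncH1_le _ _
        exact ((integrableOn_Icc_of_timeMeasure hti).mono_set
          (uIoc_subset_uIcc.trans hsub)).aestronglyMeasurable
      · exact dual_apply_le (g x) (norm_truncH1_le _ _)
      · exact ((g x).continuous.tendsto _).comp ((tendsto_truncH1 (ρ x)).comp tendsto_boxModes)
    exact tendsto_nhds_unique ((hnorm t ht).sub (hnorm s hs))
      ((hint.const_mul 2).congr fun m => (hE _ s hs t ht).symm)
  · obtain ⟨k, hk⟩ := hpair v
    have h1 := hk 0 h0T
    rw [intervalIntegral.integral_same, add_zero] at h1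
    rw [hk t ht, h1]

/-! ### Time slices: measurability, integrability and dense test functions -/

section Slices

variable {E : Type*} [NormedAddCommGroup E]

/-- For finite p this is Tonelli. For p = ∞ the essential supremum of a slice is at most c exactly
when the slice of {‖f‖ > c} is null, and the measure of a slice is measurable in t. -/
theorem measurable_eLpNorm_slice {f : ℝ × Torus n → E} (hf : StronglyMeasurable f) (p : ℝ≥0∞) :
    Measurable fun t => eLpNorm (fun x => f (t, x)) p volume := by
  rcases eq_or_ne p 0 with rfl | h0
  · simp
  rcases eq_or_ne p ⊤ with rfl | htop
  · simp only [eLpNorm_exponent_top]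
    refine measurable_of_Iic fun c => ?_
    have h1 : (fun t => eLpNormEssSup (fun x => f (t, x)) volume) ⁻¹' Iic c =
        (fun t => (volume : Measure (Torus n)) (Prod.mk t ⁻¹' {z | c < ‖f z‖ₑ})) ⁻¹' {0} := by
      ext t
      simp only [mem_preimage, mem_Iic, mem_singleton_iff, eLpNormEssSup]
      have h2 : (Prod.mk t ⁻¹' {z | c < ‖f z‖ₑ} : Set (Torus n)) = {x | ¬ ‖f (t, x)‖ₑ ≤ c} := by
        ext x; simp
      rw [h2]
      refine ⟨fun h => ?_, fun h => essSup_le_of_ae_le c h⟩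
      exact (ae_le_essSup (f := fun x => ‖f (t, x)‖ₑ)).mono fun x hx => hx.trans h
    rw [h1]
    exact measurable_measure_prodMk_left (measurableSet_lt measurable_const hf.enorm)
      (measurableSet_singleton 0)
  · simp only [eLpNorm_eq_lintegral_rpow_enorm_toReal h0 htop]
    exact (Measurable.lintegral_prod_right' (hf.enorm.pow_const _)).pow_const _

theorem aemeasurable_eLpNorm_slice {μ : Measure ℝ} [SFinite μ] {f : ℝ → Torus n → E}
    (hf : AEStronglyMeasurable (Function.uncurry f) (μ.prod volume)) (p : ℝ≥0∞) :
    AEMeasurable (fun t => eLpNorm (f t) p volume) μ := by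
  refine ⟨_, measurable_eLpNorm_slice hf.stronglyMeasurable_mk p, ?_⟩
  filter_upwards [Measure.ae_ae_of_ae_prod hf.ae_eq_mk] with t ht
  exact eLpNorm_congr_ae ht

variable {T : ℝ} {r q : ℝ≥0∞} {f : ℝ → Torus n → E}

theorem ae_aestronglyMeasurable_slice {μ : Measure ℝ} [SFinite μ] {f : ℝ → Torus n → E}
    (hf : AEStronglyMeasurable (Function.uncurry f) (μ.prod volume)) :
    ∀ᵐ t ∂μ, AEStronglyMeasurable (f t) volume := hf.prodMk_left

theorem MemMixed.lintegral_eLpNorm_lt_top (hf : MemMixed T r q f) (hr : 1 ≤ r) :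
    ∫⁻ t, eLpNorm (f t) q volume ∂(timeMeasure T) < ⊤ := by
  have h1 : ∫⁻ t, eLpNorm (f t) q volume ∂(timeMeasure T) =
      eLpNorm (fun t => eLpNorm (f t) q volume) 1 (timeMeasure T) := by
    rw [eLpNorm_one_eq_lintegral_enorm]; rfl
  rw [h1]
  refine (eLpNorm_le_eLpNorm_mul_rpow_measure_univ hr
    (aemeasurable_eLpNorm_slice hf.1 q).aestronglyMeasurable).trans_lt ?_
  refine ENNReal.mul_lt_top hf.2 (ENNReal.rpow_lt_top_of_nonneg ?_ (measure_ne_top _ _))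
  rw [sub_nonneg]
  rcases eq_or_ne r ⊤ with rfl | h
  · simp
  · rw [ENNReal.toReal_one, one_div_one, one_div]
    exact inv_le_one_of_one_le₀ (by simpa using (ENNReal.toReal_le_toReal (by simp) h).2 hr)

theorem MemMixed.ae_memLp (hf : MemMixed T r q f) (hr : 1 ≤ r) :
    ∀ᵐ t ∂(timeMeasure T), MemLp (f t) q volume := by
  filter_upwards [ae_aestronglyMeasurable_slice hf.1,
    ae_lt_top' (aemeasurable_eLpNorm_slice hf.1 q) (hf.lintegral_eLpNorm_lt_top hr).ne] with t h1 h2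
  exact ⟨h1, h2⟩

theorem MemMixed.integrable (hf : MemMixed T r q f) (hr : 1 ≤ r) (hq : 1 ≤ q) :
    Integrable (Function.uncurry f) ((timeMeasure T).prod volume) := by
  refine ⟨hf.1, ?_⟩
  rw [HasFiniteIntegral, lintegral_prod _ hf.1.enorm]
  refine lt_of_le_of_lt (lintegral_mono_ae ?_) (hf.lintegral_eLpNorm_lt_top hr)
  filter_upwards [ae_aestronglyMeasurable_slice hf.1] with t ht
  have := eLpNorm_le_eLpNorm_of_exponent_le hq ht
  rwa [eLpNorm_one_eq_lintegral_enorm] at this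

theorem MemMixed.integrable_toReal (hf : MemMixed T r q f) (hr : 1 ≤ r) :
    Integrable (fun t => (eLpNorm (f t) q volume).toReal) (timeMeasure T) :=
  integrable_toReal_of_lintegral_ne_top (aemeasurable_eLpNorm_slice hf.1 q)
    (hf.lintegral_eLpNorm_lt_top hr).ne

theorem MemMixed.lintegral_rpow (hr0 : r ≠ 0) (hr : r ≠ ⊤) :
    ∫⁻ t, eLpNorm (f t) q volume ^ r.toReal ∂(timeMeasure T) = mixedNorm T r q f ^ r.toReal := by
  unfold mixedNorm
  rw [eLpNorm_eq_lintegral_rpow_enorm_toReal hr0 hr, ← ENNReal.rpow_mul, one_div,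
    inv_mul_cancel₀ (ENNReal.toReal_pos hr0 hr).ne', ENNReal.rpow_one]
  rfl

theorem MemMixed.integrable_rpow (hf : MemMixed T r q f) (hr0 : r ≠ 0) (hr : r ≠ ⊤) :
    Integrable (fun t => (eLpNorm (f t) q volume).toReal ^ r.toReal) (timeMeasure T) := by
  simp only [ENNReal.toReal_rpow]
  refine integrable_toReal_of_lintegral_ne_top
    ((aemeasurable_eLpNorm_slice hf.1 q).pow_const _) ?_
  rw [MemMixed.lintegral_rpow hr0 hr]
  exact (ENNReal.rpow_lt_top_of_nonneg ENNReal.toReal_nonneg hf.2.ne).ne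

theorem MemMixed.integral_rpow (hf : MemMixed T r q f) (hr0 : r ≠ 0) (hr : r ≠ ⊤) :
    ∫ t, (eLpNorm (f t) q volume).toReal ^ r.toReal ∂(timeMeasure T) =
      (mixedNorm T r q f).toReal ^ r.toReal := by
  simp only [ENNReal.toReal_rpow]
  rw [← MemMixed.lintegral_rpow hr0 hr]
  refine integral_toReal ((aemeasurable_eLpNorm_slice hf.1 q).pow_const _) ?_
  refine ae_lt_top' ((aemeasurable_eLpNorm_slice hf.1 q).pow_const _) ?_
  rw [MemMixed.lintegral_rpow hr0 hr]
  exact (ENNReal.rpow_lt_top_of_nonneg ENNReal.toReal_nonneg hf.2.ne).ne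

end Slices

/-- The first-order functional `ψ ↦ ∫ α·Dψ + ∫ β ψ` vanishes on all smooth functions if it does
so on a `C¹`-dense set of them. -/
theorem eq_zero_of_dense_smooth {S : Set (Torus n → ℝ)} (hS : ∀ ψ ∈ S, SmoothOnTorus ψ)
    (hdense : ∀ φ : Torus n → ℝ, SmoothOnTorus φ → ∀ ε > 0, ∃ ψ ∈ S, ∀ x,
      |ψ x - φ x| < ε ∧ ∀ i, |partialDeriv i ψ x - partialDeriv i φ x| < ε)
    {α : Torus n → Vec n} {β : Torus n → ℝ} (hα : Integrable α) (hβ : Integrable β)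
    (h : ∀ ψ ∈ S, (∫ x, inner ℝ (α x) (grad ψ x)) + ∫ x, β x * ψ x = 0)
    {φ : Torus n → ℝ} (hφ : SmoothOnTorus φ) :
    (∫ x, inner ℝ (α x) (grad φ x)) + ∫ x, β x * φ x = 0 := by
  have hi : ∀ ψ, SmoothOnTorus ψ → Integrable (fun x => inner ℝ (α x) (grad ψ x)) := by
    intro ψ hψ
    obtain ⟨B, -, hB⟩ := hψ.continuous_grad.exists_bound_torus
    refine (hα.norm.mul_const B).mono (hα.1.inner hψ.continuous_grad.aestronglyMeasurable)
      (Eventually.of_forall fun x => ?_)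
    rw [Real.norm_eq_abs]
    refine (abs_real_inner_le_norm _ _).trans ((mul_le_mul_of_nonneg_left (hB x)
      (norm_nonneg _)).trans (le_abs_self _))
  have hi' : ∀ ψ, SmoothOnTorus ψ → Integrable (fun x => β x * ψ x) := by
    intro ψ hψ
    obtain ⟨B, -, hB⟩ := hψ.continuous.exists_bound_torus
    exact hβ.mul_bdd hψ.continuous.aestronglyMeasurable (Eventually.of_forall hB)
  set C := n * (∫ x, ‖α x‖) + ∫ x, ‖β x‖ with hC
  have hC0 : 0 ≤ C := by positivity
  refine abs_eq_zero.1 (le_antisymm (le_of_forall_pos_le_add fun δ hδ => ?_) (abs_nonneg _))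
  obtain ⟨ψ, hψS, hψ⟩ := hdense φ hφ (δ / (C + 1)) (by positivity)
  set ε := δ / (C + 1)
  have hψs := hS ψ hψS
  have e1 : ‖(∫ x, inner ℝ (α x) (grad φ x)) - ∫ x, inner ℝ (α x) (grad ψ x)‖ ≤
      ∫ x, n * ε * ‖α x‖ := by
    rw [← integral_sub (hi φ hφ) (hi ψ hψs)]
    refine norm_integral_le_of_norm_le (hα.norm.const_mul _) (Eventually.of_forall fun x => ?_)
    rw [← inner_sub_right, PiLp.inner_apply]
    refine (norm_sum_le _ _).trans ?_
    have : ∀ i ∈ Finset.univ, ‖inner ℝ ((α x) i) ((grad φ x - grad ψ x) i)‖ ≤ ε * ‖α x‖ := by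
      intro i _
      refine (norm_inner_le_norm _ _).trans ?_
      rw [mul_comm]
      refine mul_le_mul ?_ (PiLp.norm_apply_le _ _) (norm_nonneg _) (by positivity)
      rw [PiLp.sub_apply, grad_apply, grad_apply, Real.norm_eq_abs, abs_sub_comm]
      exact ((hψ x).2 i).le
    refine (Finset.sum_le_card_nsmul _ _ _ this).trans (le_of_eq ?_)
    simp [mul_assoc]
  have e2 : ‖(∫ x, β x * φ x) - ∫ x, β x * ψ x‖ ≤ ∫ x, ε * ‖β x‖ := by
    rw [← integral_sub (hi' φ hφ) (hi' ψ hψs)]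
    refine norm_integral_le_of_norm_le (hβ.norm.const_mul _) (Eventually.of_forall fun x => ?_)
    rw [← mul_sub, norm_mul, mul_comm]
    refine mul_le_mul_of_nonneg_right ?_ (norm_nonneg _)
    rw [Real.norm_eq_abs, abs_sub_comm]
    exact (hψ x).1.le
  rw [integral_const_mul, Real.norm_eq_abs] at e1 e2
  have h0 := h ψ hψS
  have e3 : |(∫ x, inner ℝ (α x) (grad φ x)) + ∫ x, β x * φ x| ≤ ε * C := by
    have := abs_add_le ((∫ x, inner ℝ (α x) (grad φ x)) - ∫ x, inner ℝ (α x) (grad ψ x))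
      ((∫ x, β x * φ x) - ∫ x, β x * ψ x)
    rw [show ((∫ x, inner ℝ (α x) (grad φ x)) - ∫ x, inner ℝ (α x) (grad ψ x)) +
      ((∫ x, β x * φ x) - ∫ x, β x * ψ x) = (∫ x, inner ℝ (α x) (grad φ x)) + ∫ x, β x * φ x by
        linarith] at this
    rw [hC]
    linarith
  have e4 : ε * C ≤ δ := by
    rw [div_mul_eq_mul_div, div_le_iff₀ (by positivity)]
    nlinarith
  linarith

/-! ### Grönwall's inequality -/

/-- An absolutely continuous f is bounded by some C on the interval, and the exponential is
Lipschitz on (-∞, C]. -/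
theorem AbsolutelyContinuousOnInterval.exp {f : ℝ → ℝ} {a b : ℝ}
    (hf : AbsolutelyContinuousOnInterval f a b) :
    AbsolutelyContinuousOnInterval (fun t => Real.exp (f t)) a b := by
  obtain ⟨C, hC⟩ := hf.exists_bound
  have hlip : ∀ x ∈ uIcc a b, ∀ y ∈ uIcc a b,
      dist (Real.exp (f x)) (Real.exp (f y)) ≤ Real.exp C * dist (f x) (f y) := by
    intro x hx y hy
    rw [dist_eq_norm, dist_eq_norm]
    exact Convex.norm_image_sub_le_of_norm_deriv_le (s := Iic C)
      (fun z _ => Real.differentiableAt_exp)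
      (fun z hz => by
        rw [Real.deriv_exp, Real.norm_of_nonneg (Real.exp_pos _).le]
        exact Real.exp_le_exp.2 hz) (convex_Iic C)
      ((le_abs_self _).trans (hC y hy)) ((le_abs_self _).trans (hC x hx))
  rw [absolutelyContinuousOnInterval_iff] at hf ⊢
  intro ε hε
  obtain ⟨δ, hδ, h⟩ := hf (ε / Real.exp C) (by positivity)
  refine ⟨δ, hδ, fun E hE hlt => ?_⟩
  have h1 := h E hE hlt
  rw [lt_div_iff₀ (Real.exp_pos _), mul_comm, Finset.mul_sum] at h1
  refine (Finset.sum_le_sum fun i hi => ?_).trans_lt h1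
  exact hlip _ (hE.1 i hi).1 _ (hE.1 i hi).2

theorem absolutelyContinuousOnInterval_primitive {T : ℝ} {f : ℝ → ℝ}
    (hf : Integrable f (timeMeasure T)) (k : ℝ) {t : ℝ} (ht : t ∈ Icc 0 T) :
    AbsolutelyContinuousOnInterval (fun y => k + ∫ x in (0 : ℝ)..y, f x) 0 t := by
  have h1 := (intervalIntegrable_of_timeMeasure hf ⟨le_rfl, ht.1.trans ht.2⟩
    ht).absolutelyContinuousOnInterval_intervalIntegral left_mem_uIcc
  have h2 : AbsolutelyContinuousOnInterval (fun _ : ℝ => k) 0 t :=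
    (LipschitzWith.const k).lipschitzOnWith.absolutelyContinuousOnInterval
  exact h2.fun_add h1

theorem ae_hasDerivAt_primitive {T : ℝ} {f : ℝ → ℝ} (hf : Integrable f (timeMeasure T)) (k : ℝ) :
    ∀ᵐ y ∂(timeMeasure T), HasDerivAt (fun y => k + ∫ x in (0 : ℝ)..y, f x) (f y) y := by
  refine (ae_restrict_iff' measurableSet_Ioo).2 ?_
  by_cases hT : 0 ≤ T
  · filter_upwards [(intervalIntegrable_of_timeMeasure hf ⟨le_rfl, hT⟩
      ⟨hT, le_rfl⟩).ae_hasDerivAt_integral] with y hy hmem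
    exact (hy (by rw [uIcc_of_le hT]; exact Ioo_subset_Icc_self hmem) 0 left_mem_uIcc).const_add k
  · exact Eventually.of_forall fun y hy => absurd (hy.1.trans hy.2).le hT

/-- **Grönwall's inequality** with damping, for absolutely continuous functions. -/
theorem gronwall_damped {T : ℝ} {F e κ : ℝ → ℝ} {c : ℝ} (he : Integrable e (timeMeasure T))
    (hκ : Integrable κ (timeMeasure T)) (hκ0 : ∀ t, 0 ≤ κ t) (hc : 0 ≤ c)
    (hF0 : ∀ t ∈ Icc 0 T, 0 ≤ F t)
    (hF : ∀ t ∈ Icc 0 T, F t = F 0 + ∫ x in (0 : ℝ)..t, e x)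
    (hle : ∀ᵐ t ∂(timeMeasure T), e t ≤ (κ t - 1) * F t + c) {t : ℝ} (ht : t ∈ Icc 0 T) :
    F t ≤ Real.exp (∫ x, κ x ∂(timeMeasure T)) * (F 0 + c) := by
  have hT : 0 ≤ T := ht.1.trans ht.2
  have h0 : (0 : ℝ) ∈ Icc 0 T := ⟨le_rfl, hT⟩
  -- The integrating factor is exp P. It satisfies P(y) ≤ y, because κ ≥ 0, and P(t) ≥ t - ∫ κ.
  set P : ℝ → ℝ := fun y => 0 + ∫ x in (0 : ℝ)..y, (1 - κ x) with hP
  have hPi : Integrable (fun x => 1 - κ x) (timeMeasure T) := (integrable_const _).sub hκ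
  set G : ℝ → ℝ := fun y => F 0 + ∫ x in (0 : ℝ)..y, e x with hG
  have hac : AbsolutelyContinuousOnInterval (fun y => Real.exp (P y) * G y) 0 t :=
    (AbsolutelyContinuousOnInterval.exp (absolutelyContinuousOnInterval_primitive hPi 0 ht)).fun_mul
      (absolutelyContinuousOnInterval_primitive he (F 0) ht)
  have hPle : ∀ y ∈ Icc 0 T, P y ≤ y := by
    intro y hy
    have hi := intervalIntegrable_of_timeMeasure hκ h0 hy
    simp only [hP]
    rw [intervalIntegral.integral_sub (by simp) hi, intervalIntegral.integral_const, zero_add]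
    have := intervalIntegral.integral_nonneg (μ := volume) hy.1 fun x _ => hκ0 x
    simp only [sub_zero, smul_eq_mul, mul_one]
    linarith
  have hderiv : (fun y => deriv (fun y => Real.exp (P y) * G y) y) ≤ᵐ[timeMeasure T]
      fun y => c * Real.exp y := by
    filter_upwards [ae_hasDerivAt_primitive hPi 0, ae_hasDerivAt_primitive he (F 0), hle,
      ae_restrict_mem measurableSet_Ioo] with y h1 h2 h3 h4
    have hy : y ∈ Icc 0 T := Ioo_subset_Icc_self h4
    have h5 : HasDerivAt (fun y => Real.exp (P y) * G y)
        (Real.exp (P y) * (1 - κ y) * G y + Real.exp (P y) * e y) y := h1.exp.fun_mul h2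
    rw [h5.deriv]
    have h6 : G y = F y := (hF y hy).symm
    rw [h6]
    have h7 : Real.exp (P y) * (1 - κ y) * F y + Real.exp (P y) * e y =
        Real.exp (P y) * (e y - (κ y - 1) * F y) := by ring
    rw [h7, mul_comm c]
    exact (mul_le_mul_of_nonneg_left (by linarith : e y - (κ y - 1) * F y ≤ c)
      (Real.exp_pos _).le).trans
      (mul_le_mul_of_nonneg_right (Real.exp_le_exp.2 (hPle y hy)) hc)
  have hint : ∫ y in (0 : ℝ)..t, deriv (fun y => Real.exp (P y) * G y) y ≤
      ∫ y in (0 : ℝ)..t, c * Real.exp y := by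
    refine intervalIntegral.integral_mono_ae_restrict ht.1 hac.intervalIntegrable_deriv
      ((by fun_prop : Continuous fun y => c * Real.exp y).intervalIntegrable _ _) ?_
    rw [← restrict_Ioo_eq_restrict_Icc]
    exact ae_mono (Measure.restrict_mono (Ioo_subset_Ioo_right ht.2) le_rfl) hderiv
  rw [hac.integral_deriv_eq_sub, intervalIntegral.integral_const_mul, integral_exp,
    Real.exp_zero] at hint
  have hG0 : G 0 = F 0 := by simp [hG]
  have hP0 : P 0 = 0 := by simp [hP]
  have hGt : G t = F t := (hF t ht).symm
  rw [hG0, hP0, hGt, Real.exp_zero, one_mul] at hint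
  have hPt : t - ∫ x, κ x ∂(timeMeasure T) ≤ P t := by
    have hi := intervalIntegrable_of_timeMeasure hκ h0 ht
    simp only [hP]
    rw [intervalIntegral.integral_sub (by simp) hi, intervalIntegral.integral_const, zero_add,
      integral_timeMeasure hT]
    have := intervalIntegral.integral_mono_interval (μ := volume) le_rfl ht.1 ht.2
      (Eventually.of_forall hκ0)
      (intervalIntegrable_of_timeMeasure hκ h0 ⟨hT, le_rfl⟩)
    simp only [sub_zero, smul_eq_mul, mul_one]
    linarith
  set I := ∫ x, κ x ∂(timeMeasure T)
  -- The integrated inequality bounds exp(P(t)) F(t) by F(0) + c(e^t - 1). The damping supplies the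
  -- matching e^t on the left, so no growth in t survives.
  have h8 : Real.exp (t - I) * F t ≤ Real.exp t * (F 0 + c) := by
    have h9 : Real.exp (t - I) * F t ≤ Real.exp (P t) * F t :=
      mul_le_mul_of_nonneg_right (Real.exp_le_exp.2 hPt) (hF0 t ht)
    have h10 : 1 ≤ Real.exp t := Real.one_le_exp ht.1
    have h11 := hF0 0 h0
    nlinarith
  have h12 : F t = Real.exp (I - t) * (Real.exp (t - I) * F t) := by
    rw [← mul_assoc, ← Real.exp_add]; simp
  rw [h12]
  refine (mul_le_mul_of_nonneg_left h8 (Real.exp_pos _).le).trans (le_of_eq ?_)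
  rw [← mul_assoc, ← Real.exp_add]; simp

/-! ### Localising the weak formulations in time -/

theorem ae_eq_zero_of_forall_test {T : ℝ} {f : ℝ → ℝ} (hf : Integrable f (timeMeasure T))
    (h : ∀ η : ℝ → ℝ, ContDiff ℝ ∞ η → HasCompactSupport η → tsupport η ⊆ Ioo 0 T →
      ∫ t, η t * f t ∂(timeMeasure T) = 0) : ∀ᵐ t ∂(timeMeasure T), f t = 0 := by
  refine (ae_restrict_iff' measurableSet_Ioo).2
    (isOpen_Ioo.ae_eq_zero_of_integral_contDiff_smul_eq_zero
      (IntegrableOn.locallyIntegrableOn hf) fun η h1 h2 h3 => ?_)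
  rw [← h η h1 h2 h3]
  exact (setIntegral_eq_integral_of_forall_compl_eq_zero fun x hx => by
    rw [image_eq_zero_of_notMem_tsupport fun h => hx (h3 h), zero_smul]).symm

theorem smoothOnSpaceTime_mul {η : ℝ → ℝ} (hη : ContDiff ℝ ∞ η) {ψ : Torus n → ℝ}
    (hψ : SmoothOnTorus ψ) : SmoothOnSpaceTime fun t x => η t * ψ x :=
  (hη.comp contDiff_fst).mul (ContDiff.comp (g := fun x => ψ (proj n x)) hψ contDiff_snd)

theorem integrable_continuous_mul {T : ℝ} {η f : ℝ → ℝ} (hη : Continuous η)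
    (hf : Integrable f (timeMeasure T)) : Integrable (fun t => η t * f t) (timeMeasure T) := by
  obtain ⟨B, hB⟩ := (isCompact_Icc (a := 0) (b := T)).exists_bound_of_continuousOn hη.continuousOn
  refine hf.bdd_mul (c := B) hη.aestronglyMeasurable ?_
  filter_upwards [ae_restrict_mem measurableSet_Ioo] with t ht
  exact hB t (Ioo_subset_Icc_self ht)

theorem integrable_prod_inner_grad {μ : Measure ℝ} [SFinite μ] {b : ℝ → Torus n → Vec n}
    (hb : Integrable (Function.uncurry b) (μ.prod volume)) {ψ : Torus n → ℝ}
    (hψ : SmoothOnTorus ψ) :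
    Integrable (fun z : ℝ × Torus n => inner ℝ (b z.1 z.2) (grad ψ z.2)) (μ.prod volume) := by
  obtain ⟨B, -, hB⟩ := hψ.continuous_grad.exists_bound_torus
  refine (hb.norm.mul_const B).mono (hb.1.inner (𝕜 := ℝ)
    (hψ.continuous_grad.comp continuous_snd).aestronglyMeasurable) (Eventually.of_forall fun z => ?_)
  rw [Real.norm_eq_abs]
  exact (abs_real_inner_le_norm _ _).trans ((mul_le_mul_of_nonneg_left (hB z.2)
    (norm_nonneg _)).trans (le_abs_self _))

/-- The divergence identity on almost every time slice. -/
theorem IsWeakDiv.ae_slice {T : ℝ} (hT : 0 < T) {b : ℝ → Torus n → Vec n}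
    {d : ℝ → Torus n → ℝ} (h : IsWeakDiv T b d)
    (hb : Integrable (Function.uncurry b) ((timeMeasure T).prod volume))
    (hd : Integrable (Function.uncurry d) ((timeMeasure T).prod volume)) {ψ : Torus n → ℝ}
    (hψ : SmoothOnTorus ψ) :
    ∀ᵐ t ∂(timeMeasure T), (∫ x, inner ℝ (b t x) (grad ψ x)) + ∫ x, d t x * ψ x = 0 := by
  have hB := (integrable_prod_inner_grad hb hψ).integral_prod_left
  have hD : Integrable (fun t => ∫ x, d t x * ψ x) (timeMeasure T) := by
    obtain ⟨B, -, hB⟩ := hψ.continuous.exists_bound_torus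
    have : Integrable (fun z : ℝ × Torus n => d z.1 z.2 * ψ z.2) ((timeMeasure T).prod volume) :=
      hd.mul_bdd (hψ.continuous.comp continuous_snd).aestronglyMeasurable
        (Eventually.of_forall fun z => hB z.2)
    exact this.integral_prod_left
  refine ae_eq_zero_of_forall_test (hB.add hD) fun η h1 h2 h3 => ?_
  obtain ⟨s₀, s₁, e1, -, e3, e4⟩ := exists_Icc_of_isCompact_subset_Ioo hT h2.isCompact h3
  have key := h (fun t x => η t * ψ x) (smoothOnSpaceTime_mul h1 hψ) ⟨s₀, s₁, e1, e3,
    fun t ht x => by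
      rw [image_eq_zero_of_notMem_tsupport fun h => ht (e4 h), zero_mul]⟩
  simp only [grad_const_mul, inner_smul_right, mul_left_comm _ (η _), integral_const_mul] at key
  simp only [mul_add]
  rw [integral_add (integrable_continuous_mul h1.continuous hB)
    (integrable_continuous_mul h1.continuous hD), key, neg_add_cancel]

theorem L2.integral_mul_eq_inner (w : L2 n) {h : Torus n → ℝ} (hh : MemLp h 2 volume) :
    ∫ x, w x * h x = inner ℝ w (hh.toLp h) := by
  rw [L2.inner_eq_integral_mul]
  refine integral_congr_ae ?_
  filter_upwards [hh.coeFn_toLp] with x hx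
  rw [hx]

/-- The chosen representatives of w(t) need not be jointly measurable in (t,x), so Fubini does not
apply directly. Expanding w(t) in modes writes the integral as a limit of finite sums of measurable
products. -/
theorem aestronglyMeasurable_integral_L2_mul {μ : Measure ℝ} [SFinite μ] {w : ℝ → L2 n}
    (hw : AEStronglyMeasurable w μ) {h : ℝ → Torus n → ℝ}
    (hh : AEStronglyMeasurable (Function.uncurry h) (μ.prod volume))
    (h2 : ∀ᵐ t ∂μ, MemLp (h t) 2 volume) :
    AEStronglyMeasurable (fun t => ∫ x, w t x * h t x) μ := by
  refine aestronglyMeasurable_of_tendsto_ae atTop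
    (f := fun m t => ∑ i ∈ boxModes n m,
      inner ℝ (w t) (H1.toL2 (modeH1 i)) * ∫ x, h t x * mode i x) (fun m => ?_) ?_
  · refine Finset.aestronglyMeasurable_fun_sum _ fun i _ => ?_
    refine (hw.inner (𝕜 := ℝ) aestronglyMeasurable_const).mul ?_
    exact (hh.mul ((smooth_mode i).continuous.comp
      continuous_snd).aestronglyMeasurable).integral_prod_right'
  · filter_upwards [h2] with t ht
    rw [L2.integral_mul_eq_inner _ ht]
    have hc : Continuous fun z : L2 n => (inner ℝ z (ht.toLp (h t)) : ℝ) :=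
      continuous_id.inner continuous_const
    have h3 := (hc.tendsto (w t)).comp
      ((isParsevalFrame_modeL2.hasSum (w t)).comp tendsto_boxModes)
    refine h3.congr fun m => ?_
    simp only [Function.comp, sum_inner, inner_smul_left, conj_trivial]
    refine Finset.sum_congr rfl fun i _ => ?_
    congr 1
    rw [real_inner_comm, inner_toL2_modeH1, modeCoeff]
    refine integral_congr_ae ?_
    filter_upwards [ht.coeFn_toLp] with x hx
    rw [hx]

theorem memLp_inner_grad {b : Torus n → Vec n} {p : ℝ≥0∞} (hb : MemLp b p volume)
    {ψ : Torus n → ℝ} (hψ : SmoothOnTorus ψ) :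
    MemLp (fun x => inner ℝ (b x) (grad ψ x)) p volume := by
  obtain ⟨B, -, hB⟩ := hψ.continuous_grad.exists_bound_torus
  refine hb.of_le_mul (c := B) (hb.1.inner (𝕜 := ℝ) hψ.continuous_grad.aestronglyMeasurable)
    (Eventually.of_forall fun x => ?_)
  rw [Real.norm_eq_abs, mul_comm]
  exact (abs_real_inner_le_norm _ _).trans (mul_le_mul_of_nonneg_left (hB x) (norm_nonneg _))

theorem exists_abs_integral_L2_mul_inner_grad_le {ψ : Torus n → ℝ} (hψ : SmoothOnTorus ψ) :
    ∃ B : ℝ, 0 ≤ B ∧ ∀ (w : L2 n) (b : Torus n → Vec n), MemLp b 2 volume →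
      |∫ x, w x * inner ℝ (b x) (grad ψ x)| ≤ ‖w‖ * (B * (eLpNorm b 2 volume).toReal) := by
  obtain ⟨B, hB0, hB⟩ := hψ.continuous_grad.exists_bound_torus
  refine ⟨B, hB0, fun w b hb => ?_⟩
  rw [L2.integral_mul_eq_inner _ (memLp_inner_grad hb hψ)]
  refine (abs_real_inner_le_norm _ _).trans (mul_le_mul_of_nonneg_left ?_ (norm_nonneg _))
  rw [Lp.norm_toLp, ← ENNReal.toReal_ofReal hB0, ← ENNReal.toReal_mul]
  refine ENNReal.toReal_mono (ENNReal.mul_ne_top ENNReal.ofReal_ne_top hb.2.ne) ?_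
  refine eLpNorm_le_mul_eLpNorm_of_ae_le_mul (Eventually.of_forall fun x => ?_) 2
  rw [Real.norm_eq_abs, mul_comm]
  exact (abs_real_inner_le_norm _ _).trans (mul_le_mul_of_nonneg_left (hB x) (norm_nonneg _))

section WeakSolution

variable {T : ℝ} {b : ℝ → Torus n → Vec n} {ρ₀ : L2 n} {ρ : ℝ → H1 n}

/-- As b is only L¹ in time with values in L², a bound on ‖ρ(t)‖ uniform in time is needed; it comes
from the continuous representative. -/
theorem integrable_transport (hb : MemMixed T 1 2 b) (hρ : MemLp ρ 2 (timeMeasure T)) {R : ℝ}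
    (hR : ∀ᵐ t ∂(timeMeasure T), ‖H1.toL2 (ρ t)‖ ≤ R) {ψ : Torus n → ℝ} (hψ : SmoothOnTorus ψ) :
    Integrable (fun t => ∫ x, H1.toL2 (ρ t) x * inner ℝ (b t x) (grad ψ x)) (timeMeasure T) := by
  obtain ⟨B, hB0, hB⟩ := exists_abs_integral_L2_mul_inner_grad_le hψ
  have hbae := hb.ae_memLp le_rfl
  refine ((hb.integrable_toReal le_rfl).const_mul (R * B)).mono'
    (aestronglyMeasurable_integral_L2_mul ((H1.toL2L n).continuous.comp_aestronglyMeasurable hρ.1)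
      (integrable_prod_inner_grad (hb.integrable le_rfl (by norm_num)) hψ).1 ?_) ?_
  · filter_upwards [hbae] with t ht using memLp_inner_grad ht hψ
  · filter_upwards [hbae, hR] with t h1 h2
    rw [Real.norm_eq_abs]
    refine (hB _ _ h1).trans ?_
    rw [mul_assoc]
    exact mul_le_mul_of_nonneg_right h2 (by positivity)

/-- The weak formulation tested with products `η(t) ψ(x)`. -/
theorem IsWeakSolution.tested (h : IsWeakSolution T b ρ₀ ρ) (hb : MemMixed T 1 2 b)
    (hρ : MemLp ρ 2 (timeMeasure T)) {R : ℝ} (hR : ∀ᵐ t ∂(timeMeasure T), ‖H1.toL2 (ρ t)‖ ≤ R)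
    {ψ : Torus n → ℝ} (hψ : SmoothOnTorus ψ) {η : ℝ → ℝ} (hη : ContDiff ℝ ∞ η)
    (hηT : ∃ s₁ < T, ∀ t, s₁ < t → η t = 0) :
    ∫ t, deriv η t * inner ℝ (H1.toL2 (ρ t)) (H1.toL2 (H1.ofSmooth ψ hψ)) ∂(timeMeasure T) =
      (∫ t, η t * (inner ℝ (H1.weakGrad (ρ t)) (H1.weakGrad (H1.ofSmooth ψ hψ)) -
        ∫ x, H1.toL2 (ρ t) x * inner ℝ (b t x) (grad ψ x)) ∂(timeMeasure T)) -
      η 0 * inner ℝ ρ₀ (H1.toL2 (H1.ofSmooth ψ hψ)) := by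
  set v := H1.ofSmooth ψ hψ with hv
  have hinner : ∀ w : L2 n, ∫ x, w x * ψ x = inner ℝ w (H1.toL2 v) := fun w => by
    rw [L2.inner_eq_integral_mul]
    refine integral_congr_ae ?_
    filter_upwards [H1.toL2_ofSmooth hψ] with x hx
    rw [hv, hx]
  have hinnerG : ∀ w : L2Vec n, ∫ x, inner ℝ (w x) (grad ψ x) = inner ℝ w (H1.weakGrad v) :=
    fun w => by
      rw [L2Vec.inner_eq_integral]
      refine integral_congr_ae ?_
      filter_upwards [H1.weakGrad_ofSmooth hψ] with x hx
      rw [hv, hx]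
  obtain ⟨s₁, hs₁, hz⟩ := hηT
  have key := h (fun t x => η t * ψ x) (smoothOnSpaceTime_mul hη hψ)
    ⟨s₁, hs₁, fun t ht x => by rw [hz t ht, zero_mul]⟩
  have hder : ∀ t x, deriv (fun s => η s * ψ x) t = deriv η t * ψ x := fun t x => by
    rw [deriv_mul_const (hη.differentiable (by simp) t)]
  simp only [hder, grad_const_mul, inner_smul_right, mul_left_comm _ (η _),
    mul_left_comm _ (deriv η _), integral_const_mul, hinner] at key
  have hslice : ∀ᵐ t ∂(timeMeasure T),
      ∫ x, (-(deriv η t * (H1.toL2 (ρ t) x * ψ x)) + η t * inner ℝ (H1.weakGrad (ρ t) x) (grad ψ x) -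
        η t * (H1.toL2 (ρ t) x * inner ℝ (b t x) (grad ψ x))) =
      -(deriv η t * inner ℝ (H1.toL2 (ρ t)) (H1.toL2 v)) +
        η t * (inner ℝ (H1.weakGrad (ρ t)) (H1.weakGrad v) -
        ∫ x, H1.toL2 (ρ t) x * inner ℝ (b t x) (grad ψ x)) := by
    filter_upwards [hb.ae_memLp le_rfl] with t ht
    have i1 : Integrable (fun x => H1.toL2 (ρ t) x * ψ x) := integrable_L2_mul _ hψ.continuous
    have i2 : Integrable (fun x => inner ℝ (H1.weakGrad (ρ t) x) (grad ψ x)) :=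
      integrable_inner_of_memLp (Lp.memLp _) (hψ.continuous_grad.memLp_torus 2)
    have i3 : Integrable (fun x => H1.toL2 (ρ t) x * inner ℝ (b t x) (grad ψ x)) :=
      MemLp.integrable_mul (p := 2) (q := 2) (Lp.memLp _) (memLp_inner_grad ht hψ)
    rw [integral_sub (((i1.const_mul _).fun_neg).fun_add (i2.const_mul _)) (i3.const_mul _),
      integral_add (i1.const_mul _).fun_neg (i2.const_mul _), integral_neg, integral_const_mul,
      integral_const_mul, integral_const_mul, hinner, hinnerG]
    ring
  rw [integral_congr_ae hslice] at key
  have j1 : Integrable (fun t => deriv η t * inner ℝ (H1.toL2 (ρ t)) (H1.toL2 v)) (timeMeasure T) :=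
    integrable_continuous_mul (hη.continuous_deriv (by simp)) (integrable_inner_toL2 hρ _)
  have j2 : Integrable (fun t => inner ℝ (H1.weakGrad (ρ t)) (H1.weakGrad v)) (timeMeasure T) :=
    Integrable.inner_const (𝕜 := ℝ)
      ((H1.weakGradL n).integrable_comp (hρ.integrable (by norm_num))) _
  have j3 := integrable_continuous_mul hη.continuous (j2.sub (integrable_transport hb hρ hR hψ))
  simp only [Pi.sub_apply] at j3
  rw [integral_add j1.fun_neg j3, integral_neg] at key
  linarith

theorem exists_smooth_cutoff {T : ℝ} (hT : 0 < T) : ∃ η : ℝ → ℝ, ContDiff ℝ ∞ η ∧ η 0 = 1 ∧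
    ∃ s₁ < T, ∀ t, s₁ < t → η t = 0 := by
  let f : ContDiffBump (0 : ℝ) := ⟨T / 4, T / 2, by linarith, by linarith⟩
  refine ⟨f, f.contDiff, f.one_of_mem_closedBall (by simp [f]; linarith), T / 2, by linarith,
    fun t ht => f.zero_of_le_dist ?_⟩
  rw [Real.dist_eq, sub_zero]
  exact ht.le.trans (le_abs_self _)

/-- The equation on almost every time slice, and the initial condition. -/
theorem IsWeakSolution.ae_slice_and_initial (h : IsWeakSolution T b ρ₀ ρ) (hT : 0 < T)
    (hb : MemMixed T 1 2 b) (hρ : MemLp ρ 2 (timeMeasure T)) {R : ℝ}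
    (hR : ∀ᵐ t ∂(timeMeasure T), ‖H1.toL2 (ρ t)‖ ≤ R) {g : ℝ → HNeg1 n}
    (hg : MemLp g 2 (timeMeasure T)) {u : ℝ → L2 n}
    (hu : ∀ᵐ t ∂(timeMeasure T), u t = H1.toL2 (ρ t))
    (hug : ∀ v : H1 n, ∀ t ∈ Icc 0 T, inner ℝ (u t) (H1.toL2 v) =
        inner ℝ (u 0) (H1.toL2 v) + ∫ x in (0 : ℝ)..t, g x v)
    {ψ : Torus n → ℝ} (hψ : SmoothOnTorus ψ) :
    (∀ᵐ t ∂(timeMeasure T), g t (H1.ofSmooth ψ hψ) +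
      (inner ℝ (H1.weakGrad (ρ t)) (H1.weakGrad (H1.ofSmooth ψ hψ)) -
        ∫ x, H1.toL2 (ρ t) x * inner ℝ (b t x) (grad ψ x)) = 0) ∧
    inner ℝ (u 0) (H1.toL2 (H1.ofSmooth ψ hψ)) = inner ℝ ρ₀ (H1.toL2 (H1.ofSmooth ψ hψ)) := by
  set v := H1.ofSmooth ψ hψ with hv
  have hgi : Integrable (fun t => g t v) (timeMeasure T) := integrable_dual_apply_const hg v
  have j2 : Integrable (fun t => inner ℝ (H1.weakGrad (ρ t)) (H1.weakGrad v)) (timeMeasure T) :=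
    Integrable.inner_const (𝕜 := ℝ)
      ((H1.weakGradL n).integrable_comp (hρ.integrable (by norm_num))) _
  have j3 := j2.sub (integrable_transport hb hρ hR hψ)
  simp only [Pi.sub_def] at j3
  -- The weak formulation is compared with integration by parts of t ↦ ⟨u(t), v⟩. For η vanishing at
  -- 0 this gives the slice equation; otherwise the boundary term compares u(0) with ρ₀.
  have key : ∀ η : ℝ → ℝ, ContDiff ℝ ∞ η → (∃ s₁ < T, ∀ t, s₁ < t → η t = 0) →
      ∫ t, η t * (g t v + (inner ℝ (H1.weakGrad (ρ t)) (H1.weakGrad v) -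
        ∫ x, H1.toL2 (ρ t) x * inner ℝ (b t x) (grad ψ x))) ∂(timeMeasure T) =
      η 0 * (inner ℝ ρ₀ (H1.toL2 v) - inner ℝ (u 0) (H1.toL2 v)) := by
    intro η hη hηT
    have e1 := h.tested hb hρ hR hψ hη hηT
    rw [← hv] at e1
    obtain ⟨s₁, hs₁, hz⟩ := hηT
    have e2 := integral_deriv_mul_primitive hT.le hgi (inner ℝ (u 0) (H1.toL2 v)) hη (hz T hs₁)
    have e3 : ∫ t, deriv η t * inner ℝ (H1.toL2 (ρ t)) (H1.toL2 v) ∂(timeMeasure T) =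
        ∫ t, deriv η t * (inner ℝ (u 0) (H1.toL2 v) + ∫ x in (0 : ℝ)..t, g x v)
          ∂(timeMeasure T) := by
      refine integral_congr_ae ?_
      filter_upwards [hu, ae_restrict_mem measurableSet_Ioo] with t h1 h2
      rw [← h1, hug v t (Ioo_subset_Icc_self h2)]
    simp only [mul_add]
    rw [integral_add (integrable_continuous_mul hη.continuous hgi)
      (integrable_continuous_mul hη.continuous j3)]
    linarith
  have hae : ∀ᵐ t ∂(timeMeasure T), g t v +
      (inner ℝ (H1.weakGrad (ρ t)) (H1.weakGrad v) -
      ∫ x, H1.toL2 (ρ t) x * inner ℝ (b t x) (grad ψ x)) = 0 :=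
    ae_eq_zero_of_forall_test (hgi.add j3) fun η h1 h2 h3 => by
      obtain ⟨s₀, s₁, e1, -, e3, e4⟩ := exists_Icc_of_isCompact_subset_Ioo hT h2.isCompact h3
      have hη0 : η 0 = 0 := image_eq_zero_of_notMem_tsupport fun h => lt_irrefl _ (h3 h).1
      have := key η h1 ⟨s₁, e3, fun t ht => image_eq_zero_of_notMem_tsupport fun h =>
        absurd (e4 h).2 (not_le.2 ht)⟩
      rw [hη0, zero_mul] at this
      exact this
  refine ⟨hae, ?_⟩
  obtain ⟨η, h1, h2, h3⟩ := exists_smooth_cutoff hT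
  have e := key η h1 h3
  rw [h2, one_mul, integral_eq_zero_of_ae] at e
  · linarith
  · filter_upwards [hae] with t ht
    rw [ht, mul_zero]; rfl

end WeakSolution

/-! ### Energy identity on slices and a priori bounds -/

/-- The energy identity on a time slice, when the equation and the divergence identity are known
for a `C¹`-dense set of test functions. -/
theorem slice_energy_eq {S : Set (Torus n → ℝ)} (hS : ∀ ψ ∈ S, SmoothOnTorus ψ)
    (hdense : ∀ φ : Torus n → ℝ, SmoothOnTorus φ → ∀ ε > 0, ∃ ψ ∈ S, ∀ x,
      |ψ x - φ x| < ε ∧ ∀ i, |partialDeriv i ψ x - partialDeriv i φ x| < ε)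
    {b : Torus n → Vec n} {d : Torus n → ℝ} (hb : MemLp b 2 volume) (hd : Integrable d) {C : ℝ}
    (hC : ∀ w : H1 n, Integrable (fun x => |d x| * H1.toL2 w x ^ 2) ∧
      ∫ x, |d x| * H1.toL2 w x ^ 2 ≤ C * ‖w‖ ^ 2)
    (hdiv : ∀ ψ ∈ S, (∫ x, inner ℝ (b x) (grad ψ x)) + ∫ x, d x * ψ x = 0)
    (γ : HNeg1 n) (v : H1 n)
    (heq : ∀ ψ, ∀ h : ψ ∈ S, γ (H1.ofSmooth ψ (hS ψ h)) +
      (inner ℝ (H1.weakGrad v) (H1.weakGrad (H1.ofSmooth ψ (hS ψ h))) -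
        ∫ x, H1.toL2 v x * inner ℝ (b x) (grad ψ x)) = 0) :
    γ v + ‖H1.weakGrad v‖ ^ 2 = -(1 / 2) * ∫ x, d x * H1.toL2 v x ^ 2 := by
  have hbi : Integrable b := hb.integrable (by norm_num)
  have hA : ∀ ψ, SmoothOnTorus ψ → ∫ x, inner ℝ (b x) (grad ψ x) = -∫ x, d x * ψ x :=
    fun ψ hψ => eq_neg_of_add_eq_zero_left (eq_zero_of_dense_smooth hS hdense hbi hd hdiv hψ)
  obtain ⟨α, β, hαβ⟩ := H1.exists_riesz γ
  have hαi : Integrable α := (Lp.memLp α).integrable (by norm_num)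
  have hvb : Integrable (fun x => H1.toL2 v x • b x) := by
    have : MemLp (fun x => H1.toL2 v x • b x) 1 volume := hb.smul (Lp.memLp (H1.toL2 v))
    exact memLp_one_iff_integrable.1 this
  have hβi : Integrable (fun x => β x + H1.weakGrad v x) :=
    ((Lp.memLp β).integrable (by norm_num)).add ((Lp.memLp (H1.weakGrad v)).integrable (by norm_num))
  have hsplit : ∀ ψ, ∀ hψ : SmoothOnTorus ψ,
      γ (H1.ofSmooth ψ hψ) + (inner ℝ (H1.weakGrad v) (H1.weakGrad (H1.ofSmooth ψ hψ)) -
        ∫ x, H1.toL2 v x * inner ℝ (b x) (grad ψ x)) =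
      (∫ x, inner ℝ (β x + H1.weakGrad v x - H1.toL2 v x • b x) (grad ψ x)) +
        ∫ x, α x * ψ x := by
    intro ψ hψ
    have hg2 := hψ.continuous_grad.memLp_torus (n := n) 2
    have i1 := integrable_inner_of_memLp (Lp.memLp β) hg2
    have i2 := integrable_inner_of_memLp (Lp.memLp (H1.weakGrad v)) hg2
    have i3 : Integrable (fun x => H1.toL2 v x * inner ℝ (b x) (grad ψ x)) :=
      MemLp.integrable_mul (p := 2) (q := 2) (Lp.memLp _) (memLp_inner_grad hb hψ)
    simp only [inner_sub_left, inner_add_left, real_inner_smul_left]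
    rw [integral_sub (i1.fun_add i2) i3, integral_add i1 i2, hαβ, L2Vec.inner_eq_integral]
    have e1 : ∫ x, α x * H1.toL2 (H1.ofSmooth ψ hψ) x = ∫ x, α x * ψ x := by
      refine integral_congr_ae ?_
      filter_upwards [H1.toL2_ofSmooth hψ] with x hx
      rw [hx]
    have e2 : ∀ w : L2Vec n, ∫ x, inner ℝ (w x) (H1.weakGrad (H1.ofSmooth ψ hψ) x) =
        ∫ x, inner ℝ (w x) (grad ψ x) := fun w => by
      refine integral_congr_ae ?_
      filter_upwards [H1.weakGrad_ofSmooth hψ] with x hx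
      rw [hx]
    rw [e1, e2, e2]
    ring
  have hB : ∀ ψ, ∀ hψ : SmoothOnTorus ψ,
      γ (H1.ofSmooth ψ hψ) + (inner ℝ (H1.weakGrad v) (H1.weakGrad (H1.ofSmooth ψ hψ)) -
        ∫ x, H1.toL2 v x * inner ℝ (b x) (grad ψ x)) = 0 := by
    intro ψ hψ
    rw [hsplit]
    refine eq_zero_of_dense_smooth hS hdense (hβi.sub hvb) hαi (fun χ hχ => ?_) hψ
    have := heq χ hχ
    rw [hsplit] at this
    exact this
  -- The slice equation says that ψ ↦ ∫ v b·Dψ agrees on smooth ψ with γ + ⟨Dv, D·⟩, which is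
  -- bounded on H¹: this is the functional L required.
  have := pairing_eq_half_integral_div hb hd hC hA v
    (γ + (innerSL ℝ (H1.weakGrad v)).comp (H1.weakGradL n)) (fun ψ hψ => by
      have := hB ψ hψ
      simp only [_root_.add_apply, ContinuousLinearMap.comp_apply,
        innerSL_apply_apply, H1.weakGradL_apply]
      linarith)
  simpa only [_root_.add_apply, ContinuousLinearMap.comp_apply,
        innerSL_apply_apply, H1.weakGradL_apply, real_inner_self_eq_norm_sq] using this

/-- For n ≥ 2 the bound on q follows from q > n/2 ≥ 1. -/
theorem AdmissibleExponents.one_le {q r : ℝ≥0∞} (h : AdmissibleExponents n q r) :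
    1 ≤ q ∧ 1 ≤ r ∧ r ≠ ⊤ := by
  rcases h.2 with ⟨h1, h2, h3, h4⟩ | ⟨-, h2, h3, h4⟩
  · refine ⟨le_trans ?_ h4.le, h2, h3.ne⟩
    rw [ENNReal.le_div_iff_mul_le (by simp) (by simp), one_mul]
    exact_mod_cast h1
  · exact ⟨h4, h2, (h3.trans_lt (by simp)).ne⟩

theorem AdmissibleExponents.toReal {q r : ℝ≥0∞} (h : AdmissibleExponents n q r) :
    (n : ℝ) / 2 * q.toReal⁻¹ + r.toReal⁻¹ ≤ 1 := by
  have h1 : (n : ℝ≥0∞) / (2 * q) ≠ ⊤ := ne_top_of_le_ne_top ENNReal.one_ne_top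
    (le_self_add.trans h.1)
  have h2 : 1 / r ≠ ⊤ := ne_top_of_le_ne_top ENNReal.one_ne_top (le_add_self.trans h.1)
  have := ENNReal.toReal_mono ENNReal.one_ne_top h.1
  rw [ENNReal.toReal_add h1 h2] at this
  simp only [ENNReal.toReal_div, ENNReal.toReal_mul, ENNReal.toReal_natCast, ENNReal.toReal_ofNat,
    ENNReal.toReal_one, one_div, ENNReal.toReal_inv] at this
  rwa [div_mul_eq_div_div, div_eq_mul_inv _ q.toReal] at this

theorem L2.ext_modes {u v : L2 n}
    (h : ∀ i, inner ℝ u (H1.toL2 (modeH1 i)) = inner ℝ v (H1.toL2 (modeH1 i))) : u = v := by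
  have h1 := isParsevalFrame_modeL2 (u - v)
  simp only [inner_sub_left, h, sub_self, ne_eq, OfNat.ofNat_ne_zero, not_false_eq_true,
    zero_pow] at h1
  have h2 : ‖u - v‖ ^ 2 = 0 := h1.unique hasSum_zero
  exact sub_eq_zero.1 (norm_eq_zero.1 (pow_eq_zero_iff two_ne_zero |>.1 h2))

/-- The a priori bounds that follow from the differential energy inequality. -/
theorem energy_bounds {T K m₂ : ℝ} (hT : 0 ≤ T) (hK : 0 ≤ K) {E e D A : ℝ → ℝ}
    (he : Integrable e (timeMeasure T)) (hA : Integrable A (timeMeasure T))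
    (hD : Integrable D (timeMeasure T)) (hA0 : ∀ t, 0 ≤ A t) (hE0 : ∀ t, 0 ≤ E t) (hm : 0 ≤ m₂)
    (hmE : m₂ ≤ E 0) (hE : ∀ t ∈ Icc 0 T, E t = E 0 + ∫ x in (0 : ℝ)..t, e x)
    (hle : ∀ᵐ t ∂(timeMeasure T), e t + D t ≤ K * (1 + A t) * m₂ + K * A t * E t)
    (hpoin : ∀ᵐ t ∂(timeMeasure T), E t - m₂ ≤ D t) :
    (∀ t ∈ Icc 0 T, E t ≤ Real.exp (K * ∫ t, A t ∂(timeMeasure T)) * (K + 4) * E 0) ∧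
    ∫ t, D t ∂(timeMeasure T) ≤ (1 + K * (T + ∫ t, A t ∂(timeMeasure T)) +
      K * (∫ t, A t ∂(timeMeasure T)) *
        (Real.exp (K * ∫ t, A t ∂(timeMeasure T)) * (K + 4))) * E 0 := by
  set I := ∫ t, A t ∂(timeMeasure T) with hI
  have hI0 : 0 ≤ I := integral_nonneg hA0
  have hbound : ∀ t ∈ Icc 0 T, E t ≤ Real.exp (K * I) * (K + 4) * E 0 := by
    intro t ht
    -- Adding m₂ to E moves the term K A m₂, which is integrable but not bounded in time, into the
    -- Grönwall factor. The leftover constant is K m₂ + 2 m₂: one m₂ from Poincaré's inequality, one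
    -- from the damping of the shift.
    have h := gronwall_damped (F := fun t => E t + m₂) (κ := fun t => K * A t)
      (c := (K + 2) * m₂) he (hA.const_mul K) (fun t => mul_nonneg hK (hA0 t)) (by positivity)
      (fun t _ => add_nonneg (hE0 t) hm) (fun t ht => by rw [hE t ht]; ring)
      (by filter_upwards [hle, hpoin] with t h1 h2; linarith) ht
    rw [integral_const_mul, ← hI] at h
    have h2 : E 0 + m₂ + (K + 2) * m₂ ≤ (K + 4) * E 0 := by nlinarith
    rw [mul_assoc]
    linarith [mul_le_mul_of_nonneg_left h2 (Real.exp_pos (K * I)).le]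
  refine ⟨hbound, ?_⟩
  set B := Real.exp (K * I) * (K + 4) with hB
  have hB0 : 0 ≤ B := by positivity
  have hT' : T ∈ Icc 0 T := ⟨hT, le_rfl⟩
  -- Integrated over (0,T), the term -e contributes E(0) - E(T) ≤ E(0); E and m₂ are replaced by
  -- their bounds through E(0).
  have h1 : ∀ᵐ t ∂(timeMeasure T), D t ≤ K * E 0 + (K * E 0 + K * (B * E 0)) * A t - e t := by
    filter_upwards [hle, ae_restrict_mem measurableSet_Ioo] with t h1 h2
    have h3 := hbound t (Ioo_subset_Icc_self h2)
    have h4 := mul_le_mul_of_nonneg_left h3 (mul_nonneg hK (hA0 t))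
    have h5 := mul_le_mul_of_nonneg_left hmE
      (mul_nonneg hK (by linarith [hA0 t] : 0 ≤ 1 + A t))
    nlinarith
  have h2 := integral_mono_ae hD
    (((integrable_const (K * E 0)).add (hA.const_mul (K * E 0 + K * (B * E 0)))).sub he) h1
  have hvol : (timeMeasure T).real univ = T := by simp [timeMeasure, Measure.real, hT]
  simp only [Pi.sub_apply, Pi.add_apply] at h2
  rw [integral_sub ((integrable_const (K * E 0)).fun_add
    (hA.const_mul (K * E 0 + K * (B * E 0)))) he, integral_add (integrable_const _)
    (hA.const_mul _), integral_const, integral_const_mul, hvol, smul_eq_mul, ← hI,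
    integral_timeMeasure hT e] at h2
  have h3 := hE T hT'
  have h4 := hE0 T
  nlinarith

end FokkerPlanck

end

/-! ### Proof of the theorem -/

open FokkerPlanck Filter Topology in
theorem mainTheorem1 (n : ℕ) (q r : ℝ≥0∞) (hqr : FokkerPlanck.AdmissibleExponents n q r) :
    ∃ (C₁ : ℝ → ℝ) (C₂ : ℝ → ℝ → ℝ),
      ∀ (T : ℝ), 0 < T →
      ∀ (b : ℝ → FokkerPlanck.Torus n → FokkerPlanck.Vec n) (d : ℝ → FokkerPlanck.Torus n → ℝ),
        FokkerPlanck.MemMixed T 1 2 b →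
        FokkerPlanck.IsWeakDiv T b d →
        FokkerPlanck.MemMixed T r q d →
      ∀ (ρ₀ : FokkerPlanck.L2 n) (ρ : ℝ → FokkerPlanck.H1 n),
        FokkerPlanck.InParabolicClass T ρ →
        FokkerPlanck.IsWeakSolution T b ρ₀ ρ →
        (∃ u : ℝ → FokkerPlanck.L2 n,
          ContinuousOn u (Icc 0 T) ∧
          (∀ᵐ t ∂(FokkerPlanck.timeMeasure T), u t = FokkerPlanck.H1.toL2 (ρ t)) ∧
          u 0 = ρ₀ ∧
          ∀ t ∈ Icc 0 T, ‖u t‖ ≤ C₁ (FokkerPlanck.mixedNorm T r q d).toReal * ‖ρ₀‖) ∧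
        ∫ t, (∫ x, ‖FokkerPlanck.H1.weakGrad (ρ t) x‖ ^ 2) ∂(FokkerPlanck.timeMeasure T) ≤
          C₂ (FokkerPlanck.mixedNorm T r q d).toReal T * ‖ρ₀‖ ^ 2 := by
  obtain ⟨hq, hr, hr_top⟩ := hqr.one_le
  have hr0 : r ≠ 0 := (zero_lt_one.trans_le hr).ne'
  have hr1 : 1 ≤ r.toReal := by simpa using ENNReal.toReal_mono hr_top hr
  have hexp := hqr.toReal
  have hs : (n : ℝ) / 2 * q.toReal⁻¹ < 1 := by
    have : 0 < r.toReal⁻¹ := by positivity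
    linarith
  obtain ⟨K, hK, hKbound⟩ := exists_weighted_energy_bound hq hr1 hexp
  obtain ⟨C, hC0, hC⟩ := exists_weighted_gagliardoNirenberg hq hs
  -- B bounds the ratio of squared L² norms, so its square root serves as C₁. Here M^r is the time
  -- integral of ‖div(b)‖_q^r.
  set B : ℝ → ℝ := fun M => Real.exp (K * M ^ r.toReal) * (K + 4) with hB
  refine ⟨fun M => √(B M),
    fun M T => 1 + K * (T + M ^ r.toReal) + K * M ^ r.toReal * B M, ?_⟩
  intro T hT b d hb hdiv hd ρ₀ ρ hρ hsol
  obtain ⟨hρ2, g, hg, hgρ⟩ := hρ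
  obtain ⟨u, huc, huρ, henergy, hpair⟩ := hgρ.exists_continuous_representative hT hρ2 hg
  have h0T : (0 : ℝ) ∈ Icc 0 T := ⟨le_rfl, hT.le⟩
  obtain ⟨R, hR⟩ := isCompact_Icc.exists_bound_of_continuousOn huc
  have hRρ : ∀ᵐ t ∂(timeMeasure T), ‖H1.toL2 (ρ t)‖ ≤ R := by
    filter_upwards [huρ, ae_restrict_mem measurableSet_Ioo] with t h1 h2
    rw [← h1]
    exact hR t (Ioo_subset_Icc_self h2)
  have hslice := fun (ψ : Torus n → ℝ) (hψ : SmoothOnTorus ψ) =>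
    hsol.ae_slice_and_initial hT hb hρ2 hRρ hg huρ hpair hψ
  have hu0 : u 0 = ρ₀ := L2.ext_modes fun i => (hslice _ (smooth_mode i)).2
  -- conservation of the mean
  set z : ModeIndex n := (0, true) with hz
  have hgrad : ∀ x, grad (mode z) x = 0 := by
    intro x
    have : mode z = fun _ : Torus n => (1 : ℝ) := funext mode_zero_true
    ext i
    simp [this, grad_apply, partialDeriv]
  have hgz : ∀ᵐ t ∂(timeMeasure T), g t (modeH1 z) = 0 := by
    have hwg : H1.weakGrad (modeH1 z) = 0 := by
      apply Lp.ext
      refine (H1.weakGrad_ofSmooth (smooth_mode z)).trans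
        (EventuallyEq.trans ?_ (Lp.coeFn_zero _ _ _).symm)
      exact Eventually.of_forall hgrad
    filter_upwards [(hslice _ (smooth_mode z)).1] with t ht
    change g t (modeH1 z) + (inner ℝ _ (H1.weakGrad (modeH1 z)) - _) = 0 at ht
    rw [hwg] at ht
    simpa [hgrad] using ht
  have hmean : ∀ᵐ t ∂(timeMeasure T), ∫ x, H1.toL2 (ρ t) x = ∫ x, ρ₀ x := by
    filter_upwards [huρ, ae_restrict_mem measurableSet_Ioo] with t h1 h2
    have ht := Ioo_subset_Icc_self h2
    have h3 := hpair (modeH1 z) t ht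
    rw [intervalIntegral_congr_timeMeasure (g := fun _ => 0) hgz h0T ht,
      intervalIntegral.integral_zero, add_zero, hu0, h1, inner_toL2_modeH1, inner_toL2_modeH1,
      modeCoeff_zero_true, modeCoeff_zero_true] at h3
    exact h3
  -- Bessel's inequality for the constant mode alone.
  have hmρ₀ : (∫ x, ρ₀ x) ^ 2 ≤ ‖ρ₀‖ ^ 2 := by
    have := isParsevalFrame_modeL2.sum_sq_le {z} ρ₀
    simpa [inner_toL2_modeH1, hz, modeCoeff_zero_true] using this
  -- the energy inequality on almost every time slice
  obtain ⟨S, hSc, hSs, hSd⟩ := exists_countable_dense_smooth n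
  -- The exceptional null set of times depends on ψ; countability of S yields a common one, and
  -- density recovers all smooth ψ on each remaining slice.
  have hdivS : ∀ᵐ t ∂(timeMeasure T), ∀ ψ ∈ S,
      (∫ x, inner ℝ (b t x) (grad ψ x)) + ∫ x, d t x * ψ x = 0 :=
    (ae_ball_iff hSc).2 fun ψ hψ => hdiv.ae_slice hT (hb.integrable le_rfl (by norm_num))
      (hd.integrable hr hq) (hSs ψ hψ)
  have heqS := (ae_ball_iff hSc).2 fun ψ hψ => (hslice ψ (hSs ψ hψ)).1
  set a : ℝ → ℝ := fun t => (eLpNorm (d t) q volume).toReal ^ r.toReal with ha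
  -- Doubling the slice identity leaves 2‖Dρ‖² on the left. One copy absorbs the gradient term of
  -- the weighted bound, the other stays as damping.
  have hineq : ∀ᵐ t ∂(timeMeasure T), 2 * g t (ρ t) + ‖H1.weakGrad (ρ t)‖ ^ 2 ≤
      K * (1 + a t) * (∫ x, ρ₀ x) ^ 2 + K * a t * ‖u t‖ ^ 2 := by
    filter_upwards [hdivS, heqS, hb.ae_memLp le_rfl, hd.ae_memLp hr, huρ, hmean] with
      t h1 h2 h3 h4 h5 h6
    have hCt : ∀ w : H1 n, Integrable (fun x => |d t x| * H1.toL2 w x ^ 2) ∧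
        ∫ x, |d t x| * H1.toL2 w x ^ 2 ≤ C * (eLpNorm (d t) q volume).toReal * ‖w‖ ^ 2 := by
      intro w
      have := hC (d t) h4 w 1 le_rfl
      rwa [Real.one_rpow, Real.one_rpow, one_mul, one_mul, ← H1.norm_sq_eq] at this
    have e1 := slice_energy_eq hSs hSd h3 (h4.integrable hq) hCt h1 (g t) (ρ t) h2
    have e2 := hKbound (d t) h4 (ρ t)
    have e3 : -∫ x, d t x * H1.toL2 (ρ t) x ^ 2 ≤ ∫ x, |d t x| * H1.toL2 (ρ t) x ^ 2 := by
      have h7 := norm_integral_le_integral_norm (μ := volume)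
        fun x => d t x * H1.toL2 (ρ t) x ^ 2
      simp only [norm_mul, Real.norm_eq_abs, abs_sq] at h7
      exact (neg_le_abs _).trans h7
    rw [h6] at e2
    rw [h5]
    linarith
  have hgi : Integrable (fun t => g t (ρ t)) (timeMeasure T) :=
    integrable_dual_apply hρ2 hg hρ2.1 fun _ => le_rfl
  have hDi : Integrable (fun t => ‖H1.weakGrad (ρ t)‖ ^ 2) (timeMeasure T) :=
    ((H1.weakGradL n).comp_memLp' hρ2).norm.integrable_sq
  have hbounds := energy_bounds (E := fun t => ‖u t‖ ^ 2) (m₂ := (∫ x, ρ₀ x) ^ 2) hT.le hK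
    (hgi.const_mul 2) (hd.integrable_rpow hr0 hr_top) hDi
    (fun t => by positivity) (fun t => by positivity) (sq_nonneg _) (by rw [hu0]; exact hmρ₀)
    (fun t ht => by
      rw [intervalIntegral.integral_const_mul, ← henergy 0 h0T t ht]; ring) hineq
    (by
      filter_upwards [huρ, hmean] with t h1 h2
      rw [h1, ← h2]
      exact norm_toL2_sq_sub_mean_sq_le _)
  rw [hd.integral_rpow hr0 hr_top, hu0] at hbounds
  refine ⟨⟨u, huc, huρ, hu0, fun t ht => ?_⟩, ?_⟩
  · refine abs_le_of_sq_le_sq' ?_ (by positivity) |>.2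
    rw [mul_pow, Real.sq_sqrt (by positivity)]
    exact hbounds.1 t ht
  · simp only [← L2Vec.norm_sq_eq_integral]
    exact hbounds.2
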